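/- **Setting.** Let $G=(V,E)$ be a finite directed graph (parallel arcs and digons are allowed) with distinct nodes $s,t$. Each arc $e=vw$ has a capacity $\nu_e\ge 0$ and a delay $\tau_e\ge 0$, and every directed cycle of $G$ has positive total delay. Let $\alpha>0$, and let $\rho:\mathbb R\to[0,\infty)$ be lower semicontinuous, strictly decreasing on $(-\infty,0]$, strictly increasing on $[0,\infty)$, with $\rho(0)=0$, $\rho(\theta)\to\infty$ as $\theta\to\pm\infty$, and $\theta\mapsto\rho(\theta)+\alpha\theta$ nondecreasing. **The flow $f$, the potentials $\pi$ and the tolls $\delta$.** Consider a terminating run of the successive shortest paths algorithm: $f^{(0)}=0$; for $j=1,\dots,m$, $P_j$ is any shortest $s$-$t$-path (with respect to $\tau$, where backward arcs have negated delay) in the residual network $G_{j-1}$ of $f^{(j-1)}$, $x_j$ is its minimum residual capacity, and $f^{(j)}=f^{(j-1)}+x_j\chi(P_j)$; and $G_m$ has no $s$-$t$-path. Let $d_j(v,w)\in(-\infty,\infty]$ be the length of a shortest $v$-$w$-path in $G_j$. Fix a cost horizon $C\in\mathbb R$ and let $I_j=\{\xi:\rho(\xi+d_{j-1}(s,t))\le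 C-\alpha d_{j-1}(s,t)\}$, a compact, possibly empty, interval. The flow over time $f$ sends flow at rate $x_j$ into $P_j$ during $I_j$: for each $j$, the rate $f_{vw}(\theta)$ of flow entering arc $vw\in E$ at time $\theta$ is increased by $x_j$ (if $P_j$ uses $vw$ forwards), respectively decreased by $x_j$ (if $P_j$ uses $vw$ backwards), for all $\theta$ with $\theta-d_{j-1}(s,v)\in I_j$. Its value is $Q=\sum_{j=1}^m x_j|I_j|$. Let $J(v,\theta)$ be the largest $j\in\{1,\dots,m\}$ with $\alpha d_{j-1}(s,t)+\rho(\theta+d_{j-1}(v,t))\le C$, and $0$ if there is none (with $\rho(\infty)=\infty$). With $J=J(v,\theta)$ put $$\pi_v(\theta)=\max\{-\alpha d_J(v,s),\; C-\alpha d_J(v,t)-\rho(\theta+d_J(v,t)),\;0\},$$ $$\delta_{vw}(\theta)=\max\{\pi_w(\theta+\tau_{vw})-\pi_v(\theta)-\alpha\tau_{vw},\,0\}.$$ **Dynamic equilibria.** In a network whose arcs have (possibly time-varying) capacities $\kappa_a(\theta)$ and tolls, users of total amount $Q$ choose a departure time and a directed $s$-$t$-path (integrable departure rates on each path). At the tail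 of each arc users queue first-in-first-out; flow enters the arc at rate $g_a(\theta)\le\kappa_a(\theta)$, with equality for almost every $\theta$ at which the queue is nonempty, and then needs time $\tau_a$ to traverse it. All users are eventually served and $g$ has compact support. A user who joins the queue of arc $a$ at time $\theta$ enters $a$ at the first time $\xi\ge\theta$ by which all flow that joined this queue up to time $\theta$ has entered $a$; this rule also applies to a single deviating user, who therefore passes an empty queue without delay. The cost of a user who departs at time $\theta$ and arrives at $t$ at time $\theta'$ is $\rho(\theta')+\alpha(\theta'-\theta)$ plus the tolls, each charged for the time at which the arc is entered. The family $g=(g_a)$ of rates is a *dynamic equilibrium of value $Q$* if it arises in this way such that almost all users have the same cost, and no choice of path and departure time has a smaller cost. **Theorem.** (1) If $g$ is a dynamic equilibrium of value $Q$ under the tolls $\delta$ in $G$ with its capacities $\nu$, and $g_e(\theta)\le f_e(\theta)$ for all $e\in E$ and $\theta\in\mathbb R$, then $g=f$, that is, $g_e(\theta)=f_e(\theta)$ for all $e\in E$ and almost every $\theta$. (2) Consequently, lane tolling strongly enforces $f$. Split each arc $e$ dynamically into a first lane with capacity $f_e(\theta)$ and toll $\delta_e(\theta)$ and a second lane with capacity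 $\nu_e-f_e(\theta)$ and constant toll $M$. There is a number $M_0\ge 0$ such that for every $M\ge M_0$: sending $f$ along the first lanes and nothing along the second lanes is a dynamic equilibrium of value $Q$, and every dynamic equilibrium of value $Q$ of the network with lanes has, for almost every $\theta$, rate $f_e(\theta)$ on the first lane and rate $0$ on the second lane of every arc $e$. -/

import Mathlib

open MeasureTheory Set

noncomputable section

namespace LaneTolls

/-! ### Directed (multi)graphs, given by the tail and head maps of a type of arcs -/

/-- `IsWalk src tgt u v l`: the list of arcs `l` is a directed walk from `u` to `v`. -/
def IsWalk {V A : Type*} (src tgt : A → V) : V → V → List A → Prop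
  | u, v, [] => u = v
  | u, v, a :: l => src a = u ∧ IsWalk src tgt (tgt a) v l

/-- `IsPath src tgt u v l`: the list of arcs `l` is a directed path from `u` to `v`, that is,
a directed walk that visits no vertex twice. -/
def IsPath {V A : Type*} (src tgt : A → V) (u v : V) (l : List A) : Prop :=
  IsWalk src tgt u v l ∧ (u :: l.map tgt).Nodup

theorem finite_setOf_isPath {V A : Type*} [Finite A] (src tgt : A → V) (u v : V) :
    {l : List A | IsPath src tgt u v l}.Finite := by
  classical
  have := Fintype.ofFinite A
  have h : (Set.range (Subtype.val : {l : List A // l.Nodup} → List A)).Finite :=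
    Set.finite_range _
  refine h.subset ?_
  rintro l ⟨-, hl⟩
  exact ⟨⟨l, (List.nodup_cons.1 hl).2.of_map _⟩, rfl⟩

/-! ### Networks, residual networks and the successive shortest paths algorithm -/

/-- A network: every arc has a tail `src`, a head `tgt`, a capacity and a delay. -/
structure Network (V E : Type*) where
  src : E → V
  tgt : E → V
  cap : E → ℝ
  delay : E → ℝ
  cap_nonneg : ∀ e, 0 ≤ cap e
  delay_nonneg : ∀ e, 0 ≤ delay e

namespace Network

variable {V E : Type*} (N : Network V E)

/-- Every directed cycle has positive total delay. -/
def NoZeroDelayCycle : Prop :=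
  ∀ (v : V) (l : List E), l ≠ [] → IsWalk N.src N.tgt v v l → 0 < (l.map N.delay).sum

/-- Tail of a potential residual arc: `(e, true)` is the forward copy of `e`, and `(e, false)`
is its backward copy. -/
def rsrc (r : E × Bool) : V := if r.2 then N.src r.1 else N.tgt r.1

/-- Head of a potential residual arc. -/
def rtgt (r : E × Bool) : V := if r.2 then N.tgt r.1 else N.src r.1

/-- Delay of a potential residual arc; a backward arc has the negated delay. -/
def rdelay (r : E × Bool) : ℝ := if r.2 then N.delay r.1 else -N.delay r.1

/-- Residual capacity of a residual arc with respect to the static flow `f`. -/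
def rcap (f : E → ℝ) (r : E × Bool) : ℝ := if r.2 then N.cap r.1 - f r.1 else f r.1

/-- Total delay of a list of residual arcs. -/
def rlength (l : List (E × Bool)) : ℝ := (l.map N.rdelay).sum

/-- `l` is a path from `u` to `v` in the residual network of the static flow `f`, whose arcs are
the residual arcs of positive residual capacity. -/
def IsResidualPath (f : E → ℝ) (u v : V) (l : List (E × Bool)) : Prop :=
  IsPath N.rsrc N.rtgt u v l ∧ ∀ r ∈ l, 0 < N.rcap f r

/-- Length of a shortest path from `u` to `v` in the residual network of `f`
(`⊤` if there is no path). -/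
def rdist (f : E → ℝ) (u v : V) : EReal :=
  ⨅ (l : List (E × Bool)) (_ : N.IsResidualPath f u v l), ((N.rlength l : ℝ) : EReal)

end Network

open Classical in
/-- The static flow `x₀ χ(P₀) + ⋯ + x_{j-1} χ(P_{j-1})`, where a backward arc of a path counts
negatively on the arc it reverses. -/
def partialFlow {E : Type*} (P : ℕ → List (E × Bool)) (x : ℕ → ℝ) (j : ℕ) (e : E) : ℝ :=
  ∑ i ∈ Finset.range j,
    x i * ((if (e, true) ∈ P i then 1 else 0) - (if (e, false) ∈ P i then 1 else 0))

/-- A complete run of the successive shortest paths algorithm from `s` to `t`. The paths are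
`P 0, …, P (m - 1)`, so `P j` is the path number `j + 1`; it is any shortest path in the residual
network of the sum of the first `j` augmentations, and the amount `x j` is its smallest residual
capacity. The run ends because no `s`-`t`-path is left. -/
structure SSPRun {V E : Type*} (N : Network V E) (s t : V) where
  m : ℕ
  P : ℕ → List (E × Bool)
  x : ℕ → ℝ
  isPath : ∀ j < m, N.IsResidualPath (partialFlow P x j) s t (P j)
  shortest : ∀ j < m, ∀ l, N.IsResidualPath (partialFlow P x j) s t l →
    N.rlength (P j) ≤ N.rlength l
  amount : ∀ j < m, IsLeast {y | ∃ r ∈ P j, N.rcap (partialFlow P x j) r = y} (x j)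
  complete : ∀ l, ¬ N.IsResidualPath (partialFlow P x m) s t l

/-- Scheduling costs: nonnegative, zero at `0`, strongly unimodal, lower semicontinuous, with
bounded sublevel sets, and satisfying the growth bound. -/
structure IsSchedulingCost (α : ℝ) (ρ : ℝ → ℝ) : Prop where
  nonneg : ∀ θ, 0 ≤ ρ θ
  zero : ρ 0 = 0
  strictAntiOn : StrictAntiOn ρ (Iic 0)
  strictMonoOn : StrictMonoOn ρ (Ici 0)
  lowerSemicontinuous : LowerSemicontinuous ρ
  tendsto_atTop : Filter.Tendsto ρ Filter.atTop Filter.atTop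
  tendsto_atBot : Filter.Tendsto ρ Filter.atBot Filter.atTop
  growth : Monotone fun θ => ρ θ + α * θ

/-- `ρ (θ + d)` for a possibly infinite `d`, with `ρ ∞ = ∞`. -/
def rhoAt (ρ : ℝ → ℝ) (θ : ℝ) (d : EReal) : EReal :=
  if d = ⊤ then ⊤ else ((ρ (θ + d.toReal) : ℝ) : EReal)

namespace SSPRun

variable {V E : Type*} {N : Network V E} {s t : V} (R : SSPRun N s t)

/-- The static flow after the first `j` augmentations. -/
def staticFlow (j : ℕ) : E → ℝ := partialFlow R.P R.x j

/-- Shortest path distances in the residual network after the first `j` augmentations. -/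
def dist (j : ℕ) (v w : V) : EReal := N.rdist (R.staticFlow j) v w

/-- The interval of times at which flow is sent from `s` into the path `P j`, for the cost
horizon `C`. It is empty if `α * R.dist j s t > C`. -/
def interval (α : ℝ) (ρ : ℝ → ℝ) (C : ℝ) (j : ℕ) : Set ℝ :=
  {ξ | ρ (ξ + (R.dist j s t).toReal) ≤ C - α * (R.dist j s t).toReal}

open Classical in
/-- The flow over time computed by the algorithm with cost horizon `C`: flow is sent into each path
`P j` at rate `x j` during `R.interval α ρ C j`. This flow is at the vertex `v` of the path
`R.dist j s v` time units later. A backward arc of `P j` reduces the flow on the arc `e` that it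
reverses; times on `e` are always measured at the tail of `e`. -/
def flow (α : ℝ) (ρ : ℝ → ℝ) (C : ℝ) (e : E) (θ : ℝ) : ℝ :=
  ∑ j ∈ Finset.range R.m,
    if θ - (R.dist j s (N.src e)).toReal ∈ R.interval α ρ C j then
      R.x j * ((if (e, true) ∈ R.P j then 1 else 0) - (if (e, false) ∈ R.P j then 1 else 0))
    else 0

/-- The value of the flow over time computed by the algorithm with cost horizon `C`. -/
def value (α : ℝ) (ρ : ℝ → ℝ) (C : ℝ) : ℝ :=
  ∑ j ∈ Finset.range R.m, R.x j * (volume (R.interval α ρ C j)).toReal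

/-- `c_j(v, θ) = α d_{j-1}(s, t) + ρ (θ + d_{j-1}(v, t))`, for `1 ≤ j ≤ m`. -/
def c (α : ℝ) (ρ : ℝ → ℝ) (j : ℕ) (v : V) (θ : ℝ) : EReal :=
  (α : EReal) * R.dist (j - 1) s t + rhoAt ρ θ (R.dist (j - 1) v t)

open Classical in
/-- `J(v, θ)`, the largest `j` in `{1, …, m}` with `c_j(v, θ) ≤ C`, and `0` if there is none. -/
def J (α : ℝ) (ρ : ℝ → ℝ) (C : ℝ) (v : V) (θ : ℝ) : ℕ :=
  ((Finset.Icc 1 R.m).filter fun j => R.c α ρ j v θ ≤ (C : EReal)).sup id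

/-- The dual solution, with `J = J(v, θ)`: the largest of `- α d_J(v, s)`,
`C - α d_J(v, t) - ρ (θ + d_J(v, t))` and `0`. -/
def potential (α : ℝ) (ρ : ℝ → ℝ) (C : ℝ) (v : V) (θ : ℝ) : ℝ :=
  (max (max (-((α : EReal) * R.dist (R.J α ρ C v θ) v s))
      ((C : EReal) - (α : EReal) * R.dist (R.J α ρ C v θ) v t
        - rhoAt ρ θ (R.dist (R.J α ρ C v θ) v t)))
    0).toReal

/-- The tolls `δ_{vw}(θ) = (π_w(θ + τ_{vw}) - π_v(θ) - α τ_{vw})⁺`. -/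
def toll (α : ℝ) (ρ : ℝ → ℝ) (C : ℝ) (e : E) (θ : ℝ) : ℝ :=
  max (R.potential α ρ C (N.tgt e) (θ + N.delay e) - R.potential α ρ C (N.src e) θ
    - α * N.delay e) 0

end SSPRun

/-! ### The fluid queueing model with tolls and departure time choice

In front of each arc there is a first-in-first-out queue. Flow leaves the queue, and enters the
arc, at a rate bounded by the capacity of the arc, and then traverses the arc in constant time. -/

/-- A network with tolls, in which capacities and tolls may vary over time. -/
structure TolledNetwork (V A : Type*) where
  src : A → V
  tgt : A → V
  delay : A → ℝ
  cap : A → ℝ → ℝ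
  toll : A → ℝ → ℝ

/-- The time at which a user who joins the queue of an arc at time `θ` enters the arc, if `U` is
the cumulative amount of flow that has joined the queue and `g` is the rate of flow that enters
the arc: the first time `ξ ≥ θ` at which everything that had joined the queue up to time `θ` has
entered the arc. -/
def entryTime (U g : ℝ → ℝ) (θ : ℝ) : ℝ :=
  sInf {ξ | θ ≤ ξ ∧ U θ ≤ ∫ x in Iic ξ, g x}

namespace TolledNetwork

variable {V A : Type*} (T : TolledNetwork V A)

/-- The routes, i.e. the directed paths from `s` to `t`. -/
def routes [Finite A] (s t : V) : Finset (List A) :=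
  (finite_setOf_isPath T.src T.tgt s t).toFinset

/-- The time at which a user who is at the tail of the first arc of `l` at time `θ` and follows
the arcs of `l` reaches the head of the last arc. -/
def reach (U g : A → ℝ → ℝ) : List A → ℝ → ℝ
  | [], θ => θ
  | a :: l, θ => reach U g l (entryTime (U a) (g a) θ + T.delay a)

/-- The sum of the tolls paid by this user; a toll is charged upon entering the arc. -/
def tollSum (U g : A → ℝ → ℝ) : List A → ℝ → ℝ
  | [], _ => 0
  | a :: l, θ => T.toll a (entryTime (U a) (g a) θ)
      + tollSum U g l (entryTime (U a) (g a) θ + T.delay a)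

/-- The total cost of a user who departs at time `θ` along the route `p`: scheduling cost,
commuting cost and tolls. -/
def cost (α : ℝ) (ρ : ℝ → ℝ) (U g : A → ℝ → ℝ) (p : List A) (θ : ℝ) : ℝ :=
  ρ (T.reach U g p θ) + α * (T.reach U g p θ - θ) + T.tollSum U g p θ

open Classical in
/-- `h p θ` is the rate at which users depart at time `θ` along the route `p`, `U a ξ` is the
amount of flow that has joined the queue of the arc `a` up to time `ξ`, and `g a ξ` is the rate at
which flow enters the arc `a` at time `ξ`. These describe a movement of `Q` units of flow from `s`
to `t` through the network. -/
structure IsLoading [Finite A] (s t : V) (Q : ℝ) (h : List A → ℝ → ℝ) (U g : A → ℝ → ℝ) :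
    Prop where
  departure_nonneg : ∀ p ∈ T.routes s t, ∀ θ, 0 ≤ h p θ
  departure_integrable : ∀ p ∈ T.routes s t, Integrable (h p)
  value : ∑ p ∈ T.routes s t, ∫ θ, h p θ = Q
  /-- A user with route `p` joins the queue of the arc `p[i]` when she has traversed the first
  `i` arcs of `p`. -/
  queue_inflow : ∀ a ξ, U a ξ = ∑ p ∈ T.routes s t, ∑ i : Fin p.length,
    if p.get i = a then ∫ θ in {θ | T.reach U g (p.take i) θ ≤ ξ}, h p θ else 0
  entry_nonneg : ∀ a ξ, 0 ≤ g a ξ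
  entry_le_cap : ∀ a ξ, g a ξ ≤ T.cap a ξ
  entry_integrable : ∀ a, Integrable (g a)
  entry_compact : ∃ K : ℝ, ∀ a ξ, K < |ξ| → g a ξ = 0
  /-- The length of the queue is nonnegative. -/
  queue_nonneg : ∀ a ξ, ∫ x in Iic ξ, g a x ≤ U a ξ
  /-- Everything that joins the queue enters the arc at some time. -/
  served : ∀ a ξ, U a ξ ≤ ∫ x, g a x
  /-- A nonempty queue is emptied at full capacity. -/
  full_capacity : ∀ a, ∀ᵐ ξ, ∫ x in Iic ξ, g a x < U a ξ → g a ξ = T.cap a ξ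

/-- `g` (the rates at which flow enters the arcs) is a dynamic equilibrium of value `Q`: almost
all users have the same total cost, and no departure time and route has a smaller one. -/
def IsDynamicEquilibrium [Finite A] (s t : V) (α : ℝ) (ρ : ℝ → ℝ) (Q : ℝ) (g : A → ℝ → ℝ) :
    Prop :=
  ∃ (h : List A → ℝ → ℝ) (U : A → ℝ → ℝ) (c : ℝ), T.IsLoading s t Q h U g ∧
    (∀ p ∈ T.routes s t, ∀ θ, c ≤ T.cost α ρ U g p θ) ∧
    ∀ p ∈ T.routes s t, ∀ᵐ θ, 0 < h p θ → T.cost α ρ U g p θ = c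

end TolledNetwork

/-- The network `N` with its constant capacities, under the tolls `δ`. -/
def Network.withTolls {V E : Type*} (N : Network V E) (δ : E → ℝ → ℝ) : TolledNetwork V E where
  src := N.src
  tgt := N.tgt
  delay := N.delay
  cap e _ := N.cap e
  toll := δ

/-- The network in which the capacity of each arc `e` of `N` is dynamically divided into the lanes
`(e, true)`, with capacity `f e θ` and toll `δ e θ`, and `(e, false)`, with the remaining capacity
and the constant toll `M`. -/
def Network.withLanes {V E : Type*} (N : Network V E) (f δ : E → ℝ → ℝ) (M : ℝ) :
    TolledNetwork V (E × Bool) where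
  src a := N.src a.1
  tgt a := N.tgt a.1
  delay a := N.delay a.1
  cap a θ := if a.2 then f a.1 θ else N.cap a.1 - f a.1 θ
  toll a θ := if a.2 then δ a.1 θ else M

end LaneTolls

end

open MeasureTheory Set

noncomputable section

set_option linter.unusedSectionVars false

namespace LaneTolls

/-! ### Walks and paths -/

section Walk

variable {V A : Type*} {src tgt : A → V}

/-! Uniqueness is a statement about flow conservation; that `f` is an equilibrium with lanes is
linear programming duality together with a path decomposition.

Structure of `f`. As the algorithm proceeds, distances to `t` grow (`SSPRun.dt_mono`), and so does
`d_j(s,t) - d_j(v,t)` (`SSPRun.gap_mono`, from the identity `d_{j+1}(v,s) = d_j(v,t) - d_j(s,t)` of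
`SSPRun.dist_succ_s`). With the growth bound on `ρ`, the paths whose flow can be at `v` at time `θ`
are exactly the first `J(v,θ)` ones, so at each time `f` agrees on every arc with one of the static
flows of the run. The time windows of the paths at `v` are nested: they open in increasing order of
the index and close in decreasing order. The number of openings and closings so far therefore
determines `J`. It does not decrease over time and does not increase along arcs that carry flow.
Ties are broken by a rank in the static flow, which has no directed cycles. The result is a bounded
integer `K(v,θ)` that is monotone in time and strictly decreasing along flow-carrying arcs
(`SSPRun.exists_key`).

Uniqueness (`SSPRun.flow_unique`). Let `g ≤ f` have the same value, with waiting allowed at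
vertices, and put `h = f - g ≥ 0`. Flow leaves a vertex only after arriving, so on every initial
segment of times the outflow of `g` is at most its inflow. As `f` balances exactly, `h` has at least
as much outflow as inflow there; at `t` this comes from the equality of the values. Add this up over
all vertices `v` with the segments `{θ | K(v,θ) ≤ k}`: the part of `h` whose head is in its segment
on arrival is at most the part whose tail is in its segment on entry. But wherever `h > 0`, the
latter condition implies the former, since `K` decreases. So the two parts agree almost everywhere
for each `k`, and `k` equal to the value of `K` at the head forces `h = 0`.

Existence. The potentials satisfy `π_s = 0`, `π_t ≥ C - ρ` and complementary slackness on
flow-carrying arcs (`SSPRun.potential_src_add_le`), so tolls and travel costs telescope along a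
route to a total cost of at least `C`, with equality for those who travel with `f`. To realise `f`
by departures along routes, let particles choose arcs with probabilities proportional to the flow
(`TolledNetwork.IsFlow.exists_isLoading`); `K` prevents them from returning to a vertex.

Enforcement. After the support of `f` has ended, nobody queues on a first lane, so departing then
along first lanes has a cost that depends only on the data. If `M` exceeds it for every route, then
no user takes a second lane, and uniqueness applies to the first lanes. -/

theorem isWalk_append {u w : V} {l₁ l₂ : List A} :
    IsWalk src tgt u w (l₁ ++ l₂) ↔ ∃ v, IsWalk src tgt u v l₁ ∧ IsWalk src tgt v w l₂ := by
  induction l₁ generalizing u with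
  | nil => simp [IsWalk]
  | cons a l ih => simp [IsWalk, ih, and_assoc]

theorem IsWalk.exists_split {u v x : V} {l : List A} (h : IsWalk src tgt u v l)
    (hx : x ∈ u :: l.map tgt) :
    ∃ l₁ l₂, l = l₁ ++ l₂ ∧ IsWalk src tgt u x l₁ ∧ IsWalk src tgt x v l₂ := by
  induction l generalizing u with
  | nil =>
    obtain rfl : x = u := by simpa using hx
    exact ⟨[], [], rfl, rfl, h⟩
  | cons a l ih =>
    rcases List.mem_cons.1 hx with rfl | hx
    · exact ⟨[], a :: l, rfl, rfl, h⟩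
    · obtain ⟨l₁, l₂, rfl, h₁, h₂⟩ := ih h.2 (by simpa using hx)
      exact ⟨a :: l₁, l₂, rfl, ⟨h.1, h₁⟩, h₂⟩

theorem IsWalk.mem_vertices {u v : V} {l : List A} (h : IsWalk src tgt u v l) :
    v ∈ u :: l.map tgt := by
  induction l generalizing u with
  | nil => simp_all [IsWalk]
  | cons a l ih => exact List.mem_cons_of_mem _ (by simpa using ih h.2)

theorem IsWalk.src_mem {u v : V} {l : List A} (h : IsWalk src tgt u v l) {a : A} (ha : a ∈ l) :
    src a ∈ u :: l.map tgt := by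
  induction l generalizing u with
  | nil => simp at ha
  | cons b l ih =>
    rcases List.mem_cons.1 ha with rfl | ha
    · simp [h.1]
    · exact List.mem_cons_of_mem _ (by simpa using ih h.2 ha)

theorem IsPath.suffix {u v x : V} {l₁ l₂ : List A} (h : IsPath src tgt u v (l₁ ++ l₂))
    (h₁ : IsWalk src tgt u x l₁) (h₂ : IsWalk src tgt x v l₂) : IsPath src tgt x v l₂ := by
  refine ⟨h₂, ?_⟩
  have hn := h.2
  have hx := h₁.mem_vertices
  rw [List.map_append, ← List.cons_append, List.nodup_append] at hn
  exact List.nodup_cons.2 ⟨fun hm => hn.2.2 _ hx _ hm rfl, hn.2.1⟩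

theorem isPath_self_iff {u : V} {l : List A} : IsPath src tgt u u l ↔ l = [] := by
  refine ⟨fun h => ?_, fun h => by subst h; exact ⟨rfl, by simp⟩⟩
  cases l with
  | nil => rfl
  | cons a l =>
    exact absurd (IsWalk.mem_vertices h.1.2) (by simpa using (List.nodup_cons.1 h.2).1)

theorem IsPath.tgt_ne {u v : V} {l : List A} (h : IsPath src tgt u v l) {a : A} (ha : a ∈ l) :
    tgt a ≠ u := fun he => (List.nodup_cons.1 h.2).1 (he ▸ List.mem_map_of_mem ha)

theorem IsPath.src_ne {u v : V} {l : List A} (h : IsPath src tgt u v l) {a : A} (ha : a ∈ l) :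
    src a ≠ v := by
  rintro rfl
  obtain ⟨l₁, l₂, rfl⟩ := List.append_of_mem ha
  obtain ⟨x, h₁, h₂⟩ := isWalk_append.1 h.1
  obtain rfl : src a = x := h₂.1
  have := isPath_self_iff.1 (h.suffix h₁ h₂)
  simp at this

/-- If no closed walk of admissible arcs has negative length, then every walk of admissible arcs
can be replaced with a path that is not longer. -/
theorem exists_isPath_sum_le {len : A → ℝ} {act : A → Prop}
    (hc : ∀ v l, IsWalk src tgt v v l → (∀ r ∈ l, act r) → 0 ≤ (l.map len).sum)
    {l : List A} {u v : V} (hl : IsWalk src tgt u v l) (ha : ∀ r ∈ l, act r) :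
    ∃ l', IsPath src tgt u v l' ∧ (∀ r ∈ l', act r) ∧ (l'.map len).sum ≤ (l.map len).sum := by
  induction l generalizing u with
  | nil => exact ⟨[], ⟨hl, by simp⟩, by simp, le_rfl⟩
  | cons a l ih =>
    obtain ⟨l', hl', ha', hs'⟩ := ih hl.2 fun r hr => ha r (List.mem_cons_of_mem _ hr)
    -- If the first vertex occurs again, the closed walk up to that occurrence is dropped; its
    -- length is nonnegative.
    by_cases hu : u ∈ tgt a :: l'.map tgt
    · obtain ⟨l₁, l₂, rfl, h₁, h₂⟩ := hl'.1.exists_split hu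
      refine ⟨l₂, hl'.suffix h₁ h₂, fun r hr => ha' r (by simp [hr]), ?_⟩
      have h0 := hc u (a :: l₁) ⟨hl.1, h₁⟩ (by
        intro r hr
        rcases List.mem_cons.1 hr with rfl | hr
        · exact ha _ (by simp)
        · exact ha' r (by simp [hr]))
      simp only [List.map_append, List.sum_append, List.map_cons, List.sum_cons] at *
      linarith
    · refine ⟨a :: l', ⟨⟨hl.1, hl'.1⟩, ?_⟩, ?_, ?_⟩
      · exact List.nodup_cons.2 ⟨by simpa using hu, by simpa using hl'.2⟩
      · intro r hr
        rcases List.mem_cons.1 hr with rfl | hr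
        · exact ha _ (by simp)
        · exact ha' r hr
      · simpa using hs'

open Classical in
/-- A walk leaves its first vertex, enters its last one, and is balanced at all others. -/
theorem IsWalk.sum_balance {u v : V} {l : List A} (h : IsWalk src tgt u v l) (x : V) :
    (l.map fun a => (if src a = x then (1 : ℝ) else 0) - if tgt a = x then 1 else 0).sum
      = (if u = x then 1 else 0) - if v = x then 1 else 0 := by
  induction l generalizing u with
  | nil =>
    obtain rfl : u = v := h
    simp
  | cons a l ih =>
    rw [List.map_cons, List.sum_cons, ih h.2, h.1]
    ring

end Walk

/-! ### Potentials and distances in residual networks -/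

namespace Network

variable {V E : Type*} (N : Network V E)

/-- `q` is a feasible potential of the residual network of `f`. -/
def IsPotential (f : E → ℝ) (q : V → ℝ) : Prop :=
  ∀ r, 0 < N.rcap f r → q (N.rsrc r) ≤ N.rdelay r + q (N.rtgt r)

variable {N} {f : E → ℝ} {q : V → ℝ}

/-- Telescoping along the walk. In particular closed residual walks have nonnegative length, which
is all that potentials are needed for. -/
theorem IsPotential.le_rlength (hq : N.IsPotential f q) {u v : V} {l : List (E × Bool)}
    (hl : IsWalk N.rsrc N.rtgt u v l) (ha : ∀ r ∈ l, 0 < N.rcap f r) :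
    q u ≤ N.rlength l + q v := by
  induction l generalizing u with
  | nil =>
    obtain rfl : u = v := hl
    simp [rlength]
  | cons a l ih =>
    have h1 := ih hl.2 fun r hr => ha r (List.mem_cons_of_mem _ hr)
    have h2 := hq a (ha a (by simp))
    rw [hl.1] at h2
    simp only [rlength, List.map_cons, List.sum_cons] at *
    linarith

theorem rlength_append (l₁ l₂ : List (E × Bool)) :
    N.rlength (l₁ ++ l₂) = N.rlength l₁ + N.rlength l₂ := by simp [rlength]

theorem rlength_cons (r : E × Bool) (l : List (E × Bool)) :
    N.rlength (r :: l) = N.rdelay r + N.rlength l := by simp [rlength]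

/-- Distances are defined by paths, but concatenations are only walks; this bridges the two. -/
theorem IsPotential.exists_path (hq : N.IsPotential f q) {u v : V} {l : List (E × Bool)}
    (hl : IsWalk N.rsrc N.rtgt u v l) (ha : ∀ r ∈ l, 0 < N.rcap f r) :
    ∃ l', N.IsResidualPath f u v l' ∧ N.rlength l' ≤ N.rlength l := by
  obtain ⟨l', h1, h2, h3⟩ := exists_isPath_sum_le (len := N.rdelay)
    (act := fun r => 0 < N.rcap f r)
    (fun v l hl ha => by have := hq.le_rlength hl ha; simp only [rlength] at this; linarith) hl ha
  exact ⟨l', ⟨h1, h2⟩, h3⟩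

theorem rdist_le {u v : V} {l : List (E × Bool)} (hl : N.IsResidualPath f u v l) :
    N.rdist f u v ≤ (N.rlength l : ℝ) := iInf₂_le l hl

theorem IsPotential.rdist_le (hq : N.IsPotential f q) {u v : V} {l : List (E × Bool)}
    (hl : IsWalk N.rsrc N.rtgt u v l) (ha : ∀ r ∈ l, 0 < N.rcap f r) :
    N.rdist f u v ≤ (N.rlength l : ℝ) := by
  obtain ⟨l', h1, h2⟩ := hq.exists_path hl ha
  exact (Network.rdist_le h1).trans (by exact_mod_cast h2)

/-- There are finitely many paths, so the infimum is attained unless it ranges over nothing. -/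
theorem rdist_eq_top_or [Finite E] (u v : V) : N.rdist f u v = ⊤ ∨
    ∃ l, N.IsResidualPath f u v l ∧ N.rdist f u v = (N.rlength l : ℝ) := by
  by_cases hne : {l | N.IsResidualPath f u v l}.Nonempty
  · right
    have hfin : {l | N.IsResidualPath f u v l}.Finite :=
      (finite_setOf_isPath N.rsrc N.rtgt u v).subset fun l hl => hl.1
    obtain ⟨l, hl, hmin⟩ := Set.exists_min_image _ N.rlength hfin hne
    refine ⟨l, hl, le_antisymm (rdist_le hl) ?_⟩
    exact le_iInf₂ fun l' hl' => by exact_mod_cast hmin l' hl'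
  · left
    simp only [rdist, iInf_eq_top]
    exact fun l hl => absurd ⟨l, hl⟩ hne

theorem rdist_ne_bot [Finite E] (u v : V) : N.rdist f u v ≠ ⊥ := by
  rcases N.rdist_eq_top_or (f := f) u v with h | ⟨l, -, h⟩ <;> rw [h] <;> simp

theorem rdist_self (u : V) : N.rdist f u u = 0 := by
  have h : N.IsResidualPath f u u [] := ⟨isPath_self_iff.2 rfl, by simp⟩
  refine le_antisymm (by simpa [rlength] using rdist_le h) (le_iInf₂ fun l hl => ?_)
  simp [isPath_self_iff.1 hl.1, rlength]

/-- The triangle inequality, for a walk followed by a shortest path. -/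
theorem IsPotential.rdist_le_add [Finite E] (hq : N.IsPotential f q) {u v w : V}
    {l : List (E × Bool)} (hl : IsWalk N.rsrc N.rtgt u v l) (ha : ∀ r ∈ l, 0 < N.rcap f r) :
    N.rdist f u w ≤ (N.rlength l : ℝ) + N.rdist f v w := by
  rcases N.rdist_eq_top_or (f := f) v w with h | ⟨l', hl', h⟩
  · rw [h]; simp
  · rw [h, ← EReal.coe_add, ← rlength_append]
    refine hq.rdist_le (isWalk_append.2 ⟨v, hl, hl'.1.1⟩) fun r hr => ?_
    rcases List.mem_append.1 hr with hr | hr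
    exacts [ha r hr, hl'.2 r hr]

theorem IsPotential.rdist_triangle [Finite E] (hq : N.IsPotential f q) (u v w : V) :
    N.rdist f u w ≤ N.rdist f u v + N.rdist f v w := by
  rcases N.rdist_eq_top_or (f := f) u v with h | ⟨l, hl, h⟩
  · rw [h, EReal.top_add_of_ne_bot (rdist_ne_bot _ _)]
    exact le_top
  · rw [h]; exact hq.rdist_le_add hl.1.1 hl.2

theorem IsPotential.rdist_arc_le [Finite E] (hq : N.IsPotential f q) {r : E × Bool}
    (hr : 0 < N.rcap f r) (w : V) :
    N.rdist f (N.rsrc r) w ≤ (N.rdelay r : ℝ) + N.rdist f (N.rtgt r) w := by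
  have := hq.rdist_le_add (l := [r]) (u := N.rsrc r) (v := N.rtgt r) (w := w)
    ⟨rfl, rfl⟩ (by simpa using hr)
  simpa [rlength] using this

/-- Inequalities along the arcs of a walk add up. -/
theorem le_rlength_add_of_arcs {d : V → EReal} {u v : V} {l : List (E × Bool)}
    (hl : IsWalk N.rsrc N.rtgt u v l)
    (h : ∀ r ∈ l, d (N.rsrc r) ≤ (N.rdelay r : ℝ) + d (N.rtgt r)) :
    d u ≤ (N.rlength l : ℝ) + d v := by
  induction l generalizing u with
  | nil =>
    obtain rfl : u = v := hl
    simp [rlength]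
  | cons a l ih =>
    have h1 := ih hl.2 fun r hr => h r (List.mem_cons_of_mem _ hr)
    have h2 := h a (by simp)
    rw [hl.1] at h2
    rw [rlength_cons, EReal.coe_add, add_assoc]
    exact h2.trans (add_le_add le_rfl h1)

end Network

/-! ### The successive shortest paths algorithm -/

namespace Network

variable {V E : Type*} {N : Network V E}

/-- The residual arc opposite to `r`. -/
def rev (r : E × Bool) : E × Bool := (r.1, !r.2)

@[simp] theorem rsrc_rev (r : E × Bool) : N.rsrc (rev r) = N.rtgt r := by
  rcases r with ⟨e, _ | _⟩ <;> simp [rev, rsrc, rtgt]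

@[simp] theorem rtgt_rev (r : E × Bool) : N.rtgt (rev r) = N.rsrc r := by
  rcases r with ⟨e, _ | _⟩ <;> simp [rev, rsrc, rtgt]

@[simp] theorem rdelay_rev (r : E × Bool) : N.rdelay (rev r) = -N.rdelay r := by
  rcases r with ⟨e, _ | _⟩ <;> simp [rev, rdelay]

theorem isWalk_reverse {u v : V} {l : List (E × Bool)} (h : IsWalk N.rsrc N.rtgt u v l) :
    IsWalk N.rsrc N.rtgt v u (l.map rev).reverse := by
  induction l generalizing u with
  | nil => exact h.symm
  | cons a l ih =>
    rw [List.map_cons, List.reverse_cons]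
    exact isWalk_append.2 ⟨_, ih h.2, by simp [IsWalk, h.1]⟩

theorem rlength_reverse (l : List (E × Bool)) :
    N.rlength (l.map rev).reverse = -N.rlength l := by
  induction l with
  | nil => simp [rlength]
  | cons a l ih =>
    rw [List.map_cons, List.reverse_cons, rlength_append, ih, rlength_cons, rlength_cons]
    simp [rlength]

end Network

open Network

namespace SSPRun

variable {V E : Type*} {N : Network V E} {s t : V} (R : SSPRun N s t)

open Classical in
theorem staticFlow_succ (j : ℕ) (e : E) : R.staticFlow (j + 1) e = R.staticFlow j e +
    R.x j * ((if (e, true) ∈ R.P j then 1 else 0) - (if (e, false) ∈ R.P j then 1 else 0)) := by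
  simp [staticFlow, partialFlow, Finset.sum_range_succ]

theorem staticFlow_zero (e : E) : R.staticFlow 0 e = 0 := by simp [staticFlow, partialFlow]

theorem rcap_pos {j : ℕ} (hj : j < R.m) {r : E × Bool} (hr : r ∈ R.P j) :
    0 < N.rcap (R.staticFlow j) r := (R.isPath j hj).2 r hr

theorem x_pos {j : ℕ} (hj : j < R.m) : 0 < R.x j := by
  obtain ⟨r, hr, h⟩ := (R.amount j hj).1
  rw [← h]; exact R.rcap_pos hj hr

theorem x_le {j : ℕ} (hj : j < R.m) {r : E × Bool} (hr : r ∈ R.P j) :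
    R.x j ≤ N.rcap (R.staticFlow j) r := (R.amount j hj).2 ⟨r, hr, rfl⟩

theorem staticFlow_mem {j : ℕ} (hj : j ≤ R.m) (e : E) :
    0 ≤ R.staticFlow j e ∧ R.staticFlow j e ≤ N.cap e := by
  induction j with
  | zero => simp [staticFlow_zero, N.cap_nonneg]
  | succ j ih =>
    obtain ⟨h0, h1⟩ := ih (by omega)
    have hx := R.x_pos hj
    rw [staticFlow_succ]
    by_cases ht : (e, true) ∈ R.P j <;> by_cases hf : (e, false) ∈ R.P j
    -- A path containing both copies of an arc is not excluded; the two contributions cancel.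
    · simp [ht, hf, h0, h1]
    · have := R.x_le hj ht
      simp only [rcap, if_true] at this
      simp only [ht, hf, if_true, if_false]
      constructor <;> linarith
    · have := R.x_le hj hf
      simp only [rcap] at this
      simp only [ht, hf, if_true, if_false]
      simp at this
      constructor <;> linarith
    · simp [ht, hf, h0, h1]

/-- An arc of the residual network was there before the last augmentation, unless it is opposite
to an arc of the augmenting path. -/
theorem rcap_pos_or {j : ℕ} (hj : j < R.m) {r : E × Bool}
    (hr : 0 < N.rcap (R.staticFlow (j + 1)) r) :
    0 < N.rcap (R.staticFlow j) r ∨ rev r ∈ R.P j := by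
  by_contra! hcon
  obtain ⟨h1, h2⟩ := hcon
  have hx := R.x_pos hj
  rcases r with ⟨e, _ | _⟩
  · simp only [rcap, rev, Bool.not_false, staticFlow_succ] at *
    simp only [h2, if_false] at hr
    simp at hr h1
    split_ifs at hr <;> linarith
  · simp only [rcap, rev, Bool.not_true, staticFlow_succ] at *
    simp only [h2, if_false] at hr
    simp at hr h1
    split_ifs at hr <;> linarith

theorem rcap_succ_pos {j : ℕ} (hj : j < R.m) {r : E × Bool}
    (hr : 0 < N.rcap (R.staticFlow j) r) (h : r ∉ R.P j) :
    0 < N.rcap (R.staticFlow (j + 1)) r := by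
  have hx := R.x_pos hj
  rcases r with ⟨e, _ | _⟩ <;> simp [rcap, staticFlow_succ, h] at * <;> split_ifs <;> linarith

/-- Normally the opposite arc gains `x j > 0` on a nonnegative residual capacity. If the path
contains both copies, the residual capacity is unchanged and was positive before. -/
theorem rcap_rev_pos {j : ℕ} (hj : j < R.m) {r : E × Bool} (h : r ∈ R.P j) :
    0 < N.rcap (R.staticFlow (j + 1)) (rev r) := by
  by_cases hr : rev r ∈ R.P j
  · have h1 := R.rcap_pos hj hr
    rcases r with ⟨e, _ | _⟩ <;> simp [rcap, staticFlow_succ, rev] at * <;> simp [h, hr] <;>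
      linarith
  · have hx := R.x_pos hj
    obtain ⟨h0, h1⟩ := R.staticFlow_mem hj.le r.1
    rcases r with ⟨e, _ | _⟩ <;> simp [rcap, staticFlow_succ, rev] at * <;> simp [h, hr] <;>
      linarith

section Potential

variable [Finite E] {j : ℕ} {q : V → ℝ}

theorem dist_st_of_isPotential (hj : j < R.m) :
    R.dist j s t = (N.rlength (R.P j) : ℝ) :=
  le_antisymm (Network.rdist_le (R.isPath j hj))
    (le_iInf₂ fun l hl => by exact_mod_cast R.shortest j hj l hl)

/-- Both parts of a shortest path are shortest: exchanging one of them gives an `s`-`t`-walk, and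
the potential turns this walk into a path that is not longer. -/
theorem dist_suffix_of_isPotential (hj : j < R.m) (hq : N.IsPotential (R.staticFlow j) q) {v : V}
    {l₁ l₂ : List (E × Bool)} (hl : R.P j = l₁ ++ l₂) (h₁ : IsWalk N.rsrc N.rtgt s v l₁)
    (h₂ : IsWalk N.rsrc N.rtgt v t l₂) :
    R.dist j v t = (N.rlength l₂ : ℝ) ∧ R.dist j s v = (N.rlength l₁ : ℝ) := by
  have hP := R.isPath j hj
  have ha₁ : ∀ r ∈ l₁, 0 < N.rcap (R.staticFlow j) r := fun r hr =>
    R.rcap_pos hj (by simp [hl, hr])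
  have ha₂ : ∀ r ∈ l₂, 0 < N.rcap (R.staticFlow j) r := fun r hr =>
    R.rcap_pos hj (by simp [hl, hr])
  have key : ∀ l, IsWalk N.rsrc N.rtgt s t l → (∀ r ∈ l, 0 < N.rcap (R.staticFlow j) r) →
      N.rlength l₁ + N.rlength l₂ ≤ N.rlength l := fun l hw ha => by
    obtain ⟨l', h, h'⟩ := hq.exists_path hw ha
    have := R.shortest j hj l' h
    rw [hl, rlength_append] at this
    exact this.trans h'
  constructor
  · refine le_antisymm (hq.rdist_le h₂ ha₂) (le_iInf₂ fun l h => ?_)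
    have := key (l₁ ++ l) (isWalk_append.2 ⟨v, h₁, h.1.1⟩) fun r hr => by
      rcases List.mem_append.1 hr with hr | hr
      exacts [ha₁ r hr, h.2 r hr]
    rw [rlength_append] at this
    exact_mod_cast (by linarith : N.rlength l₂ ≤ N.rlength l)
  · refine le_antisymm (hq.rdist_le h₁ ha₁) (le_iInf₂ fun l h => ?_)
    have := key (l ++ l₂) (isWalk_append.2 ⟨v, h.1.1, h₂⟩) fun r hr => by
      rcases List.mem_append.1 hr with hr | hr
      exacts [h.2 r hr, ha₂ r hr]
    rw [rlength_append] at this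
    exact_mod_cast (by linarith : N.rlength l₁ ≤ N.rlength l)

/-- Arcs of the augmenting path are tight. -/
theorem dist_arc_of_isPotential (hj : j < R.m) (hq : N.IsPotential (R.staticFlow j) q)
    {r : E × Bool} (hr : r ∈ R.P j) : ∃ d : ℝ, R.dist j (N.rtgt r) t = (d : EReal) ∧
      R.dist j (N.rsrc r) t = ((N.rdelay r + d : ℝ) : EReal) := by
  obtain ⟨l₁, l₂, hl⟩ := List.append_of_mem hr
  have hw := (R.isPath j hj).1.1
  rw [hl] at hw
  obtain ⟨x, h₁, h₂⟩ := isWalk_append.1 hw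
  obtain rfl : N.rsrc r = x := h₂.1
  refine ⟨N.rlength l₂, ?_, ?_⟩
  · refine (R.dist_suffix_of_isPotential hj hq (l₁ := l₁ ++ [r]) (by simp [hl]) ?_ h₂.2).1
    exact isWalk_append.2 ⟨_, h₁, rfl, rfl⟩
  · rw [(R.dist_suffix_of_isPotential hj hq hl h₁ h₂).1, rlength_cons]

/-- The distances to `t` before an augmentation are feasible after it, too. -/
theorem dist_feasible_of_isPotential (hj : j < R.m) (hq : N.IsPotential (R.staticFlow j) q)
    {r : E × Bool} (hr : 0 < N.rcap (R.staticFlow (j + 1)) r) :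
    R.dist j (N.rsrc r) t ≤ (N.rdelay r : ℝ) + R.dist j (N.rtgt r) t := by
  rcases R.rcap_pos_or hj hr with h | h
  · exact hq.rdist_arc_le h t
  · obtain ⟨d, h1, h2⟩ := R.dist_arc_of_isPotential hj hq h
    simp only [rtgt_rev, rsrc_rev, rdelay_rev] at h1 h2
    rw [h1, h2, ← EReal.coe_add]
    norm_cast
    linarith

variable [Finite V]

open Classical in
/-- The residual networks have feasible potentials, and thus no cycles of negative length. -/
theorem exists_isPotential (hj : j ≤ R.m) : ∃ q, N.IsPotential (R.staticFlow j) q := by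
  induction j with
  | zero =>
    refine ⟨0, fun r hr => ?_⟩
    rcases r with ⟨e, _ | _⟩
    · simp [rcap, staticFlow_zero] at hr
    · simp [rdelay, N.delay_nonneg]
  | succ j ih =>
    obtain ⟨q, hq⟩ := ih (by omega)
    -- The new potential is the distance to `t` where this is finite and the old potential raised by
    -- `K` elsewhere. With `K` this large, arcs into the second kind of vertices are harmless; such
    -- arcs were residual before, so `q` is feasible on them.
    obtain ⟨K, hK⟩ := (Set.finite_range fun v => (R.dist j v t).toReal - q v).bddAbove
    have hK' : ∀ v, (R.dist j v t).toReal ≤ K + q v := fun v => by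
      have := hK ⟨v, rfl⟩; simp only at this; linarith
    have hr : ∀ v, R.dist j v t ≠ ⊤ → R.dist j v t = ((R.dist j v t).toReal : EReal) := fun v hv =>
      (EReal.coe_toReal hv (rdist_ne_bot _ _)).symm
    refine ⟨fun v => if R.dist j v t = ⊤ then K + q v else (R.dist j v t).toReal, fun r h => ?_⟩
    have hfeas := R.dist_feasible_of_isPotential hj hq h
    by_cases hw : R.dist j (N.rtgt r) t = ⊤
    · have h' : 0 < N.rcap (R.staticFlow j) r := by
        refine (R.rcap_pos_or hj h).resolve_right fun hmem => ?_
        obtain ⟨d, -, h2⟩ := R.dist_arc_of_isPotential hj hq hmem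
        rw [rsrc_rev, hw] at h2
        exact EReal.coe_ne_top _ h2.symm
      have h1 := hq r h'
      have h2 := hK' (N.rsrc r)
      simp only [hw, if_true]
      split_ifs <;> linarith
    · rw [hr _ hw, ← EReal.coe_add] at hfeas
      have hv : R.dist j (N.rsrc r) t ≠ ⊤ := fun hv => by
        rw [hv] at hfeas; exact EReal.coe_ne_top _ (top_le_iff.1 hfeas)
      rw [hr _ hv] at hfeas
      simp only [hv, hw, if_false]
      exact_mod_cast hfeas

theorem dist_self (j : ℕ) (v : V) : R.dist j v v = 0 := rdist_self v

theorem dist_ne_bot (j : ℕ) (u v : V) : R.dist j u v ≠ ⊥ := rdist_ne_bot u v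

theorem dist_triangle (hj : j ≤ R.m) (u v w : V) : R.dist j u w ≤ R.dist j u v + R.dist j v w := by
  obtain ⟨q, hq⟩ := R.exists_isPotential hj
  exact hq.rdist_triangle u v w

theorem dist_arc_le (hj : j ≤ R.m) {r : E × Bool} (hr : 0 < N.rcap (R.staticFlow j) r) (w : V) :
    R.dist j (N.rsrc r) w ≤ (N.rdelay r : ℝ) + R.dist j (N.rtgt r) w := by
  obtain ⟨q, hq⟩ := R.exists_isPotential hj
  exact hq.rdist_arc_le hr w

/-- Distances to `t` do not decrease. -/
theorem dist_le_succ (hj : j < R.m) (v : V) : R.dist j v t ≤ R.dist (j + 1) v t := by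
  obtain ⟨q, hq⟩ := R.exists_isPotential hj.le
  rcases N.rdist_eq_top_or (f := R.staticFlow (j + 1)) v t with h | ⟨l, hl, h⟩
  · rw [dist, dist, h]; exact le_top
  · have := le_rlength_add_of_arcs (d := fun v => R.dist j v t) hl.1.1 fun r hr =>
      R.dist_feasible_of_isPotential hj hq (hl.2 r hr)
    simp only [dist_self, add_zero] at this
    exact this.trans_eq h.symm

theorem dist_mono {i : ℕ} (hij : i ≤ j) (hj : j ≤ R.m) (v : V) : R.dist i v t ≤ R.dist j v t := by
  induction j, hij using Nat.le_induction with
  | base => exact le_rfl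
  | succ j hij ih => exact (ih (by omega)).trans (R.dist_le_succ hj v)

/-- Follow the walk until its next arc belongs to `P j`, or until `t`. Up to there its arcs survive
the augmentation. Then return to `s` along the reversed initial part of `P j`; what is left of the
walk is at least as long as the rest of `P j`. -/
theorem dist_s_le_of_walk (hj : j < R.m) {v : V} {l : List (E × Bool)}
    (hl : IsWalk N.rsrc N.rtgt v t l) (ha : ∀ r ∈ l, 0 < N.rcap (R.staticFlow j) r) :
    R.dist (j + 1) v s ≤ ((N.rlength l - N.rlength (R.P j) : ℝ) : EReal) := by
  obtain ⟨q, hq⟩ := R.exists_isPotential hj.le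
  obtain ⟨q', hq'⟩ := R.exists_isPotential (j := j + 1) hj
  have back : ∀ l₁ l₂ w, R.P j = l₁ ++ l₂ → IsWalk N.rsrc N.rtgt s w l₁ →
      R.dist (j + 1) w s ≤ ((-N.rlength l₁ : ℝ) : EReal) := fun l₁ l₂ w h h₁ => by
    rw [← rlength_reverse]
    refine hq'.rdist_le (isWalk_reverse h₁) fun r hr => ?_
    simp only [List.mem_reverse, List.mem_map] at hr
    obtain ⟨r, hr, rfl⟩ := hr
    exact R.rcap_rev_pos hj (by simp [h, hr])
  induction l generalizing v with
  | nil =>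
    obtain rfl : v = t := hl
    simpa [rlength] using back (R.P j) [] v (by simp) (R.isPath j hj).1.1
  | cons r l ih =>
    have hr := ha r (by simp)
    by_cases hmem : r ∈ R.P j
    · obtain ⟨l₁, l₂, hP⟩ := List.append_of_mem hmem
      have hw := (R.isPath j hj).1.1
      rw [hP] at hw
      obtain ⟨x, h₁, h₂⟩ := isWalk_append.1 hw
      obtain rfl : N.rsrc r = x := h₂.1
      obtain rfl : N.rsrc r = v := hl.1
      refine (back l₁ _ _ hP h₁).trans ?_
      have h3 := (R.dist_suffix_of_isPotential hj hq hP h₁ h₂).1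
      have h4 : R.dist j (N.rsrc r) t ≤ (N.rlength (r :: l) : ℝ) := hq.rdist_le hl ha
      rw [h3] at h4
      have h5 : N.rlength (r :: l₂) ≤ N.rlength (r :: l) := by exact_mod_cast h4
      rw [hP, rlength_append]
      exact_mod_cast (by linarith)
    · have h1 := ih hl.2 fun r hr => ha r (List.mem_cons_of_mem _ hr)
      have h2 := R.dist_arc_le hj (R.rcap_succ_pos hj hr hmem) s
      rw [hl.1] at h2
      rw [rlength_cons]
      refine h2.trans ((add_le_add le_rfl h1).trans_eq ?_)
      rw [← EReal.coe_add, add_sub_assoc]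

/-- The distances to `s` after an augmentation are the distances to `t` before it, up to a
constant. -/
theorem dist_succ_s (hj : j < R.m) (v : V) :
    R.dist (j + 1) v s = R.dist j v t - R.dist j s t := by
  obtain ⟨q, hq⟩ := R.exists_isPotential hj.le
  rw [R.dist_st_of_isPotential hj]
  apply le_antisymm
  · rcases N.rdist_eq_top_or (f := R.staticFlow j) v t with h | ⟨l, hl, h⟩
    · rw [dist, dist, h]; simp
    · refine (R.dist_s_le_of_walk hj hl.1.1 hl.2).trans_eq ?_
      rw [dist, h, EReal.coe_sub]
  · rcases N.rdist_eq_top_or (f := R.staticFlow (j + 1)) v s with h | ⟨l, hl, h⟩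
    · rw [dist, dist, h]; exact le_top
    · have := le_rlength_add_of_arcs (d := fun v => R.dist j v t) hl.1.1 fun r hr =>
        R.dist_feasible_of_isPotential hj hq (hl.2 r hr)
      simp only [R.dist_st_of_isPotential hj] at this
      rw [EReal.sub_le_iff_le_add (by simp) (by simp), dist, dist, h]
      exact this

end Potential

end SSPRun

open Network

/-! ### Real-valued distances and the arcs used by the augmenting paths -/

namespace SSPRun

variable {V E : Type*} {N : Network V E} {s t : V} (R : SSPRun N s t)

/-- The distance to `t` as a real number. -/
def dt (j : ℕ) (v : V) : ℝ := (R.dist j v t).toReal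

/-- `t` can be reached from `v` in the first residual network. -/
def Reaches (v : V) : Prop := R.dist 0 v t ≠ ⊤

/-- The path number `j` uses the arc `e` in one of the two directions. -/
def Uses (j : ℕ) (e : E) : Prop := (e, true) ∈ R.P j ∨ (e, false) ∈ R.P j

open Classical in
/-- The flow of one unit along the path number `j`. -/
def chi (j : ℕ) (e : E) : ℝ :=
  (if (e, true) ∈ R.P j then 1 else 0) - (if (e, false) ∈ R.P j then 1 else 0)

theorem chi_eq_zero {j : ℕ} {e : E} (h : ¬ R.Uses j e) : R.chi j e = 0 := by
  simp only [Uses, not_or] at h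
  simp [chi, h.1, h.2]

theorem staticFlow_eq_sum (j : ℕ) (e : E) :
    R.staticFlow j e = ∑ i ∈ Finset.range j, R.x i * R.chi i e := rfl

theorem staticFlow_eq_of_not_uses {i k : ℕ} (hik : i ≤ k) {e : E}
    (h : ∀ l, i ≤ l → l < k → ¬ R.Uses l e) : R.staticFlow i e = R.staticFlow k e := by
  induction k, hik using Nat.le_induction with
  | base => rfl
  | succ k hik ih =>
    rw [ih fun l h1 h2 => h l h1 (by omega), staticFlow_eq_sum, staticFlow_eq_sum,
      Finset.sum_range_succ, R.chi_eq_zero (h k hik (by omega))]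
    simp

theorem exists_uses {j : ℕ} {e : E} (h : 0 < R.staticFlow j e) : ∃ l < j, R.Uses l e := by
  by_contra! hcon
  rw [← R.staticFlow_eq_of_not_uses (Nat.zero_le j) fun l _ hl => hcon l hl,
    staticFlow_zero] at h
  exact lt_irrefl _ h

section

variable [Finite E]

open Classical in
/-- The path number `j` carries one unit from `s` to `t`. -/
theorem chi_balance {j : ℕ} (hj : j < R.m) [Fintype E] (v : V) :
    ∑ e, ((if N.src e = v then (1 : ℝ) else 0) - if N.tgt e = v then 1 else 0) * R.chi j e
      = (if s = v then 1 else 0) - if t = v then 1 else 0 := by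
  have hP := (R.isPath j hj).1
  have hnd : (R.P j).Nodup := (List.nodup_cons.1 hP.2).2.of_map _
  have h := hP.1.sum_balance v
  rw [← List.sum_toFinset _ hnd] at h
  have h2 : ∀ F : E × Bool → ℝ, ∑ r ∈ (R.P j).toFinset, F r
      = ∑ r, F r * if r ∈ R.P j then 1 else 0 := fun F => by
    simp only [mul_ite, mul_one, mul_zero, ← Finset.sum_filter]
    congr 1; ext; simp
  rw [h2, Fintype.sum_prod_type] at h
  simp only [Fintype.sum_bool, rsrc, rtgt] at h
  simp only [if_true, Bool.false_eq_true, if_false] at h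
  convert h using 1
  · refine Finset.sum_congr rfl fun e _ => ?_
    simp only [chi]; ring

variable [Finite V] {j : ℕ}

theorem dist_st (hj : j < R.m) : R.dist j s t = (N.rlength (R.P j) : ℝ) :=
  R.dist_st_of_isPotential hj

theorem dist_st_ne_top (hj : j < R.m) : R.dist j s t ≠ ⊤ := by
  rw [R.dist_st hj]; exact EReal.coe_ne_top _

theorem dist_m_st : R.dist R.m s t = ⊤ := by
  rcases N.rdist_eq_top_or (f := R.staticFlow R.m) s t with h | ⟨l, hl, -⟩
  · exact h
  · exact absurd hl (R.complete l)

/-- Reachability of `t` is not lost before the run ends: by `dist_succ_s`, `v` reaches `s` after the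
augmentation, and `s` still reaches `t`. -/
theorem reaches_iff (hj : j < R.m) {v : V} : R.dist j v t ≠ ⊤ ↔ R.Reaches v := by
  refine ⟨fun h h0 => h (top_le_iff.1 (h0 ▸ R.dist_mono (Nat.zero_le j) hj.le v)), fun h => ?_⟩
  induction j with
  | zero => exact h
  | succ j ih =>
    have h1 := ih (by omega)
    have h2 := R.dist_succ_s (j := j) (by omega) v
    have h3 := R.dist_triangle hj.le v s t
    lift R.dist j v t to ℝ using ⟨h1, R.dist_ne_bot _ _ _⟩ with a
    have h4 := R.dist_st (j := j) (by omega)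
    rw [h4] at h2
    rw [h2, R.dist_st hj, ← EReal.coe_sub, ← EReal.coe_add] at h3
    exact (h3.trans_lt (EReal.coe_lt_top _)).ne

theorem coe_dt (hj : j < R.m) {v : V} (hv : R.Reaches v) : R.dist j v t = (R.dt j v : EReal) :=
  (EReal.coe_toReal ((R.reaches_iff hj).2 hv) (R.dist_ne_bot _ _ _)).symm

theorem reaches_s (hm : 0 < R.m) : R.Reaches s := R.dist_st_ne_top hm

theorem reaches_t : R.Reaches t := by simp [Reaches, dist_self]

theorem dt_t : R.dt j t = 0 := by simp [dt, dist_self]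

theorem dt_mono {i : ℕ} (hij : i ≤ j) (hj : j < R.m) {v : V} (hv : R.Reaches v) :
    R.dt i v ≤ R.dt j v := by
  have := R.dist_mono hij hj.le v
  rw [R.coe_dt hj hv, R.coe_dt (hij.trans_lt hj) hv] at this
  exact_mod_cast this

theorem dist_succ_s_eq (hj : j < R.m) {v : V} (hv : R.Reaches v) :
    R.dist (j + 1) v s = ((R.dt j v - R.dt j s : ℝ) : EReal) := by
  rw [R.dist_succ_s hj, R.coe_dt hj hv, R.coe_dt hj (R.reaches_s (by omega)), EReal.coe_sub]

/-- After one more augmentation, `v` can go to `t` via `s`, and its distance to `s` is then known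
from `dist_succ_s`. The triangle inequality is the claim for one step. -/
theorem gap_mono {i : ℕ} (hij : i ≤ j) (hj : j < R.m) {v : V} (hv : R.Reaches v) :
    R.dt i s - R.dt i v ≤ R.dt j s - R.dt j v := by
  induction j, hij using Nat.le_induction with
  | base => exact le_rfl
  | succ j hij ih =>
    refine (ih (by omega)).trans ?_
    have h := R.dist_triangle hj.le v s t
    rw [R.dist_succ_s_eq (by omega) hv, R.coe_dt hj hv, R.coe_dt hj (R.reaches_s (by omega)),
      ← EReal.coe_add] at h
    have h' : R.dt (j + 1) v ≤ R.dt j v - R.dt j s + R.dt (j + 1) s := by exact_mod_cast h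
    linarith

theorem reaches_of_mem (hj : j < R.m) {r : E × Bool} (hr : r ∈ R.P j) :
    R.Reaches (N.rsrc r) ∧ R.Reaches (N.rtgt r) ∧
      R.dt j (N.rsrc r) = N.rdelay r + R.dt j (N.rtgt r) := by
  obtain ⟨q, hq⟩ := R.exists_isPotential hj.le
  obtain ⟨d, h1, h2⟩ := R.dist_arc_of_isPotential hj hq hr
  refine ⟨(R.reaches_iff hj).1 ?_, (R.reaches_iff hj).1 ?_, ?_⟩
  · rw [h2]; exact EReal.coe_ne_top _
  · rw [h1]; exact EReal.coe_ne_top _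
  · simp only [dt, h1, h2, EReal.toReal_coe]

theorem Uses.reaches {e : E} (hj : j < R.m) (h : R.Uses j e) :
    R.Reaches (N.src e) ∧ R.Reaches (N.tgt e) := by
  rcases h with h | h
  · exact ⟨(R.reaches_of_mem hj h).1, (R.reaches_of_mem hj h).2.1⟩
  · exact ⟨(R.reaches_of_mem hj h).2.1, (R.reaches_of_mem hj h).1⟩

theorem Uses.dt_src {e : E} (hj : j < R.m) (h : R.Uses j e) :
    R.dt j (N.src e) = N.delay e + R.dt j (N.tgt e) := by
  rcases h with h | h
  · exact (R.reaches_of_mem hj h).2.2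
  · have := (R.reaches_of_mem hj h).2.2
    simp only [rsrc, rtgt, rdelay, Bool.false_eq_true, if_false] at this
    linarith

theorem Uses.dist_s_src {e : E} (hj : j < R.m) (h : R.Uses j e) :
    (R.dist j s (N.src e)).toReal = R.dt j s - R.dt j (N.src e) := by
  obtain ⟨q, hq⟩ := R.exists_isPotential hj.le
  have key : ∃ l₁ l₂, R.P j = l₁ ++ l₂ ∧ IsWalk N.rsrc N.rtgt s (N.src e) l₁ ∧
      IsWalk N.rsrc N.rtgt (N.src e) t l₂ := by
    refine (R.isPath j hj).1.1.exists_split ?_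
    rcases h with h | h
    · exact (R.isPath j hj).1.1.src_mem h
    · exact List.mem_cons_of_mem _ (List.mem_map_of_mem (f := N.rtgt) h)
  obtain ⟨l₁, l₂, hP, h₁, h₂⟩ := key
  obtain ⟨h3, h4⟩ := R.dist_suffix_of_isPotential hj hq hP h₁ h₂
  simp only [dt, h3, h4, R.dist_st hj, EReal.toReal_coe, hP, rlength_append]
  ring

theorem dist_tgt_le {e : E} (hj : j ≤ R.m) (h : 0 < R.staticFlow j e) (w : V) :
    R.dist j (N.tgt e) w ≤ ((-N.delay e : ℝ) : EReal) + R.dist j (N.src e) w :=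
  R.dist_arc_le hj (r := (e, false)) (by simpa [rcap] using h) w

theorem reaches_of_staticFlow_pos {e : E} (hj : j ≤ R.m) (h : 0 < R.staticFlow j e) :
    R.Reaches (N.src e) ∧ R.Reaches (N.tgt e) := by
  obtain ⟨l, hl, hu⟩ := R.exists_uses h
  exact Uses.reaches R (by omega) hu

theorem dt_tgt_le {e : E} (hj : j < R.m) (h : 0 < R.staticFlow j e) :
    N.delay e + R.dt j (N.tgt e) ≤ R.dt j (N.src e) := by
  obtain ⟨h1, h2⟩ := R.reaches_of_staticFlow_pos hj.le h
  have := R.dist_tgt_le hj.le h t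
  rw [R.coe_dt hj h1, R.coe_dt hj h2, ← EReal.coe_add] at this
  have h' : R.dt j (N.tgt e) ≤ -N.delay e + R.dt j (N.src e) := by exact_mod_cast this
  linarith

theorem dist_zero_nonneg (u v : V) : 0 ≤ R.dist 0 u v := by
  refine le_iInf₂ fun l hl => ?_
  have h : 0 ≤ N.rlength l := List.sum_nonneg fun y hy => by
    obtain ⟨r, hr, rfl⟩ := List.mem_map.1 hy
    have h' := hl.2 r hr
    rcases r with ⟨e, _ | _⟩
    · simp [rcap, staticFlow_zero] at h'
    · simp [rdelay, N.delay_nonneg]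
  exact_mod_cast h

theorem dt_s_nonneg (hj : j < R.m) : 0 ≤ R.dt j s := by
  have h : 0 ≤ R.dist j s t := (R.dist_zero_nonneg s t).trans (R.dist_mono (Nat.zero_le j) hj.le s)
  exact EReal.toReal_nonneg h

/-- A path from `s` to `t` neither enters `s` nor leaves `t`, so only the backward copy could occur,
and this one needs flow on the arc. -/
theorem not_uses_of_staticFlow_eq_zero (hj : j < R.m) {e : E} (he : N.tgt e = s ∨ N.src e = t)
    (h0 : R.staticFlow j e = 0) : ¬ R.Uses j e := by
  have hP := R.isPath j hj
  rintro (hu | hu)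
  · rcases he with he | he
    · exact hP.1.tgt_ne hu he
    · exact hP.1.src_ne hu he
  · have := R.rcap_pos hj hu
    simp [rcap, h0] at this

theorem staticFlow_eq_zero (hj : j ≤ R.m) {e : E} (he : N.tgt e = s ∨ N.src e = t) :
    R.staticFlow j e = 0 := by
  induction j with
  | zero => exact R.staticFlow_zero e
  | succ j ih =>
    rw [staticFlow_eq_sum, Finset.sum_range_succ, ← staticFlow_eq_sum, ih (by omega),
      R.chi_eq_zero (R.not_uses_of_staticFlow_eq_zero hj he (ih (by omega)))]
    simp

theorem not_uses (hj : j < R.m) {e : E} (he : N.tgt e = s ∨ N.src e = t) : ¬ R.Uses j e :=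
  R.not_uses_of_staticFlow_eq_zero hj he (R.staticFlow_eq_zero hj.le he)

/-- The arcs that carry flow do not form directed cycles. -/
theorem exists_rank (hN : N.NoZeroDelayCycle) (hj : j ≤ R.m) :
    ∃ rk : V → ℕ, (∀ v, rk v ≤ Nat.card V) ∧
      ∀ e, 0 < R.staticFlow j e → rk (N.tgt e) < rk (N.src e) := by
  classical
  have := Fintype.ofFinite V
  obtain ⟨q, hq⟩ := R.exists_isPotential hj
  let rel : V → V → Prop := fun v w => ∃ e, N.src e = v ∧ N.tgt e = w ∧ 0 < R.staticFlow j e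
  have hrel : ∀ v w, Relation.TransGen rel v w → ∃ l, l ≠ [] ∧ IsWalk N.src N.tgt v w l ∧
      (l.map N.delay).sum ≤ q v - q w := by
    -- The backward copy of a flow-carrying arc is residual. Hence the delay of a walk along such
    -- arcs is at most a difference of potentials, and a cycle would have delay at most zero.
    have harc : ∀ e, 0 < R.staticFlow j e → N.delay e ≤ q (N.src e) - q (N.tgt e) := fun e he => by
      have := hq (e, false) (by simpa [rcap] using he)
      simp only [rsrc, rtgt, rdelay, Bool.false_eq_true, if_false] at this
      linarith
    intro v w h
    induction h with
    | single h =>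
      obtain ⟨e, rfl, rfl, he⟩ := h
      exact ⟨[e], by simp, ⟨rfl, rfl⟩, by simpa using harc e he⟩
    | tail _ h ih =>
      obtain ⟨l, -, h1, h2⟩ := ih
      obtain ⟨e, rfl, rfl, he⟩ := h
      refine ⟨l ++ [e], by simp, isWalk_append.2 ⟨_, h1, rfl, rfl⟩, ?_⟩
      have := harc e he
      simp only [List.map_append, List.sum_append, List.map_cons, List.map_nil, List.sum_cons,
        List.sum_nil]
      linarith
  -- The rank of `v` is the number of vertices that can be reached from `v` along at least one
  -- flow-carrying arc.
  refine ⟨fun v => (Finset.univ.filter fun u => Relation.TransGen rel v u).card, fun v => ?_,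
    fun e he => Finset.card_lt_card ?_⟩
  · rw [Nat.card_eq_fintype_card]; exact Finset.card_le_univ _
  · have hvw : rel (N.src e) (N.tgt e) := ⟨e, rfl, rfl, he⟩
    rw [Finset.ssubset_iff_of_subset]
    · refine ⟨N.tgt e, by simpa using Relation.TransGen.single hvw, ?_⟩
      simp only [Finset.mem_filter, Finset.mem_univ, true_and]
      intro h
      obtain ⟨l, h1, h2, h3⟩ := hrel _ _ h
      have := hN _ l h1 h2
      linarith
    · intro u hu
      simp only [Finset.mem_filter, Finset.mem_univ, true_and] at hu ⊢
      exact Relation.TransGen.head hvw hu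

end

end SSPRun

open Network

/-! ### Scheduling costs -/

namespace IsSchedulingCost

variable {α : ℝ} {ρ : ℝ → ℝ}

/-- The form in which the growth bound is used: arriving earlier by `d` raises the scheduling cost
by at most `α d`. -/
theorem le_add (hρ : IsSchedulingCost α ρ) {y z : ℝ} (h : y ≤ z) : ρ y ≤ ρ z + α * (z - y) := by
  have := hρ.growth h
  simp only at this
  linarith

theorem le_max (hρ : IsSchedulingCost α ρ) {x y z : ℝ} (h₁ : x ≤ y) (h₂ : y ≤ z) : ρ y ≤ max (ρ x) (ρ z) := by
  rcases le_total y 0 with h | h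
  · exact le_max_of_le_left (hρ.strictAntiOn.antitoneOn (h₁.trans h) h h₁)
  · exact le_max_of_le_right (hρ.strictMonoOn.monotoneOn h (h.trans h₂) h₂)

theorem isClosed_sublevel (hρ : IsSchedulingCost α ρ) (c : ℝ) : IsClosed {y | ρ y ≤ c} :=
  hρ.lowerSemicontinuous.isClosed_preimage c

theorem exists_bound (hρ : IsSchedulingCost α ρ) (c : ℝ) : ∃ B, 0 ≤ B ∧ ∀ y, ρ y ≤ c → |y| ≤ B := by
  obtain ⟨B₁, h₁⟩ := Filter.eventually_atTop.1 (hρ.tendsto_atTop.eventually_gt_atTop c)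
  obtain ⟨B₂, h₂⟩ := Filter.eventually_atBot.1 (hρ.tendsto_atBot.eventually_gt_atTop c)
  refine ⟨max (max B₁ (-B₂)) 0, le_max_right _ _, fun y hy => ?_⟩
  have h3 : y < B₁ := lt_of_not_ge fun h => (h₁ y h).not_ge hy
  have h4 : B₂ < y := lt_of_not_ge fun h => (h₂ y h).not_ge hy
  refine le_max_of_le_left (abs_le.2 ⟨?_, h3.le.trans (le_max_left _ _)⟩)
  have := le_max_right B₁ (-B₂)
  linarith

end IsSchedulingCost

/-! ### Availability of the paths, and the flow over time as a family of static flows -/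

namespace SSPRun

variable {V E : Type*} {N : Network V E} {s t : V} (R : SSPRun N s t) {α : ℝ} {ρ : ℝ → ℝ} {C : ℝ}

/-- Flow sent into the path number `j` can be at the vertex `v` at time `θ`. -/
def Avail (α : ℝ) (ρ : ℝ → ℝ) (C : ℝ) (j : ℕ) (v : V) (θ : ℝ) : Prop :=
  ρ (θ + R.dt j v) ≤ C - α * R.dt j s

theorem mem_interval {j : ℕ} {ξ : ℝ} :
    ξ ∈ R.interval α ρ C j ↔ ρ (ξ + R.dt j s) ≤ C - α * R.dt j s := Iff.rfl

theorem isClosed_avail (hρ : IsSchedulingCost α ρ) (j : ℕ) (v : V) :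
    IsClosed {θ | R.Avail α ρ C j v θ} :=
  (hρ.isClosed_sublevel _).preimage (continuous_id.add continuous_const)

variable [Finite V] [Finite E] {j : ℕ} {e : E} {v : V} {θ : ℝ}

theorem Uses.avail_iff (hj : j < R.m) (h : R.Uses j e) :
    R.Avail α ρ C j (N.tgt e) (θ + N.delay e) ↔ R.Avail α ρ C j (N.src e) θ := by
  simp only [Avail, h.dt_src R hj, add_assoc]

theorem Uses.mem_interval_iff (hj : j < R.m) (h : R.Uses j e) :
    θ - (R.dist j s (N.src e)).toReal ∈ R.interval α ρ C j ↔ R.Avail α ρ C j (N.src e) θ := by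
  rw [h.dist_s_src R hj, mem_interval, Avail]
  rw [show θ - (R.dt j s - R.dt j (N.src e)) + R.dt j s = θ + R.dt j (N.src e) by ring]

open Classical in
theorem flow_eq_sum (e : E) (θ : ℝ) : R.flow α ρ C e θ = ∑ j ∈ Finset.range R.m,
    if R.Avail α ρ C j (N.src e) θ then R.x j * R.chi j e else 0 := by
  refine Finset.sum_congr rfl fun j hj => ?_
  by_cases h : R.Uses j e
  · simp only [h.mem_interval_iff R (Finset.mem_range.1 hj)]
    rfl
  · rw [R.chi_eq_zero h]
    have := R.chi_eq_zero h
    rw [chi] at this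
    rw [this]
    simp

/-- Only paths that use `e` contribute, so it suffices to know for these that the available ones are
those with index below `n`. This freedom permits both the index of the tail and that of the head. -/
theorem flow_eq_staticFlow {n : ℕ} (hn : n ≤ R.m)
    (h : ∀ l < R.m, R.Uses l e → (l < n ↔ R.Avail α ρ C l (N.src e) θ)) :
    R.flow α ρ C e θ = R.staticFlow n e := by
  classical
  rw [flow_eq_sum, staticFlow_eq_sum, ← Finset.sum_subset (Finset.range_mono hn)]
  · refine Finset.sum_congr rfl fun l hl => ?_
    by_cases hu : R.Uses l e
    · rw [if_pos ((h l ((Finset.mem_range.1 hl).trans_le hn) hu).1 (Finset.mem_range.1 hl))]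
    · simp [R.chi_eq_zero hu]
  · intro l hl hl'
    by_cases hu : R.Uses l e
    · rw [if_neg (mt (h l (Finset.mem_range.1 hl) hu).2 (by simpa using hl'))]
    · simp [R.chi_eq_zero hu]

theorem measurable_flow (hρ : IsSchedulingCost α ρ) (e : E) : Measurable (R.flow α ρ C e) := by
  classical
  have : R.flow α ρ C e = fun θ => ∑ j ∈ Finset.range R.m,
      if R.Avail α ρ C j (N.src e) θ then R.x j * R.chi j e else 0 := funext (R.flow_eq_sum e)
  rw [this]
  exact Finset.measurable_sum _ fun j _ => Measurable.ite
    (R.isClosed_avail hρ j _).measurableSet measurable_const measurable_const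

theorem exists_flow_support (hρ : IsSchedulingCost α ρ) :
    ∃ L, ∀ e θ, L < |θ| → R.flow α ρ C e θ = 0 := by
  classical
  have h : ∀ p : E × Fin R.m, ∃ B, ∀ θ, R.Avail α ρ C p.2 (N.src p.1) θ → |θ| ≤ B := fun p => by
    obtain ⟨B, -, hB⟩ := hρ.exists_bound (C - α * R.dt p.2 s)
    refine ⟨B + |R.dt p.2 (N.src p.1)|, fun θ hθ => ?_⟩
    have h1 := hB _ hθ
    have h2 := abs_sub (θ + R.dt p.2 (N.src p.1)) (R.dt p.2 (N.src p.1))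
    rw [add_sub_cancel_right] at h2
    linarith
  choose B hB using h
  obtain ⟨L, hL⟩ := (Set.finite_range B).bddAbove
  refine ⟨L, fun e θ hθ => ?_⟩
  rw [flow_eq_sum]
  refine Finset.sum_eq_zero fun j hj => if_neg fun ha => ?_
  have h1 := hB (e, ⟨j, Finset.mem_range.1 hj⟩) θ ha
  have h2 := hL ⟨(e, ⟨j, Finset.mem_range.1 hj⟩), rfl⟩
  linarith

open Classical in
/-- Flow conservation over time. -/
theorem flow_balance [Fintype E] (v : V) (θ : ℝ) :
    (∑ e, if N.src e = v then R.flow α ρ C e θ else 0) -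
      (∑ e, if N.tgt e = v then R.flow α ρ C e (θ - N.delay e) else 0) =
    ∑ j ∈ Finset.range R.m, (if R.Avail α ρ C j v θ then R.x j else 0) *
      ((if s = v then 1 else 0) - if t = v then 1 else 0) := by
  have h : ∀ j ∈ Finset.range R.m, (if R.Avail α ρ C j v θ then R.x j else 0) *
      ((if s = v then (1 : ℝ) else 0) - if t = v then 1 else 0) =
      (∑ e, if N.src e = v then
        (if R.Avail α ρ C j (N.src e) θ then R.x j * R.chi j e else 0) else 0) -
      (∑ e, if N.tgt e = v then
        (if R.Avail α ρ C j (N.src e) (θ - N.delay e) then R.x j * R.chi j e else 0)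
          else 0) := by
    intro j hj
    rw [← R.chi_balance (Finset.mem_range.1 hj) v, Finset.mul_sum, ← Finset.sum_sub_distrib]
    refine Finset.sum_congr rfl fun e _ => ?_
    -- Arcs of `P j` are tight, so availability at the tail on entry is availability at the head on
    -- arrival. All terms at `v` thus have the same condition, and the static balance of `P j`
    -- remains.
    by_cases hu : R.Uses j e
    · have h2 : R.Avail α ρ C j (N.src e) (θ - N.delay e) ↔ R.Avail α ρ C j (N.tgt e) θ := by
        rw [← hu.avail_iff R (Finset.mem_range.1 hj), sub_add_cancel]
      simp only [h2]
      by_cases h3 : N.src e = v <;> by_cases h4 : N.tgt e = v <;> simp [h3, h4]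
    · simp [R.chi_eq_zero hu]
  rw [Finset.sum_congr rfl h, Finset.sum_sub_distrib, Finset.sum_comm]
  congr 1
  · refine Finset.sum_congr rfl fun e _ => ?_
    split_ifs
    · exact R.flow_eq_sum e θ
    · simp
  · rw [Finset.sum_comm]
    refine Finset.sum_congr rfl fun e _ => ?_
    split_ifs
    · exact R.flow_eq_sum e _
    · simp

theorem flow_eq_zero (he : N.tgt e = s ∨ N.src e = t) : R.flow α ρ C e θ = 0 := by
  rw [R.flow_eq_staticFlow (n := 0) (Nat.zero_le _), staticFlow_zero]
  exact fun l hl hu => absurd hu (R.not_uses hl he)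

theorem volume_avail_ne_top (hρ : IsSchedulingCost α ρ) (j : ℕ) (v : V) :
    volume {θ | R.Avail α ρ C j v θ} ≠ ⊤ := by
  obtain ⟨B, -, hB⟩ := hρ.exists_bound (C - α * R.dt j s)
  refine ((measure_mono fun θ hθ => ?_).trans_lt
    (measure_Icc_lt_top (a := -B - R.dt j v) (b := B - R.dt j v))).ne
  have := abs_le.1 (hB _ hθ)
  exact ⟨by linarith [this.1], by linarith [this.2]⟩

open Classical in
theorem integrable_avail (hρ : IsSchedulingCost α ρ) (j : ℕ) (v : V) (a : ℝ) :
    Integrable fun θ => if R.Avail α ρ C j v θ then a else 0 :=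
  (integrable_indicator_iff (R.isClosed_avail hρ j v).measurableSet).2
    (integrableOn_const (R.volume_avail_ne_top hρ j v))

theorem integrable_flow (hρ : IsSchedulingCost α ρ) (e : E) : Integrable (R.flow α ρ C e) := by
  classical
  have : R.flow α ρ C e = fun θ => ∑ j ∈ Finset.range R.m,
      if R.Avail α ρ C j (N.src e) θ then R.x j * R.chi j e else 0 := funext (R.flow_eq_sum e)
  rw [this]
  exact integrable_finsetSum _ fun j _ => R.integrable_avail hρ j _ _

open Classical in
theorem integral_avail (hρ : IsSchedulingCost α ρ) (v : V) :
    ∫ θ, ∑ j ∈ Finset.range R.m, (if R.Avail α ρ C j v θ then R.x j else 0) =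
      R.value α ρ C := by
  rw [integral_finsetSum _ fun j _ => R.integrable_avail hρ j v _]
  refine Finset.sum_congr rfl fun j _ => ?_
  have hset : {θ | R.Avail α ρ C j v θ}
      = (fun θ => θ + (R.dt j v - R.dt j s)) ⁻¹' R.interval α ρ C j := by
    ext θ
    rw [mem_preimage, mem_interval,
      show θ + (R.dt j v - R.dt j s) + R.dt j s = θ + R.dt j v by ring]
    rfl
  have h1 : (fun θ => if R.Avail α ρ C j v θ then R.x j else 0)
      = {θ | R.Avail α ρ C j v θ}.indicator fun _ => R.x j := by
    ext θ; simp [indicator_apply]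
  rw [h1, integral_indicator (R.isClosed_avail hρ j v).measurableSet, setIntegral_const, hset,
    measureReal_def, measure_preimage_add_right, smul_eq_mul, mul_comm]

open Classical in
theorem integral_flow_src_s [Fintype E] (hst : s ≠ t) (hρ : IsSchedulingCost α ρ) :
    ∫ θ, (∑ e, if N.src e = s then R.flow α ρ C e θ else 0) = R.value α ρ C := by
  rw [← R.integral_avail hρ s]
  refine integral_congr_ae (Filter.Eventually.of_forall fun θ => ?_)
  have h := R.flow_balance (α := α) (ρ := ρ) (C := C) s θ
  have h0 : (∑ e, if N.tgt e = s then R.flow α ρ C e (θ - N.delay e) else 0) = 0 :=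
    Finset.sum_eq_zero fun e _ => by
      split_ifs with he
      exacts [R.flow_eq_zero (Or.inl he), rfl]
  rw [h0, sub_zero] at h
  simpa [hst.symm] using h

open Classical in
theorem integral_flow_tgt_t [Fintype E] (hst : s ≠ t) (hρ : IsSchedulingCost α ρ) :
    ∑ e, (if N.tgt e = t then ∫ θ, R.flow α ρ C e θ else 0) = R.value α ρ C := by
  rw [← R.integral_avail hρ t]
  have h1 : ∀ e, (if N.tgt e = t then ∫ θ, R.flow α ρ C e θ else 0)
      = ∫ θ, if N.tgt e = t then R.flow α ρ C e (θ - N.delay e) else 0 := fun e => by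
    split_ifs
    · exact (integral_sub_right_eq_self _ _).symm
    · simp
  rw [Finset.sum_congr rfl fun e _ => h1 e, ← integral_finsetSum]
  · refine integral_congr_ae (Filter.Eventually.of_forall fun θ => ?_)
    have h := R.flow_balance (α := α) (ρ := ρ) (C := C) t θ
    have h0 : (∑ e, if N.src e = t then R.flow α ρ C e θ else 0) = 0 :=
      Finset.sum_eq_zero fun e _ => by
        split_ifs with he
        exacts [R.flow_eq_zero (Or.inr he), rfl]
    rw [h0, zero_sub] at h
    simpa [hst] using h
  · intro e _
    split_ifs
    · exact (R.integrable_flow hρ e).comp_sub_right _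
    · simp

/-! ### The index `J` -/

/-- Passing from `j` to `i` lowers the distance from `v` by some `d`, which costs at most `α d` in
`ρ`. By `gap_mono` the distance from `s` drops by at least `d`, so the right-hand side gains at
least `α d`. -/
theorem Avail.anti (hρ : IsSchedulingCost α ρ) (hα : 0 < α) {i : ℕ} (hij : i ≤ j) (hj : j < R.m)
    (hv : R.Reaches v) (h : R.Avail α ρ C j v θ) : R.Avail α ρ C i v θ := by
  have h1 := hρ.le_add (y := θ + R.dt i v) (z := θ + R.dt j v)
    (by linarith [R.dt_mono hij hj hv])
  have h2 := mul_le_mul_of_nonneg_left (R.gap_mono hij hj hv) hα.le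
  simp only [Avail] at *
  linarith

/-- Index shift: `c` counts paths from one, `Avail` from zero. -/
theorem c_succ_le_iff (hj : j < R.m) :
    R.c α ρ (j + 1) v θ ≤ (C : EReal) ↔ R.Reaches v ∧ R.Avail α ρ C j v θ := by
  have hs := R.coe_dt hj (R.reaches_s (by omega))
  simp only [c, Nat.add_sub_cancel, rhoAt]
  rw [hs]
  by_cases hv : R.Reaches v
  · rw [if_neg ((R.reaches_iff hj).2 hv)]
    simp only [hv, true_and, Avail, ← EReal.coe_mul, ← EReal.coe_add, EReal.coe_le_coe_iff]
    rw [dt, ← le_sub_iff_add_le']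
    rfl
  · have h := hv
    rw [← R.reaches_iff hj, not_not] at h
    rw [if_pos h, ← EReal.coe_mul, EReal.coe_add_top]
    simp [hv]

theorem J_le : R.J α ρ C v θ ≤ R.m := by
  classical
  refine Finset.sup_le fun j hj => ?_
  exact (Finset.mem_Icc.1 (Finset.mem_filter.1 hj).1).2

/-- By `Avail.anti` the available indices form an initial segment, and `J` is its length. -/
theorem lt_J_iff (hρ : IsSchedulingCost α ρ) (hα : 0 < α) (hj : j < R.m) (hv : R.Reaches v) :
    j < R.J α ρ C v θ ↔ R.Avail α ρ C j v θ := by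
  classical
  constructor
  · intro h
    obtain ⟨k, hk, hjk⟩ := Finset.lt_sup_iff.1 h
    obtain ⟨h1, h2⟩ := Finset.mem_filter.1 hk
    obtain ⟨h3, h4⟩ := Finset.mem_Icc.1 h1
    obtain ⟨k, rfl⟩ : ∃ k', k = k' + 1 := ⟨k - 1, by omega⟩
    exact Avail.anti R hρ hα (Nat.lt_succ_iff.1 hjk) h4 hv ((R.c_succ_le_iff h4).1 h2).2
  · intro h
    refine Nat.lt_of_succ_le (Finset.le_sup (f := id) (b := j + 1) ?_)
    exact Finset.mem_filter.2 ⟨Finset.mem_Icc.2 ⟨by omega, hj⟩, (R.c_succ_le_iff hj).2 ⟨hv, h⟩⟩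

/-- At each time the flow on an arc is that of one static flow of the run. The index can be read off
at the tail, or at the head on arrival; the two indices may differ, but no path between them uses
the arc. -/
theorem flow_eq_J_src (hρ : IsSchedulingCost α ρ) (hα : 0 < α) :
    R.flow α ρ C e θ = R.staticFlow (R.J α ρ C (N.src e) θ) e :=
  R.flow_eq_staticFlow R.J_le fun _ hl hu => R.lt_J_iff hρ hα hl (hu.reaches R hl).1

theorem flow_eq_J_tgt (hρ : IsSchedulingCost α ρ) (hα : 0 < α) :
    R.flow α ρ C e θ = R.staticFlow (R.J α ρ C (N.tgt e) (θ + N.delay e)) e :=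
  R.flow_eq_staticFlow R.J_le fun l hl hu => by
    rw [← hu.avail_iff R hl]; exact R.lt_J_iff hρ hα hl (hu.reaches R hl).2

theorem flow_nonneg (hρ : IsSchedulingCost α ρ) (hα : 0 < α) : 0 ≤ R.flow α ρ C e θ := by
  rw [R.flow_eq_J_src hρ hα]; exact (R.staticFlow_mem R.J_le e).1

theorem flow_le_cap (hρ : IsSchedulingCost α ρ) (hα : 0 < α) : R.flow α ρ C e θ ≤ N.cap e := by
  rw [R.flow_eq_J_src hρ hα]; exact (R.staticFlow_mem R.J_le e).2

end SSPRun

open Network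

namespace SSPRun

variable {V E : Type*} {N : Network V E} {s t : V} (R : SSPRun N s t) {α : ℝ} {ρ : ℝ → ℝ} {C : ℝ}

/-! ### A counter that increases over time and decreases along flow-carrying arcs -/

/-- The first time at which flow on the path number `j` can be at `v` has passed. -/
def Opened (α : ℝ) (ρ : ℝ → ℝ) (C : ℝ) (j : ℕ) (v : V) (θ : ℝ) : Prop :=
  ∃ y ≤ θ + R.dt j v, ρ y ≤ C - α * R.dt j s

/-- The last time at which flow on the path number `j` can be at `v` has passed. -/
def Closed (α : ℝ) (ρ : ℝ → ℝ) (C : ℝ) (j : ℕ) (v : V) (θ : ℝ) : Prop :=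
  ∀ y, θ + R.dt j v ≤ y → C - α * R.dt j s < ρ y

open Classical in
/-- The number of paths with a nonempty interval. -/
def numActive (α C : ℝ) : ℕ :=
  ((Finset.range R.m).filter fun j => 0 ≤ C - α * R.dt j s).card

open Classical in
-- Over time the events at a vertex that reaches `t` come in the order: windows `0, …, n - 1` open,
-- then windows `n - 1, …, 0` close, where `n` is `numActive`. The counter is the number of events
-- so far.
def counter (α : ℝ) (ρ : ℝ → ℝ) (C : ℝ) (v : V) (θ : ℝ) : ℕ :=
  ((Finset.range (R.numActive α C)).filter fun j => R.Opened α ρ C j v θ).card +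
    ((Finset.range (R.numActive α C)).filter fun j => R.Closed α ρ C j v θ).card

theorem Opened.mono {j : ℕ} {v : V} {θ θ' : ℝ} (h : θ ≤ θ') (ho : R.Opened α ρ C j v θ) :
    R.Opened α ρ C j v θ' := by
  obtain ⟨y, h1, h2⟩ := ho
  exact ⟨y, by linarith, h2⟩

theorem Closed.mono {j : ℕ} {v : V} {θ θ' : ℝ} (h : θ ≤ θ') (ho : R.Closed α ρ C j v θ) :
    R.Closed α ρ C j v θ' := fun y hy => ho y (by linarith)

theorem counter_mono (v : V) : Monotone (R.counter α ρ C v) := fun θ θ' h => by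
  classical
  refine add_le_add (Finset.card_le_card ?_) (Finset.card_le_card ?_)
  · exact Finset.monotone_filter_right _ fun j _ hj => Opened.mono R h hj
  · exact Finset.monotone_filter_right _ fun j _ hj => Closed.mono R h hj

theorem counter_le (v : V) (θ : ℝ) : R.counter α ρ C v θ ≤ 2 * R.numActive α C := by
  classical
  have h1 := Finset.card_filter_le (Finset.range (R.numActive α C))
    fun j => R.Opened α ρ C j v θ
  have h2 := Finset.card_filter_le (Finset.range (R.numActive α C))
    fun j => R.Closed α ρ C j v θ
  rw [Finset.card_range] at h1 h2
  rw [counter]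
  omega

/-- Counting an initial segment of an interval. -/
theorem card_filter_range_of_anti {n : ℕ} {p : ℕ → Prop} [DecidablePred p]
    (h : ∀ i j, i ≤ j → j < n → p j → p i) {j : ℕ} (hj : j < n) :
    j < ((Finset.range n).filter p).card ↔ p j := by
  constructor
  · intro hlt
    by_contra hp
    have hsub : (Finset.range n).filter p ⊆ Finset.range j := fun i hi => by
      obtain ⟨h1, h2⟩ := Finset.mem_filter.1 hi
      rw [Finset.mem_range] at *
      by_contra hij
      exact hp (h j i (by omega) h1 h2)
    have := Finset.card_le_card hsub
    rw [Finset.card_range] at this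
    omega
  · intro hp
    have hsub : Finset.range (j + 1) ⊆ (Finset.range n).filter p := fun i hi => by
      rw [Finset.mem_range] at hi
      exact Finset.mem_filter.2 ⟨Finset.mem_range.2 (by omega), h i j (by omega) hj hp⟩
    have := Finset.card_le_card hsub
    rw [Finset.card_range] at this
    omega

variable [Finite V] [Finite E] {j : ℕ} {e : E} {v : V} {θ : ℝ}

theorem numActive_le : R.numActive α C ≤ R.m := by
  classical
  exact (Finset.card_filter_le _ _).trans_eq (Finset.card_range _)

theorem lt_numActive_iff (hα : 0 < α) (hj : j < R.m) :
    j < R.numActive α C ↔ 0 ≤ C - α * R.dt j s := by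
  classical
  refine card_filter_range_of_anti (fun i j hij hj h => ?_) hj
  have := mul_le_mul_of_nonneg_left (R.dt_mono hij hj (R.reaches_s (by omega))) hα.le
  linarith

/-- Sublevel sets of the unimodal function `ρ` are intervals. -/
theorem avail_iff_opened_and (hρ : IsSchedulingCost α ρ) :
    R.Avail α ρ C j v θ ↔ R.Opened α ρ C j v θ ∧ ¬ R.Closed α ρ C j v θ := by
  simp only [Avail, Opened, Closed, not_forall, not_lt, exists_prop]
  constructor
  · exact fun h => ⟨⟨_, le_rfl, h⟩, ⟨_, le_rfl, h⟩⟩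
  · rintro ⟨⟨y, hy, h1⟩, ⟨z, hz, h2⟩⟩
    exact (hρ.le_max hy hz).trans (max_le h1 h2)

theorem Opened.anti (hρ : IsSchedulingCost α ρ) (hα : 0 < α) {i : ℕ} (hij : i ≤ j) (hj : j < R.m)
    (hv : R.Reaches v) (h : R.Opened α ρ C j v θ) : R.Opened α ρ C i v θ := by
  obtain ⟨y, h1, h2⟩ := h
  have h0 := R.dt_mono hij hj hv
  have h3 := hρ.le_add (y := y - (R.dt j v - R.dt i v)) (z := y) (by linarith)
  have h4 := mul_le_mul_of_nonneg_left (R.gap_mono hij hj hv) hα.le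
  refine ⟨y - (R.dt j v - R.dt i v), by linarith, ?_⟩
  linarith

theorem Closed.mono_index (hα : 0 < α) {i : ℕ} (hij : i ≤ j) (hj : j < R.m)
    (hv : R.Reaches v) (h : R.Closed α ρ C i v θ) : R.Closed α ρ C j v θ := fun y hy => by
  have h1 := mul_le_mul_of_nonneg_left (R.dt_mono hij hj (R.reaches_s (by omega))) hα.le
  have h2 := h y (by linarith [R.dt_mono hij hj hv])
  linarith

/-- The window of an active path contains the moment at which punctual arrival, with cost `ρ 0 = 0`,
is possible; a closed window has passed it. -/
theorem Closed.opened (hρ : IsSchedulingCost α ρ) (hα : 0 < α) (hj : j < R.numActive α C)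
    (h : R.Closed α ρ C j v θ) : R.Opened α ρ C j v θ := by
  have h0 := (R.lt_numActive_iff hα (hj.trans_le R.numActive_le)).1 hj
  refine ⟨0, ?_, by rwa [hρ.zero]⟩
  by_contra hlt
  have := h 0 (by linarith)
  rw [hρ.zero] at this
  linarith

theorem Uses.opened_iff (hj : j < R.m) (h : R.Uses j e) :
    R.Opened α ρ C j (N.tgt e) (θ + N.delay e) ↔ R.Opened α ρ C j (N.src e) θ := by
  simp only [Opened, h.dt_src R hj, add_assoc]

theorem lt_numActive_of_lt_J (hρ : IsSchedulingCost α ρ) (hα : 0 < α) (hv : R.Reaches v)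
    (hj : j < R.J α ρ C v θ) : j < R.numActive α C := by
  have hm := hj.trans_le R.J_le
  rw [R.lt_numActive_iff hα hm]
  exact (hρ.nonneg _).trans ((R.lt_J_iff hρ hα hm hv).1 hj)

/-- The counter determines `J`. -/
theorem J_eq_counter (hρ : IsSchedulingCost α ρ) (hα : 0 < α) (hv : R.Reaches v) :
    R.J α ρ C v θ = min (R.counter α ρ C v θ) (2 * R.numActive α C - R.counter α ρ C v θ) := by
  classical
  set n := R.numActive α C with hn
  have hnm : n ≤ R.m := R.numActive_le
  set a := ((Finset.range n).filter fun j => R.Opened α ρ C j v θ).card with ha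
  set b := ((Finset.range n).filter fun j => ¬ R.Closed α ρ C j v θ).card with hb
  have hab : R.counter α ρ C v θ = a + (n - b) := by
    have := Finset.card_filter_add_card_filter_not (s := Finset.range n)
      fun j => R.Closed α ρ C j v θ
    rw [Finset.card_range] at this
    rw [counter, ← hn, ← ha]
    omega
  have hA : ∀ j < n, (j < a ↔ R.Opened α ρ C j v θ) := fun j hj =>
    card_filter_range_of_anti (fun i j hij hj h => Opened.anti R hρ hα hij (by omega) hv h) hj
  have hB : ∀ j < n, (j < b ↔ ¬ R.Closed α ρ C j v θ) := fun j hj =>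
    card_filter_range_of_anti
      (fun i j hij hj h h' => h (Closed.mono_index R hα hij (by omega) hv h')) hj
  have han : a ≤ n := by simpa using Finset.card_filter_le (Finset.range n) _
  have hbn : b ≤ n := by simpa using Finset.card_filter_le (Finset.range n) _
  have hJn : R.J α ρ C v θ ≤ n := by
    by_contra hlt
    exact absurd (R.lt_numActive_of_lt_J hρ hα hv (not_le.1 hlt)) (lt_irrefl _)
  have hJ : ∀ j < n, (j < R.J α ρ C v θ ↔ j < a ∧ j < b) := fun j hj => by
    rw [R.lt_J_iff hρ hα (by omega) hv, R.avail_iff_opened_and hρ, hA j hj, hB j hj]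
  -- Here `J = min a b` and the counter is `a + (n - b)`. No window closes before all have opened,
  -- because the closing of any one entails that of number `n - 1`, which has then been open.
  have hnb : b < n → a = n := fun h => by
    by_contra hne
    have h1 : R.Closed α ρ C b v θ := by
      have := (hB b h); simpa using this
    have h2 := Closed.mono_index R hα (show b ≤ n - 1 by omega) (by omega) hv h1
    have h3 := (hA (n - 1) (by omega)).2 (Closed.opened R hρ hα (by omega) h2)
    omega
  have h4 := hJ (R.J α ρ C v θ)
  have h5 := hJ (min a b)
  rcases lt_or_eq_of_le hbn with h | h
  · have := hnb h
    rcases lt_trichotomy (R.J α ρ C v θ) b with h' | h' | h'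
    · have := h4 (by omega); omega
    · omega
    · have := hJ b h; omega
  · rcases lt_trichotomy (R.J α ρ C v θ) a with h' | h' | h'
    · have := h4 (by omega); omega
    · omega
    · have := hJ a (by omega); omega

/-- The counter does not increase along arcs that carry flow. -/
theorem counter_tgt_le (hρ : IsSchedulingCost α ρ) (hα : 0 < α) (h : 0 < R.flow α ρ C e θ) :
    R.counter α ρ C (N.tgt e) (θ + N.delay e) ≤ R.counter α ρ C (N.src e) θ := by
  classical
  have hJm : R.J α ρ C (N.src e) θ ≤ R.m := R.J_le
  have hf : 0 < R.staticFlow (R.J α ρ C (N.src e) θ) e := by rwa [← R.flow_eq_J_src hρ hα]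
  obtain ⟨hv, hw⟩ := R.reaches_of_staticFlow_pos R.J_le hf
  have key : ∀ j < R.numActive α C,
      (R.Opened α ρ C j (N.tgt e) (θ + N.delay e) → R.Opened α ρ C j (N.src e) θ) ∧
      (R.Closed α ρ C j (N.tgt e) (θ + N.delay e) → R.Closed α ρ C j (N.src e) θ) := by
    intro j hj
    have hjm := hj.trans_le R.numActive_le
    -- If `e` carries flow in the static flow number `j`, its backward copy is residual and the
    -- events of window `j` occur at the tail no later than at the head. Otherwise some path `l`
    -- between `j` and `J` uses `e`. If `l < J`, path `l` is available at both ends, so window `j ≤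
    -- l` is open at both. If `l ≥ J`, its window is either closed at the tail, and so is that of `j
    -- > l`, or not yet open at the head, and neither is that of `j`.
    by_cases hfj : 0 < R.staticFlow j e
    · have hd := R.dt_tgt_le hjm hfj
      refine ⟨fun ⟨y, h1, h2⟩ => ⟨y, by linarith, h2⟩, fun h y hy => h y (by linarith)⟩
    have hne : R.staticFlow j e ≠ R.staticFlow (R.J α ρ C (N.src e) θ) e := fun he =>
      hfj (he ▸ hf)
    rcases le_total j (R.J α ρ C (N.src e) θ) with hjJ | hjJ
    · obtain ⟨l, h1, h2, hu⟩ : ∃ l, j ≤ l ∧ l < R.J α ρ C (N.src e) θ ∧ R.Uses l e := by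
        by_contra! hcon
        exact hne (R.staticFlow_eq_of_not_uses hjJ hcon)
      have hlm : l < R.m := by omega
      have hl := (R.avail_iff_opened_and hρ).1 ((R.lt_J_iff hρ hα hlm hv).1 h2)
      have hl' := (R.avail_iff_opened_and hρ).1
        ((hu.avail_iff R hlm).2 ((R.lt_J_iff hρ hα hlm hv).1 h2))
      exact ⟨fun _ => Opened.anti R hρ hα h1 hlm hv hl.1,
        fun hc => absurd (Closed.mono_index R hα h1 hlm hw hc) hl'.2⟩
    · obtain ⟨l, h1, h2, hu⟩ : ∃ l, R.J α ρ C (N.src e) θ ≤ l ∧ l < j ∧ R.Uses l e := by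
        by_contra! hcon
        exact hne (R.staticFlow_eq_of_not_uses hjJ hcon).symm
      have hlm : l < R.m := by omega
      have hl : ¬ R.Avail α ρ C l (N.src e) θ := fun hA => by
        have := (R.lt_J_iff hρ hα hlm hv).2 hA
        omega
      by_cases hc : R.Closed α ρ C l (N.src e) θ
      · have hc' := Closed.mono_index R hα h2.le hjm hv hc
        exact ⟨fun _ => Closed.opened R hρ hα hj hc', fun _ => hc'⟩
      · have ho : ¬ R.Opened α ρ C l (N.tgt e) (θ + N.delay e) := fun ho =>
          hl ((R.avail_iff_opened_and hρ).2 ⟨(hu.opened_iff R hlm).1 ho, hc⟩)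
        have ho' : ¬ R.Opened α ρ C j (N.tgt e) (θ + N.delay e) := fun h =>
          ho (Opened.anti R hρ hα h2.le hjm hw h)
        exact ⟨fun h => absurd h ho', fun h => absurd (Closed.opened R hρ hα hj h) ho'⟩
  refine add_le_add (Finset.card_le_card fun j hj => ?_) (Finset.card_le_card fun j hj => ?_)
  · obtain ⟨h1, h2⟩ := Finset.mem_filter.1 hj
    exact Finset.mem_filter.2 ⟨h1, (key j (Finset.mem_range.1 h1)).1 h2⟩
  · obtain ⟨h1, h2⟩ := Finset.mem_filter.1 hj
    exact Finset.mem_filter.2 ⟨h1, (key j (Finset.mem_range.1 h1)).2 h2⟩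

/-- There is a bounded integer-valued function of vertices and times that does not decrease over
time, and that decreases strictly along arcs that carry flow. -/
theorem exists_key (hN : N.NoZeroDelayCycle) (hρ : IsSchedulingCost α ρ) (hα : 0 < α) :
    ∃ (K : V → ℝ → ℕ) (B : ℕ), (∀ v, Monotone (K v)) ∧ (∀ v θ, K v θ ≤ B) ∧
      ∀ e θ, 0 < R.flow α ρ C e θ → K (N.tgt e) (θ + N.delay e) < K (N.src e) θ := by
  choose! rk h1 h2 using fun j (hj : j ≤ R.m) => R.exists_rank hN hj
  let n := R.numActive α C
  have hn : n ≤ R.m := R.numActive_le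
  let idx : ℕ → ℕ := fun k => min k (2 * n - k)
  have hidx : ∀ k, idx k ≤ R.m := fun k => by simp only [idx]; omega
  -- The lexicographic order of counter and rank, encoded in base `Nat.card V + 1` since ranks are
  -- at most `Nat.card V`. If the counters at the ends of an arc agree, both ends use the same
  -- static flow, and its rank decreases.
  refine ⟨fun v θ => R.counter α ρ C v θ * (Nat.card V + 1) + rk (idx (R.counter α ρ C v θ)) v,
    2 * n * (Nat.card V + 1) + Nat.card V, fun v θ θ' h => ?_, fun v θ => ?_, fun e θ h => ?_⟩
  · rcases (R.counter_mono (α := α) (ρ := ρ) (C := C) v h).lt_or_eq with hlt | heq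
    · have h3 := h1 _ (hidx (R.counter α ρ C v θ)) v
      have h4 := Nat.mul_le_mul_right (Nat.card V + 1) (Nat.succ_le_of_lt hlt)
      rw [Nat.succ_mul] at h4
      simp only
      omega
    · simp only [heq, le_refl]
  · have h3 := h1 _ (hidx (R.counter α ρ C v θ)) v
    have h4 := Nat.mul_le_mul_right (Nat.card V + 1) (R.counter_le (α := α) (ρ := ρ) (C := C) v θ)
    exact add_le_add h4 h3
  · rcases (R.counter_tgt_le hρ hα h).lt_or_eq with hlt | heq
    · have h3 := h1 _ (hidx (R.counter α ρ C (N.tgt e) (θ + N.delay e))) (N.tgt e)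
      have h4 := Nat.mul_le_mul_right (Nat.card V + 1) (Nat.succ_le_of_lt hlt)
      rw [Nat.succ_mul] at h4
      simp only
      omega
    · have hf : 0 < R.staticFlow (R.J α ρ C (N.src e) θ) e := by rwa [← R.flow_eq_J_src hρ hα]
      have hv := (R.reaches_of_staticFlow_pos R.J_le hf).1
      rw [R.J_eq_counter hρ hα hv] at hf
      simp only [heq]
      exact Nat.add_lt_add_left (h2 _ (hidx _) e hf) _

end SSPRun

open Network

namespace SSPRun

variable {V E : Type*} {N : Network V E} {s t : V} (R : SSPRun N s t) {α : ℝ} {ρ : ℝ → ℝ} {C : ℝ}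

/-! ### Distances from `s` -/

variable [Finite V] [Finite E] {j : ℕ} {e : E} {v : V} {θ : ℝ}

theorem dist_s_arc_le (hj : j ≤ R.m) {r : E × Bool} (hr : 0 < N.rcap (R.staticFlow j) r) (u : V) :
    R.dist j u (N.rtgt r) ≤ R.dist j u (N.rsrc r) + (N.rdelay r : ℝ) := by
  have h := R.dist_arc_le hj hr (N.rtgt r)
  rw [dist_self, add_zero] at h
  exact (R.dist_triangle hj u _ _).trans (add_le_add le_rfl h)

/-- The counterpart of `dist_feasible_of_isPotential` for distances from `s`: new arcs are reversed
arcs of a shortest path and hence tight. -/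
theorem dist_s_feasible (hj : j < R.m) {r : E × Bool}
    (hr : 0 < N.rcap (R.staticFlow (j + 1)) r) :
    R.dist j s (N.rtgt r) ≤ R.dist j s (N.rsrc r) + (N.rdelay r : ℝ) := by
  rcases R.rcap_pos_or hj hr with h | h
  · exact R.dist_s_arc_le hj.le h s
  · obtain ⟨q, hq⟩ := R.exists_isPotential hj.le
    obtain ⟨l₁, l₂, hl⟩ := List.append_of_mem h
    have hw := (R.isPath j hj).1.1
    rw [hl] at hw
    obtain ⟨x, h₁, h₂⟩ := isWalk_append.1 hw
    have hx : N.rtgt r = x := by simpa using h₂.1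
    subst hx
    have h3 := (R.dist_suffix_of_isPotential hj hq hl h₁ h₂).2
    have h4 := (R.dist_suffix_of_isPotential hj hq (v := N.rsrc r) (l₁ := l₁ ++ [rev r])
      (l₂ := l₂) (by simp [hl]) (isWalk_append.2 ⟨_, h₁, by simp [IsWalk]⟩)
      (by simpa using h₂.2)).2
    rw [h3, h4, ← EReal.coe_add, rlength_append, rlength_cons]
    simp [rlength]

theorem dist_s_le_succ (hj : j < R.m) (v : V) : R.dist j s v ≤ R.dist (j + 1) s v := by
  have key : ∀ (l : List (E × Bool)) (u : V), IsWalk N.rsrc N.rtgt u v l →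
      (∀ r ∈ l, 0 < N.rcap (R.staticFlow (j + 1)) r) →
      R.dist j s v ≤ R.dist j s u + (N.rlength l : ℝ) := by
    intro l
    induction l with
    | nil =>
      rintro u rfl -
      simp [rlength]
    | cons r l ih =>
      intro u hl ha
      have h1 := ih _ hl.2 fun r hr => ha r (List.mem_cons_of_mem _ hr)
      have h2 := R.dist_s_feasible hj (ha r (by simp))
      rw [hl.1] at h2
      rw [rlength_cons, EReal.coe_add, ← add_assoc]
      exact h1.trans (add_le_add h2 le_rfl)
  rcases N.rdist_eq_top_or (f := R.staticFlow (j + 1)) s v with h | ⟨l, hl, h⟩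
  · rw [dist, dist, h]; exact le_top
  · have := key l s hl.1.1 hl.2
    rw [dist_self, zero_add] at this
    exact this.trans_eq h.symm

/-- The first residual network has no backward arcs and therefore no negative delays; later
distances from `s` are not smaller. -/
theorem dist_s_nonneg (hj : j ≤ R.m) (v : V) : 0 ≤ R.dist j s v := by
  induction j with
  | zero => exact R.dist_zero_nonneg s v
  | succ j ih => exact (ih (by omega)).trans (R.dist_s_le_succ hj v)

/-- A vertex of an augmenting path is at least as close to `t` as `s`. -/
theorem Uses.gap_nonneg (hj : j < R.m) (h : R.Uses j e) :
    0 ≤ R.dt j s - R.dt j (N.src e) := by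
  rw [← h.dist_s_src R hj]
  exact EReal.toReal_nonneg (R.dist_s_nonneg hj.le _)

/-! ### The dual solution -/

theorem neg_mul_dist_eq (d : ℝ) (i : ℕ) (h : R.dist i v s = d) :
    -((α : EReal) * R.dist i v s) = ((-(α * d) : ℝ) : EReal) := by
  rw [h, ← EReal.coe_mul, EReal.coe_neg]

theorem sub_rhoAt_eq (d : ℝ) (i : ℕ) (h : R.dist i v t = d) :
    (C : EReal) - (α : EReal) * R.dist i v t - rhoAt ρ θ (R.dist i v t)
      = ((C - α * d - ρ (θ + d) : ℝ) : EReal) := by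
  rw [h, rhoAt, if_neg (EReal.coe_ne_top d), EReal.toReal_coe, ← EReal.coe_mul, ← EReal.coe_sub,
    ← EReal.coe_sub]

theorem neg_mul_dist_eq_bot (hα : 0 < α) (i : ℕ) (h : R.dist i v s = ⊤) :
    -((α : EReal) * R.dist i v s) = ⊥ := by
  rw [h, EReal.coe_mul_top_of_pos hα, EReal.neg_top]

theorem sub_rhoAt_eq_bot (hα : 0 < α) (i : ℕ) (h : R.dist i v t = ⊤) :
    (C : EReal) - (α : EReal) * R.dist i v t - rhoAt ρ θ (R.dist i v t) = ⊥ := by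
  rw [h, EReal.coe_mul_top_of_pos hα, EReal.sub_top, EReal.bot_sub]

theorem coe_potential (hα : 0 < α) : ((R.potential α ρ C v θ : ℝ) : EReal) =
    max (max (-((α : EReal) * R.dist (R.J α ρ C v θ) v s))
      ((C : EReal) - (α : EReal) * R.dist (R.J α ρ C v θ) v t
        - rhoAt ρ θ (R.dist (R.J α ρ C v θ) v t))) 0 := by
  refine EReal.coe_toReal ?_ ?_
  · refine (max_lt (max_lt ?_ ?_) EReal.zero_lt_top).ne
    · by_cases h : R.dist (R.J α ρ C v θ) v s = ⊤
      · rw [R.neg_mul_dist_eq_bot hα _ h]; exact bot_lt_top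
      · rw [R.neg_mul_dist_eq _ _ (EReal.coe_toReal h (R.dist_ne_bot _ _ _)).symm]
        exact EReal.coe_lt_top _
    · by_cases h : R.dist (R.J α ρ C v θ) v t = ⊤
      · rw [R.sub_rhoAt_eq_bot hα _ h]; exact bot_lt_top
      · rw [R.sub_rhoAt_eq _ _ (EReal.coe_toReal h (R.dist_ne_bot _ _ _)).symm]
        exact EReal.coe_lt_top _
  · exact (lt_of_lt_of_le EReal.bot_lt_zero (le_max_right _ _)).ne'

theorem potential_nonneg (hα : 0 < α) : 0 ≤ R.potential α ρ C v θ := by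
  have : (0 : EReal) ≤ (R.potential α ρ C v θ : ℝ) := by
    rw [R.coe_potential hα]; exact le_max_right _ _
  exact_mod_cast this

theorem le_potential_s (hα : 0 < α) {d : ℝ} (h : R.dist (R.J α ρ C v θ) v s = d) :
    -(α * d) ≤ R.potential α ρ C v θ := by
  rw [← EReal.coe_le_coe_iff, R.coe_potential hα, ← R.neg_mul_dist_eq d _ h]
  exact le_max_of_le_left (le_max_left _ _)

theorem le_potential_t (hα : 0 < α) {d : ℝ} (h : R.dist (R.J α ρ C v θ) v t = d) :
    C - α * d - ρ (θ + d) ≤ R.potential α ρ C v θ := by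
  rw [← EReal.coe_le_coe_iff, R.coe_potential hα, ← R.sub_rhoAt_eq d _ h]
  exact le_max_of_le_left (le_max_right _ _)

theorem potential_le (hα : 0 < α) {x : ℝ} (h0 : 0 ≤ x)
    (h1 : ∀ d : ℝ, R.dist (R.J α ρ C v θ) v s = d → -(α * d) ≤ x)
    (h2 : ∀ d : ℝ, R.dist (R.J α ρ C v θ) v t = d → C - α * d - ρ (θ + d) ≤ x) :
    R.potential α ρ C v θ ≤ x := by
  rw [← EReal.coe_le_coe_iff, R.coe_potential hα]
  refine max_le (max_le ?_ ?_) (by exact_mod_cast h0)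
  · by_cases h : R.dist (R.J α ρ C v θ) v s = ⊤
    · rw [R.neg_mul_dist_eq_bot hα _ h]; exact bot_le
    · have h' := (EReal.coe_toReal h (R.dist_ne_bot _ _ _)).symm
      rw [R.neg_mul_dist_eq _ _ h']
      exact_mod_cast h1 _ h'
  · by_cases h : R.dist (R.J α ρ C v θ) v t = ⊤
    · rw [R.sub_rhoAt_eq_bot hα _ h]; exact bot_le
    · have h' := (EReal.coe_toReal h (R.dist_ne_bot _ _ _)).symm
      rw [R.sub_rhoAt_eq _ _ h']
      exact_mod_cast h2 _ h'

/-- The first term is zero. Path number `J` is the first that is not available at `s`, which says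
that the second term is negative; it is `⊥` when `J = m`. -/
theorem potential_s (hα : 0 < α) (hρ : IsSchedulingCost α ρ) : R.potential α ρ C s θ = 0 := by
  refine le_antisymm (R.potential_le hα le_rfl (fun d hd => ?_) fun d hd => ?_)
    (R.potential_nonneg hα)
  · rw [dist_self] at hd
    have : d = 0 := by exact_mod_cast hd.symm
    simp [this]
  · have hJ : R.J α ρ C s θ < R.m := by
      refine lt_of_le_of_ne R.J_le fun h => ?_
      rw [h, dist_m_st] at hd
      exact EReal.coe_ne_top _ hd.symm
    have hs := R.reaches_s (Nat.zero_lt_of_lt hJ)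
    obtain rfl : R.dt (R.J α ρ C s θ) s = d := by rw [dt, hd, EReal.toReal_coe]
    have h := mt (R.lt_J_iff (C := C) (θ := θ) hρ hα hJ hs).2 (lt_irrefl _)
    simp only [Avail, not_le] at h
    linarith

theorem le_potential_at_t (hα : 0 < α) : C - ρ θ ≤ R.potential α ρ C t θ := by
  have := R.le_potential_t (ρ := ρ) (C := C) (v := t) (θ := θ) hα (d := 0) (by simp [dist_self])
  simpa using this

/-- The term with the distance to `t` is `C - ρ θ`. If `J > 0`, then `-α d_J(t,s) = α d_{J-1}(s,t)`,
and this is at most `C - ρ θ` because path `J - 1` is available at `t`. If `J = 0`, distances are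
nonnegative. -/
theorem potential_at_t (hα : 0 < α) (hρ : IsSchedulingCost α ρ) (h : ρ θ ≤ C) :
    R.potential α ρ C t θ = C - ρ θ := by
  refine le_antisymm (R.potential_le hα (by linarith) (fun d hd => ?_) fun d hd => ?_)
    (R.le_potential_at_t hα)
  · rcases Nat.eq_zero_or_eq_succ_pred (R.J α ρ C t θ) with h0 | h1
    · have h2 := R.dist_zero_nonneg t s
      rw [h0] at hd
      rw [hd] at h2
      have := mul_nonneg hα.le (show 0 ≤ d by exact_mod_cast h2)
      linarith
    · set k := (R.J α ρ C t θ).pred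
      have hk : k < R.m := by have := R.J_le (α := α) (ρ := ρ) (C := C) (v := t) (θ := θ); omega
      have hA := (R.lt_J_iff (C := C) (θ := θ) hρ hα hk R.reaches_t).1 (by omega)
      rw [h1, R.dist_succ_s_eq hk R.reaches_t] at hd
      have hd' : R.dt k t - R.dt k s = d := by exact_mod_cast hd
      rw [Avail, dt_t, add_zero] at hA
      rw [← hd', dt_t]
      linarith
  · rw [dist_self] at hd
    have : d = 0 := by exact_mod_cast hd.symm
    simp [this]

theorem rho_le_of_flow_pos (hα : 0 < α) (hρ : IsSchedulingCost α ρ) (he : N.tgt e = t)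
    (h : 0 < R.flow α ρ C e θ) : ρ (θ + N.delay e) ≤ C := by
  have hJm : R.J α ρ C (N.src e) θ ≤ R.m := R.J_le
  rw [R.flow_eq_J_src hρ hα] at h
  obtain ⟨l, hl, hu⟩ := R.exists_uses h
  have hlm : l < R.m := by omega
  have hA := (hu.avail_iff R hlm).2 ((R.lt_J_iff hρ hα hlm (hu.reaches R hlm).1).1 hl)
  rw [Avail, he, dt_t, add_zero] at hA
  have := mul_nonneg hα.le (R.dt_s_nonneg hlm)
  linarith

/-- Complementary slackness: arcs that carry flow are tight or tolled. -/
theorem potential_src_add_le (hα : 0 < α) (hρ : IsSchedulingCost α ρ)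
    (h : 0 < R.flow α ρ C e θ) :
    R.potential α ρ C (N.src e) θ + α * N.delay e ≤
      R.potential α ρ C (N.tgt e) (θ + N.delay e) := by
  set i := R.J α ρ C (N.src e) θ with hi
  set j := R.J α ρ C (N.tgt e) (θ + N.delay e) with hj
  set x := R.potential α ρ C (N.tgt e) (θ + N.delay e) with hx
  have him : i ≤ R.m := R.J_le
  have hjm : j ≤ R.m := R.J_le
  have hfi : 0 < R.staticFlow i e := by rwa [← R.flow_eq_J_src hρ hα]
  have hfj : 0 < R.staticFlow j e := by rwa [← R.flow_eq_J_tgt hρ hα]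
  obtain ⟨hv, hw⟩ := R.reaches_of_staticFlow_pos him hfi
  have pos : ∀ n, 0 < R.staticFlow n e → ∃ k, n = k + 1 := fun n hn => by
    obtain ⟨l, hl, -⟩ := R.exists_uses hn
    exact ⟨n - 1, by omega⟩
  obtain ⟨k', hk'⟩ := pos j hfj
  have hk'm : k' < R.m := by omega
  have hgapw : α * (R.dt k' s - R.dt k' (N.tgt e)) ≤ x := by
    have := R.le_potential_s (C := C) (ρ := ρ) hα (v := N.tgt e) (θ := θ + N.delay e)
      (by rw [← hj, hk', R.dist_succ_s_eq hk'm hw])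
    linarith
  have hgapvw : N.delay e + (R.dt k' s - R.dt k' (N.src e)) ≤ R.dt k' s - R.dt k' (N.tgt e) := by
    have := R.dist_tgt_le hjm hfj s
    rw [hk', R.dist_succ_s_eq hk'm hw, R.dist_succ_s_eq hk'm hv, ← EReal.coe_add] at this
    have h' : R.dt k' (N.tgt e) - R.dt k' s ≤
      -N.delay e + (R.dt k' (N.src e) - R.dt k' s) := by exact_mod_cast this
    linarith
  -- The potential at the head bounds these quantities through its term with the distance to `s` in
  -- network `j = k' + 1`. It remains to bound each of the three terms at the tail.
  have hlow : ∀ k ≤ k', α * (N.delay e + (R.dt k s - R.dt k (N.src e))) ≤ x := fun k hk => by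
    have := R.gap_mono hk hk'm hv
    exact (mul_le_mul_of_nonneg_left (by linarith) hα.le).trans hgapw
  suffices h : R.potential α ρ C (N.src e) θ ≤ x - α * N.delay e by linarith
  refine R.potential_le hα ?_ (fun d hd => ?_) fun d hd => ?_
  · obtain ⟨l, hl, hu⟩ := R.exists_uses hfj
    have h1 := hlow l (by omega)
    have h2 := mul_nonneg hα.le (hu.gap_nonneg R (by omega))
    linarith
  · obtain ⟨k, hk⟩ := pos i hfi
    have hkm : k < R.m := by omega
    rw [← hi, hk, R.dist_succ_s_eq hkm hv] at hd
    have hd' : R.dt k (N.src e) - R.dt k s = d := by exact_mod_cast hd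
    by_cases hij : k ≤ k'
    · have := hlow k hij
      rw [← hd']
      linarith
    -- Now `j ≤ k < i`. A path `l` in this range that uses `e` would be available at both ends,
    -- contradicting `l ≥ j`. So `e` carries flow in network `k` too, and the term of the head with
    -- the distance to `t` suffices because path `k` is available at the tail.
    · have hnu : ∀ l, k ≤ l → l < i → ¬ R.Uses l e := fun l h1 h2 hu => by
        have h3 := (R.lt_J_iff hρ hα (by omega) hv).1 h2
        have h4 := (R.lt_J_iff hρ hα (by omega) hw).2 ((hu.avail_iff R (by omega)).2 h3)
        omega
      have hfk : 0 < R.staticFlow k e := by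
        rwa [R.staticFlow_eq_of_not_uses (by omega : k ≤ i) hnu]
      have h1 := R.dt_tgt_le hkm hfk
      have h2 := (R.lt_J_iff (C := C) (θ := θ) hρ hα hkm hv).1 (by omega)
      have h3 := R.dt_mono (by omega : j ≤ k) hkm hw
      have h4 := R.le_potential_t (C := C) (ρ := ρ) hα (v := N.tgt e) (θ := θ + N.delay e)
        (d := R.dt j (N.tgt e)) (R.coe_dt (by omega) hw)
      have h5 := hρ.le_add (y := θ + N.delay e + R.dt j (N.tgt e)) (z := θ + R.dt k (N.src e))
        (by linarith)
      rw [Avail] at h2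
      rw [← hd']
      linarith
  · by_cases hij : j ≤ i
    · have h1 := R.dist_tgt_le him hfi t
      rw [hd, ← EReal.coe_add] at h1
      have h2 := (R.dist_mono hij him (N.tgt e)).trans h1
      have h3 : R.dist j (N.tgt e) t ≠ ⊤ := (h2.trans_lt (EReal.coe_lt_top _)).ne
      have h4 := (EReal.coe_toReal h3 (R.dist_ne_bot _ _ _)).symm
      set d' := (R.dist j (N.tgt e) t).toReal
      rw [h4] at h2
      have h5 : d' ≤ -N.delay e + d := by exact_mod_cast h2
      have h6 := R.le_potential_t (C := C) (ρ := ρ) hα (v := N.tgt e) (θ := θ + N.delay e) h4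
      have h7 := hρ.le_add (y := θ + N.delay e + d') (z := θ + d) (by linarith)
      linarith
    -- Path `i` is not available at the tail, so the term with the distance to `t` is below `α
    -- (d_i(s,t) - d_i(v,t))`, which `hlow` bounds.
    · have him' : i < R.m := by omega
      obtain rfl : R.dt i (N.src e) = d := by rw [dt, hi, hd, EReal.toReal_coe]
      have h1 := mt (R.lt_J_iff (C := C) (θ := θ) hρ hα him' hv).2 (lt_irrefl _)
      simp only [Avail, not_le] at h1
      have h2 := hlow i (by omega)
      linarith

end SSPRun

/-! ### Lower sets of times -/

theorem exists_seq_of_isLowerSet {S : Set ℝ} (hS : IsLowerSet S) (hne : S.Nonempty) :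
    ∃ a : ℕ → ℝ, Monotone a ∧ S = ⋃ n, Iic (a n) := by
  by_cases hb : BddAbove S
  · by_cases hm : sSup S ∈ S
    · refine ⟨fun _ => sSup S, monotone_const, ?_⟩
      rw [iUnion_const]
      exact Subset.antisymm (fun x hx => le_csSup hb hx) fun x hx => hS hx hm
    · refine ⟨fun n => sSup S - 1 / ((n : ℝ) + 1), fun m n h => ?_, ?_⟩
      · have := one_div_le_one_div_of_le (show (0 : ℝ) < m + 1 by positivity)
          (show (m : ℝ) + 1 ≤ n + 1 by gcongr)
        simp only
        linarith
      · ext x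
        simp only [mem_iUnion, mem_Iic]
        constructor
        · intro hx
          have hlt : x < sSup S := lt_of_le_of_ne (le_csSup hb hx) fun h => hm (h ▸ hx)
          obtain ⟨n, hn⟩ := exists_nat_one_div_lt (sub_pos.2 hlt)
          exact ⟨n, by linarith⟩
        · rintro ⟨n, hn⟩
          have h0 : (0 : ℝ) < 1 / ((n : ℝ) + 1) := by positivity
          obtain ⟨y, hy, hxy⟩ := exists_lt_of_lt_csSup hne (show x < sSup S by linarith)
          exact hS hxy.le hy
  · refine ⟨fun n => n, fun m n h => by simpa using h, ?_⟩
    ext x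
    simp only [mem_iUnion, mem_Iic]
    refine ⟨fun _ => exists_nat_ge x, fun _ => ?_⟩
    obtain ⟨y, hy, hxy⟩ := not_bddAbove_iff.1 hb x
    exact hS hxy.le hy

theorem measurableSet_of_isLowerSet {S : Set ℝ} (hS : IsLowerSet S) : MeasurableSet S :=
  hS.ordConnected.measurableSet

/-- A nonempty lower set is an increasing union of closed half-lines, so the inequality passes to
the limit. -/
theorem setIntegral_le_of_isLowerSet {f g : ℝ → ℝ} (hf : Integrable f) (hg : Integrable g)
    (h : ∀ ξ, ∫ x in Iic ξ, f x ≤ ∫ x in Iic ξ, g x) {S : Set ℝ} (hS : IsLowerSet S) :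
    ∫ x in S, f x ≤ ∫ x in S, g x := by
  rcases S.eq_empty_or_nonempty with rfl | hne
  · simp
  obtain ⟨a, ha, rfl⟩ := exists_seq_of_isLowerSet hS hne
  have hmono : Monotone fun n => Iic (a n) := fun m n hmn => Iic_subset_Iic.2 (ha hmn)
  exact le_of_tendsto_of_tendsto'
    (tendsto_setIntegral_of_monotone (fun n => measurableSet_Iic) hmono hf.integrableOn)
    (tendsto_setIntegral_of_monotone (fun n => measurableSet_Iic) hmono hg.integrableOn)
    fun n => h (a n)

theorem setIntegral_comp_sub {f : ℝ → ℝ} {S : Set ℝ} (hS : MeasurableSet S) (τ : ℝ) :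
    ∫ x in S, f (x - τ) = ∫ x in (fun x => x + τ) ⁻¹' S, f x := by
  have hS' : MeasurableSet ((fun x => x + τ) ⁻¹' S) := (measurable_id.add_const τ) hS
  rw [← integral_indicator hS, ← integral_indicator hS',
    ← integral_sub_right_eq_self (((fun x => x + τ) ⁻¹' S).indicator f) τ]
  congr 1
  ext x
  by_cases h : x ∈ S <;> simp [h]

/-! ### Uniqueness -/

namespace SSPRun

variable {V E : Type*} {N : Network V E} {s t : V} (R : SSPRun N s t) {α : ℝ} {ρ : ℝ → ℝ} {C : ℝ}
variable [Finite V]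

open Classical in
/-- A movement of flow through the network, with waiting at the vertices, that has the same value
as the flow over time `R.flow` and never exceeds it on any arc, is equal to `R.flow`. -/
theorem flow_unique [Fintype E] (hst : s ≠ t) (hN : N.NoZeroDelayCycle) (hα : 0 < α)
    (hρ : IsSchedulingCost α ρ) {g : E → ℝ → ℝ} (hg0 : ∀ e θ, 0 ≤ g e θ)
    (hgf : ∀ e θ, g e θ ≤ R.flow α ρ C e θ) (hgi : ∀ e, Integrable (g e))
    (hcons : ∀ v, v ≠ s → ∀ ξ, (∑ e, if N.src e = v then ∫ x in Iic ξ, g e x else 0) ≤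
      ∑ e, if N.tgt e = v then ∫ x in Iic (ξ - N.delay e), g e x else 0)
    (hval : R.value α ρ C ≤ ∑ e, if N.tgt e = t then ∫ x, g e x else 0) (e : E) :
    ∀ᵐ θ, g e θ = R.flow α ρ C e θ := by
  have := Fintype.ofFinite V
  obtain ⟨K, -, hKm, -, hK⟩ := R.exists_key (α := α) (ρ := ρ) (C := C) hN hρ hα
  set f := R.flow α ρ C with hf
  have hfi : ∀ e, Integrable (f e) := R.integrable_flow hρ
  let h : E → ℝ → ℝ := fun e θ => f e θ - g e θ
  have hh0 : ∀ e θ, 0 ≤ h e θ := fun e θ => sub_nonneg.2 (hgf e θ)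
  have hhi : ∀ e, Integrable (h e) := fun e => (hfi e).sub (hgi e)
  have hf0 : ∀ e, N.tgt e = s ∨ N.src e = t → ∀ θ, h e θ = 0 := fun e he θ => by
    have h1 : f e θ = 0 := R.flow_eq_zero he
    have h2 := hg0 e θ
    have h3 := hgf e θ
    simp only [h]
    linarith
  have cut : ∀ v (S : Set ℝ), IsLowerSet S →
      (∑ e, if N.tgt e = v then ∫ x in (fun x => x + N.delay e) ⁻¹' S, h e x else 0) ≤
        ∑ e, if N.src e = v then ∫ x in S, h e x else 0 := by
    intro v S hS
    have hSm := measurableSet_of_isLowerSet hS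
    have hnn : 0 ≤ ∑ e, if N.src e = v then ∫ x in S, h e x else 0 :=
      Finset.sum_nonneg fun e _ => by
        split_ifs
        exacts [integral_nonneg (hh0 e), le_rfl]
    by_cases hvs : v = s
    · refine le_trans (le_of_eq (Finset.sum_eq_zero fun e _ => ?_)) hnn
      split_ifs with he
      · simp [hf0 e (Or.inl (he.trans hvs))]
      · rfl
    by_cases hvt : v = t
    · refine le_trans ?_ hnn
      have h1 := R.integral_flow_tgt_t hst hρ (C := C)
      calc (∑ e, if N.tgt e = v then ∫ x in (fun x => x + N.delay e) ⁻¹' S, h e x else 0)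
          ≤ ∑ e, ((if N.tgt e = t then ∫ x, f e x else 0) -
              if N.tgt e = t then ∫ x, g e x else 0) := by
            refine Finset.sum_le_sum fun e _ => ?_
            rw [hvt]
            split_ifs
            · rw [← integral_sub (hfi e) (hgi e)]
              exact setIntegral_le_integral (hhi e) (Filter.Eventually.of_forall (hh0 e))
            · simp
        _ ≤ 0 := by rw [Finset.sum_sub_distrib]; linarith
    · let F : (E → ℝ → ℝ) → ℝ → ℝ := fun q θ => ∑ e, if N.src e = v then q e θ else 0
      let G : (E → ℝ → ℝ) → ℝ → ℝ := fun q θ => ∑ e, if N.tgt e = v then q e (θ - N.delay e) else 0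
      have hFi : ∀ q : E → ℝ → ℝ, (∀ e, Integrable (q e)) → ∀ e,
          Integrable (fun θ => if N.src e = v then q e θ else 0) := fun q hq e => by
        split_ifs
        exacts [hq e, integrable_zero _ _ _]
      have hGi : ∀ q : E → ℝ → ℝ, (∀ e, Integrable (q e)) → ∀ e,
          Integrable (fun θ => if N.tgt e = v then q e (θ - N.delay e) else 0) := fun q hq e => by
        split_ifs
        exacts [(hq e).comp_sub_right _, integrable_zero _ _ _]
      have hFS : ∀ q : E → ℝ → ℝ, (∀ e, Integrable (q e)) → ∀ S : Set ℝ,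
          ∫ x in S, F q x = ∑ e, if N.src e = v then ∫ x in S, q e x else 0 := fun q hq S => by
        rw [integral_finsetSum _ fun e _ => (hFi q hq e).integrableOn]
        refine Finset.sum_congr rfl fun e _ => ?_
        split_ifs <;> simp
      have hGS : ∀ q : E → ℝ → ℝ, (∀ e, Integrable (q e)) → ∀ S : Set ℝ, MeasurableSet S →
          ∫ x in S, G q x = ∑ e, if N.tgt e = v then
            ∫ x in (fun x => x + N.delay e) ⁻¹' S, q e x else 0 := fun q hq S hS => by
        rw [integral_finsetSum _ fun e _ => (hGi q hq e).integrableOn]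
        refine Finset.sum_congr rfl fun e _ => ?_
        split_ifs
        · exact setIntegral_comp_sub hS _
        · simp
      have hpre : ∀ ξ τ : ℝ, (fun x => x + τ) ⁻¹' Iic ξ = Iic (ξ - τ) := fun ξ τ => by
        ext x; simp [le_sub_iff_add_le]
      have h1 : ∫ x in S, F g x ≤ ∫ x in S, G g x := by
        refine setIntegral_le_of_isLowerSet (integrable_finsetSum _ fun e _ => hFi g hgi e)
          (integrable_finsetSum _ fun e _ => hGi g hgi e) (fun ξ => ?_) hS
        rw [hFS g hgi, hGS g hgi _ measurableSet_Iic]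
        simpa only [hpre] using hcons v hvs ξ
      have h2 : ∀ x, F f x = G f x := fun x => by
        have := R.flow_balance (α := α) (ρ := ρ) (C := C) v x
        rw [if_neg (Ne.symm hvs), if_neg (Ne.symm hvt)] at this
        simp only [sub_self, mul_zero, Finset.sum_const_zero] at this
        exact sub_eq_zero.1 this
      have h3 : ∫ x in S, F f x = ∫ x in S, G f x := by simp only [h2]
      rw [← hFS h hhi, ← hGS h hhi S hSm]
      have h4 : ∫ x in S, F h x = (∫ x in S, F f x) - ∫ x in S, F g x := by
        rw [hFS h hhi, hFS f hfi, hFS g hgi, ← Finset.sum_sub_distrib]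
        refine Finset.sum_congr rfl fun e _ => ?_
        split_ifs
        · exact integral_sub (hfi e).integrableOn (hgi e).integrableOn
        · simp
      have h5 : ∫ x in S, G h x = (∫ x in S, G f x) - ∫ x in S, G g x := by
        rw [hGS h hhi _ hSm, hGS f hfi _ hSm, hGS g hgi _ hSm, ← Finset.sum_sub_distrib]
        refine Finset.sum_congr rfl fun e _ => ?_
        split_ifs
        · exact integral_sub (hfi e).integrableOn (hgi e).integrableOn
        · simp
      rw [h4, h5, h3]
      linarith
  let S : ℕ → V → Set ℝ := fun k v => {θ | K v θ ≤ k}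
  have hS : ∀ k v, IsLowerSet (S k v) := fun k v x y hyx hx => (hKm v hyx).trans hx
  have hSm : ∀ k v, MeasurableSet (S k v) := fun k v => measurableSet_of_isLowerSet (hS k v)
  let S' : ℕ → E → Set ℝ := fun k e => (fun x => x + N.delay e) ⁻¹' S k (N.tgt e)
  have hSm' : ∀ k e, MeasurableSet (S' k e) := fun k e => (measurable_id.add_const _) (hSm k _)
  have hpos : ∀ e θ, h e θ ≠ 0 → K (N.tgt e) (θ + N.delay e) < K (N.src e) θ := fun e θ hne => by
    refine hK e θ (lt_of_lt_of_le (lt_of_le_of_ne (hh0 e θ) hne.symm) ?_)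
    have := hg0 e θ
    simp only [h]
    linarith
  have hle : ∀ k e θ, (S k (N.src e)).indicator (h e) θ ≤ (S' k e).indicator (h e) θ := by
    intro k e θ
    by_cases hne : h e θ = 0
    · simp [indicator_apply, hne]
    · have h1 := hpos e θ hne
      have h2 : θ ∈ S k (N.src e) → θ ∈ S' k e := fun hθ => h1.le.trans hθ
      by_cases h3 : θ ∈ S k (N.src e)
      · rw [indicator_of_mem h3, indicator_of_mem (h2 h3)]
      · rw [indicator_of_notMem h3]
        exact indicator_nonneg (fun θ _ => hh0 e θ) θ
  -- The integrands are nonnegative because `K` decreases on the support of `h`, whereas the cuts at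
  -- all vertices add up to a nonpositive sum of integrals.
  have hae : ∀ k e, ∀ᵐ θ, (S' k e).indicator (h e) θ - (S k (N.src e)).indicator (h e) θ = 0 := by
    intro k e
    have hint : ∀ e, Integrable fun θ =>
        (S' k e).indicator (h e) θ - (S k (N.src e)).indicator (h e) θ := fun e =>
      ((hhi e).indicator (hSm' k e)).sub ((hhi e).indicator (hSm k _))
    have hnn : ∀ e, 0 ≤ fun θ =>
        (S' k e).indicator (h e) θ - (S k (N.src e)).indicator (h e) θ := fun e θ =>
      sub_nonneg.2 (hle k e θ)
    have hsum : ∑ e, ∫ θ, ((S' k e).indicator (h e) θ - (S k (N.src e)).indicator (h e) θ) ≤ 0 := by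
      have h1 := Finset.sum_le_sum fun v (_ : v ∈ Finset.univ) => cut v (S k v) (hS k v)
      rw [Finset.sum_comm, Finset.sum_comm (s := (Finset.univ : Finset V))] at h1
      simp only [Finset.sum_ite_eq, Finset.mem_univ, if_true] at h1
      calc _ = ∑ e, ((∫ x in S' k e, h e x) - ∫ x in S k (N.src e), h e x) := by
            refine Finset.sum_congr rfl fun e _ => ?_
            rw [integral_sub ((hhi e).indicator (hSm' k e)) ((hhi e).indicator (hSm k _)),
              integral_indicator (hSm' k e), integral_indicator (hSm k _)]
        _ ≤ 0 := by rw [Finset.sum_sub_distrib]; exact sub_nonpos.2 h1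
    have hzero := (Finset.sum_eq_zero_iff_of_nonneg fun e _ => integral_nonneg (hnn e)).1
      (le_antisymm hsum (Finset.sum_nonneg fun e _ => integral_nonneg (hnn e))) e
      (Finset.mem_univ e)
    exact (integral_eq_zero_iff_of_nonneg (hnn e) (hint e)).1 hzero
  filter_upwards [ae_all_iff.2 fun k => hae k e] with θ hθ
  by_contra hne
  have hne' : h e θ ≠ 0 := fun h0 => hne (sub_eq_zero.1 h0).symm
  have h1 := hpos e θ hne'
  -- At this level the head is in its segment, but the tail, having a larger value of `K`, is not.
  have h2 := hθ (K (N.tgt e) (θ + N.delay e))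
  rw [indicator_of_mem (show θ ∈ S' _ e from le_refl (K (N.tgt e) (θ + N.delay e))),
    indicator_of_notMem (show θ ∉ S (K (N.tgt e) (θ + N.delay e)) (N.src e) from
      fun hm => absurd h1 (not_lt.2 hm)), sub_zero] at h2
  exact hne' h2

end SSPRun

/-! ### Walks by position -/

theorem IsWalk.tgt_get {V A : Type*} {src tgt : A → V} {u v : V} {l : List A}
    (h : IsWalk src tgt u v l) (i : ℕ) (hi : i + 1 < l.length) :
    tgt l[i] = src l[i + 1] := by
  induction l generalizing u i with
  | nil => simp at hi
  | cons a l ih =>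
    cases i with
    | zero =>
      cases l with
      | nil => simp at hi
      | cons b l => exact h.2.1.symm
    | succ i => exact ih h.2 i (by simpa using hi)

theorem IsWalk.exists_last {V A : Type*} {src tgt : A → V} {u v : V} {l : List A}
    (h : IsWalk src tgt u v l) (huv : u ≠ v) : ∃ i : Fin l.length, tgt (l.get i) = v := by
  induction l generalizing u with
  | nil => exact absurd h huv
  | cons a l ih =>
    by_cases hav : tgt a = v
    · exact ⟨⟨0, by simp⟩, hav⟩
    · obtain ⟨i, hi⟩ := ih h.2 hav
      exact ⟨i.succ, hi⟩

open Classical in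
-- As `v` is not the first vertex, each arc leaving `v` is preceded by one entering `v`: position `i
-- + 1` is matched with position `i`.
theorem IsWalk.sum_src_le_sum_tgt {V A : Type*} {src tgt : A → V} {u w v : V} {l : List A}
    (h : IsWalk src tgt u w l) (hv : v ≠ u) {M M' : ℕ → ℝ} (hM' : ∀ i < l.length, 0 ≤ M' i)
    (hM : ∀ i, i + 1 < l.length → M (i + 1) ≤ M' i) :
    (∑ i : Fin l.length, if src (l.get i) = v then M i else 0) ≤
      ∑ i : Fin l.length, if tgt (l.get i) = v then M' i else 0 := by
  cases l with
  | nil => simp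
  | cons a l =>
    refine (Fin.sum_univ_succ (n := l.length) _).trans_le
      (le_trans ?_ (Fin.sum_univ_castSucc (n := l.length) _).ge)
    have h0 : ¬ src ((a :: l).get 0) = v := fun h0 => hv (h0.symm.trans h.1)
    rw [if_neg h0, zero_add]
    refine le_trans (Finset.sum_le_sum fun i _ => ?_)
      (le_add_of_nonneg_right (by split_ifs; exacts [hM' _ (by simp), le_rfl]))
    have hst : tgt ((a :: l).get i.castSucc) = src ((a :: l).get i.succ) :=
      h.tgt_get i (by simp)
    rw [hst]
    split_ifs
    · exact hM i (by simp)
    · exact le_rfl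

open Classical in
theorem sum_ite_sum_get {A : Type*} [Fintype A] (w : A → Prop) (l : List A)
    (m : Fin l.length → A → ℝ) :
    (∑ a, if w a then ∑ i : Fin l.length, (if l.get i = a then m i a else 0) else 0) =
      ∑ i : Fin l.length, if w (l.get i) then m i (l.get i) else 0 := by
  have h1 : ∀ a, (if w a then ∑ i : Fin l.length, (if l.get i = a then m i a else 0) else 0)
      = ∑ i : Fin l.length, if l.get i = a then (if w a then m i a else 0) else 0 := fun a => by
    by_cases ha : w a <;> simp [ha]
  rw [Finset.sum_congr rfl fun a _ => h1 a, Finset.sum_comm]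
  exact Finset.sum_congr rfl fun i _ => Finset.sum_ite_eq _ _ _ |>.trans (if_pos (Finset.mem_univ _))

open Classical in
theorem sum_ite_sum_sum_get {A : Type*} [Fintype A] (P : Finset (List A)) (w : A → Prop)
    (m : List A → ℕ → A → ℝ) :
    (∑ a, if w a then ∑ p ∈ P, ∑ i : Fin p.length, (if p.get i = a then m p i a else 0) else 0) =
      ∑ p ∈ P, ∑ i : Fin p.length, if w (p.get i) then m p i (p.get i) else 0 := by
  rw [← Finset.sum_congr rfl fun p _ => sum_ite_sum_get w p fun i => m p i, Finset.sum_comm]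
  refine Finset.sum_congr rfl fun a _ => ?_
  split_ifs <;> simp

/-! ### Queues -/

theorem continuous_setIntegral_Iic {g : ℝ → ℝ} (hg : Integrable g) :
    Continuous fun y => ∫ x in Iic y, g x := by
  have h : (fun y => ∫ x in Iic y, g x) = fun y => (∫ x in Iic 0, g x) + ∫ x in (0 : ℝ)..y, g x := by
    ext y
    rw [← intervalIntegral.integral_Iic_sub_Iic hg.integrableOn hg.integrableOn]
    ring
  rw [h]
  exact continuous_const.add (intervalIntegral.continuous_primitive
    (fun a b => hg.intervalIntegrable) 0)

theorem setIntegral_mono_Iic {g : ℝ → ℝ} (hg : Integrable g) (hg0 : ∀ x, 0 ≤ g x) {y z : ℝ}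
    (h : y ≤ z) : ∫ x in Iic y, g x ≤ ∫ x in Iic z, g x :=
  setIntegral_mono_set hg.integrableOn (Filter.Eventually.of_forall hg0)
    (Iic_subset_Iic.2 h).eventuallyLE

theorem setIntegral_Iic_eq_integral {g : ℝ → ℝ} {L y : ℝ} (h : ∀ x, L < x → g x = 0)
    (hy : L ≤ y) : ∫ x in Iic y, g x = ∫ x, g x :=
  setIntegral_eq_integral_of_forall_compl_eq_zero fun x hx =>
    h x (hy.trans_lt (by simpa using hx))

/-- A user who finds no queue is not delayed. -/
theorem entryTime_eq_self {U g : ℝ → ℝ} {θ : ℝ} (h : U θ ≤ ∫ x in Iic θ, g x) :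
    entryTime U g θ = θ :=
  le_antisymm (csInf_le ⟨θ, fun _ hx => hx.1⟩ ⟨le_rfl, h⟩) (le_csInf ⟨θ, le_rfl, h⟩ fun _ hx => hx.1)

namespace TolledNetwork

variable {V A : Type*} [Finite A] {T : TolledNetwork V A} {s t : V} {Q : ℝ}
  {h : List A → ℝ → ℝ} {U g : A → ℝ → ℝ}

theorem mem_routes {p : List A} : p ∈ T.routes s t ↔ IsPath T.src T.tgt s t p := by
  simp [routes]

namespace IsLoading

theorem queue_mono (hL : T.IsLoading s t Q h U g) (a : A) : Monotone (U a) := fun ξ ξ' hξ => by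
  rw [hL.queue_inflow, hL.queue_inflow]
  refine Finset.sum_le_sum fun p hp => Finset.sum_le_sum fun i _ => ?_
  split_ifs
  · exact setIntegral_mono_set (hL.departure_integrable p hp).integrableOn
      (Filter.Eventually.of_forall (hL.departure_nonneg p hp))
      (LE.le.eventuallyLE fun θ hθ => le_trans hθ hξ)
  · exact le_rfl

/-- Guarantees that the infimum in `entryTime` is not taken over the empty set, where it would be
the default value `0`. -/
theorem exists_served (hL : T.IsLoading s t Q h U g) (a : A) (θ : ℝ) :
    {ξ | θ ≤ ξ ∧ U a θ ≤ ∫ x in Iic ξ, g a x}.Nonempty := by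
  obtain ⟨K, hK⟩ := hL.entry_compact
  refine ⟨max θ K, le_max_left _ _, ?_⟩
  rw [setIntegral_Iic_eq_integral (fun x hx => hK a x (hx.trans_le (le_abs_self x)))
    (le_max_right θ K)]
  exact hL.served a θ

theorem le_entryTime (hL : T.IsLoading s t Q h U g) (a : A) (θ : ℝ) :
    θ ≤ entryTime (U a) (g a) θ := le_csInf (hL.exists_served a θ) fun _ hx => hx.1

/-- The infimum is attained, since cumulative flow is continuous and the set is closed. -/
theorem le_cumulative_entryTime (hL : T.IsLoading s t Q h U g) (a : A) (θ : ℝ) :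
    U a θ ≤ ∫ x in Iic (entryTime (U a) (g a) θ), g a x := by
  have hc : IsClosed {ξ | θ ≤ ξ ∧ U a θ ≤ ∫ x in Iic ξ, g a x} :=
    (isClosed_le continuous_const continuous_id).inter
      (isClosed_le continuous_const (continuous_setIntegral_Iic (hL.entry_integrable a)))
  exact (hc.csInf_mem (hL.exists_served a θ) ⟨θ, fun _ hx => hx.1⟩).2

theorem entryTime_mono (hL : T.IsLoading s t Q h U g) (a : A) :
    Monotone (entryTime (U a) (g a)) := fun _ _ hθ =>
  csInf_le_csInf ⟨_, fun _ hx => hx.1⟩ (hL.exists_served a _) fun _ hx =>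
    ⟨hθ.trans hx.1, (hL.queue_mono a hθ).trans hx.2⟩

theorem reach_mono (hL : T.IsLoading s t Q h U g) (p : List A) : Monotone (T.reach U g p) := by
  induction p with
  | nil => exact monotone_id
  | cons a p ih => exact fun _ _ hθ => ih (by simpa using hL.entryTime_mono a hθ)

theorem le_reach (hL : T.IsLoading s t Q h U g) (hd : ∀ a, 0 ≤ T.delay a) (p : List A) (θ : ℝ) :
    θ ≤ T.reach U g p θ := by
  induction p generalizing θ with
  | nil => exact le_rfl
  | cons a p ih =>
    refine le_trans ?_ (ih _)
    linarith [hL.le_entryTime a θ, hd a]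

theorem reach_append (p q : List A) (θ : ℝ) :
    T.reach U g (p ++ q) θ = T.reach U g q (T.reach U g p θ) := by
  induction p generalizing θ with
  | nil => rfl
  | cons a p ih => exact ih _

theorem reach_take_succ (p : List A) (i : ℕ) (hi : i < p.length) (θ : ℝ) :
    T.reach U g (p.take (i + 1)) θ =
      entryTime (U p[i]) (g p[i]) (T.reach U g (p.take i) θ) + T.delay p[i] := by
  rw [List.take_succ_eq_append_getElem hi, reach_append]
  rfl

open Classical in
/-- The amount of flow that joins the queue of `a` at times in a lower set. -/
theorem sum_setIntegral_le (hL : T.IsLoading s t Q h U g) (a : A) {Z : Set ℝ} (hZ : IsLowerSet Z)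
    {y : ℝ} (hy : 0 ≤ y) (hU : ∀ ζ ∈ Z, U a ζ ≤ y) :
    ∑ p ∈ T.routes s t, ∑ i : Fin p.length,
      (if p.get i = a then ∫ θ in {θ | T.reach U g (p.take i) θ ∈ Z}, h p θ else 0) ≤ y := by
  rcases Z.eq_empty_or_nonempty with rfl | hne
  · simpa using hy
  obtain ⟨b, hb, hZb⟩ := exists_seq_of_isLowerSet hZ hne
  have hlim : Filter.Tendsto (fun n => ∑ p ∈ T.routes s t, ∑ i : Fin p.length,
      (if p.get i = a then ∫ θ in {θ | T.reach U g (p.take i) θ ≤ b n}, h p θ else 0)) Filter.atTop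
      (nhds (∑ p ∈ T.routes s t, ∑ i : Fin p.length,
        (if p.get i = a then ∫ θ in {θ | T.reach U g (p.take i) θ ∈ Z}, h p θ else 0))) := by
    refine tendsto_finsetSum _ fun p hp => tendsto_finsetSum _ fun i _ => ?_
    split_ifs
    · have hset : {θ | T.reach U g (p.take i) θ ∈ Z}
          = ⋃ n, {θ | T.reach U g (p.take i) θ ≤ b n} := by
        ext θ; rw [hZb]; simp
      rw [hset]
      refine tendsto_setIntegral_of_monotone (fun n => measurableSet_of_isLowerSet ?_) ?_
        (hL.departure_integrable p hp).integrableOn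
      · exact fun x z hzx hx => (hL.reach_mono _ hzx).trans hx
      · exact fun m n hmn θ hθ => le_trans hθ (hb hmn)
    · exact tendsto_const_nhds
  refine le_of_tendsto' hlim fun n => ?_
  rw [← hL.queue_inflow]
  exact hU _ (by rw [hZb]; exact mem_iUnion.2 ⟨n, mem_Iic.2 le_rfl⟩)

open Classical in
/-- Flow cannot leave a vertex before it arrives there. -/
theorem outflow_le_inflow [Fintype A] (hL : T.IsLoading s t Q h U g) {v : V} (hv : v ≠ s)
    (ξ : ℝ) : (∑ a, if T.src a = v then ∫ x in Iic ξ, g a x else 0) ≤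
      ∑ a, if T.tgt a = v then ∫ x in Iic (ξ - T.delay a), g a x else 0 := by
  -- Joining times of users who are covered by the flow that has entered `a` early enough to reach
  -- its head by time `ξ`. A user at the next vertex by time `ξ` joined the queue of the preceding
  -- arc at such a time.
  let Z : A → Set ℝ := fun a => {ζ | U a ζ ≤ ∫ x in Iic (ξ - T.delay a), g a x}
  have hin : ∀ a, ∑ p ∈ T.routes s t, ∑ i : Fin p.length,
      (if p.get i = a then ∫ θ in {θ | T.reach U g (p.take i) θ ∈ Z a}, h p θ else 0) ≤
        ∫ x in Iic (ξ - T.delay a), g a x := fun a =>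
    hL.sum_setIntegral_le a (fun x z hzx hx => (hL.queue_mono a hzx).trans hx)
      (integral_nonneg fun x => hL.entry_nonneg a x) fun ζ hζ => hζ
  calc (∑ a, if T.src a = v then ∫ x in Iic ξ, g a x else 0)
      ≤ ∑ a, if T.src a = v then ∑ p ∈ T.routes s t, ∑ i : Fin p.length,
          (if p.get i = a then ∫ θ in {θ | T.reach U g (p.take i) θ ≤ ξ}, h p θ else 0) else 0 := by
        refine Finset.sum_le_sum fun a _ => ?_
        split_ifs
        · rw [← hL.queue_inflow]; exact hL.queue_nonneg a ξ
        · exact le_rfl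
    _ = ∑ p ∈ T.routes s t, ∑ i : Fin p.length, if T.src (p.get i) = v then
          ∫ θ in {θ | T.reach U g (p.take i) θ ≤ ξ}, h p θ else 0 :=
        sum_ite_sum_sum_get (T.routes s t) (fun a => T.src a = v)
          fun p i _ => ∫ θ in {θ | T.reach U g (p.take i) θ ≤ ξ}, h p θ
    _ ≤ ∑ p ∈ T.routes s t, ∑ i : Fin p.length, if T.tgt (p.get i) = v then
          ∫ θ in {θ | T.reach U g (p.take i) θ ∈ Z (p.get i)}, h p θ else 0 := by
        refine Finset.sum_le_sum fun p hp => ?_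
        have hw := (mem_routes.1 hp).1
        have hM := hw.sum_src_le_sum_tgt hv
          (M := fun i => ∫ θ in {θ | T.reach U g (p.take i) θ ≤ ξ}, h p θ)
          (M' := fun i => if hi : i < p.length then
            ∫ θ in {θ | T.reach U g (p.take i) θ ∈ Z p[i]}, h p θ else 0)
          (fun i hi => by
            rw [dif_pos hi]; exact integral_nonneg (hL.departure_nonneg p hp)) fun i hi => by
            rw [dif_pos (by omega)]
            refine setIntegral_mono_set (hL.departure_integrable p hp).integrableOn
              (Filter.Eventually.of_forall (hL.departure_nonneg p hp))
              (LE.le.eventuallyLE fun θ hθ => ?_)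
            have hθ' : T.reach U g (p.take (i + 1)) θ ≤ ξ := hθ
            rw [reach_take_succ p i (by omega), ← le_sub_iff_add_le] at hθ'
            exact (hL.le_cumulative_entryTime _ _).trans
              (setIntegral_mono_Iic (hL.entry_integrable _) (hL.entry_nonneg _) hθ')
        refine hM.trans_eq (Finset.sum_congr rfl fun i _ => ?_)
        rw [dif_pos i.2]
        rfl
    _ = ∑ a, if T.tgt a = v then ∑ p ∈ T.routes s t, ∑ i : Fin p.length,
          (if p.get i = a then ∫ θ in {θ | T.reach U g (p.take i) θ ∈ Z a}, h p θ else 0)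
            else 0 :=
        (sum_ite_sum_sum_get (T.routes s t) (fun a => T.tgt a = v)
          fun p i a => ∫ θ in {θ | T.reach U g (p.take i) θ ∈ Z a}, h p θ).symm
    _ ≤ _ := by
        refine Finset.sum_le_sum fun a _ => ?_
        split_ifs
        exacts [hin a, le_rfl]

open Classical in
/-- All users arrive at `t`. -/
theorem value_le [Fintype A] (hL : T.IsLoading s t Q h U g) (hst : s ≠ t) :
    Q ≤ ∑ a, if T.tgt a = t then ∫ x, g a x else 0 := by
  have hin : ∀ a, ∑ p ∈ T.routes s t, ∑ i : Fin p.length,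
      (if p.get i = a then ∫ θ, h p θ else 0) ≤ ∫ x, g a x := fun a => by
    have := hL.sum_setIntegral_le a (Z := univ) isLowerSet_univ
      (integral_nonneg fun x => hL.entry_nonneg a x) fun ζ _ => hL.served a ζ
    simpa using this
  rw [← hL.value]
  calc ∑ p ∈ T.routes s t, ∫ θ, h p θ
      ≤ ∑ p ∈ T.routes s t, ∑ a, if T.tgt a = t then ∑ i : Fin p.length,
          (if p.get i = a then ∫ θ, h p θ else 0) else 0 := by
        refine Finset.sum_le_sum fun p hp => ?_
        have hnn : 0 ≤ ∫ θ, h p θ := integral_nonneg (hL.departure_nonneg p hp)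
        obtain ⟨i, hi⟩ := (mem_routes.1 hp).1.exists_last hst
        have h0 : ∀ a, 0 ≤ ∑ i : Fin p.length, (if p.get i = a then ∫ θ, h p θ else 0) := fun a =>
          Finset.sum_nonneg fun i _ => by split_ifs; exacts [hnn, le_rfl]
        refine le_trans ?_ (Finset.single_le_sum (fun a _ => ?_) (Finset.mem_univ (p.get i)))
        · rw [if_pos hi]
          refine le_trans ?_ (Finset.single_le_sum (fun j _ => ?_) (Finset.mem_univ i))
          · simp
          · split_ifs; exacts [hnn, le_rfl]
        · split_ifs; exacts [h0 a, le_rfl]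
    _ = ∑ a, if T.tgt a = t then ∑ p ∈ T.routes s t, ∑ i : Fin p.length,
          (if p.get i = a then ∫ θ, h p θ else 0) else 0 := by
        rw [Finset.sum_comm]
        refine Finset.sum_congr rfl fun a _ => ?_
        split_ifs <;> simp
    _ ≤ _ := by
        refine Finset.sum_le_sum fun a _ => ?_
        split_ifs
        exacts [hin a, le_rfl]

end IsLoading

end TolledNetwork

/-! ### Decomposition of a flow over time into path flows -/

open Classical in
/-- The lists of length at most `n`. -/
def listsUpTo (A : Type*) [Fintype A] : ℕ → Finset (List A)
  | 0 => {[]}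
  | n + 1 => insert [] ((Finset.univ ×ˢ listsUpTo A n).image fun x => x.1 :: x.2)

theorem sum_listsUpTo_succ {A : Type*} [Fintype A] (n : ℕ) (φ : List A → ℝ) :
    ∑ l ∈ listsUpTo A (n + 1), φ l = φ [] + ∑ a, ∑ l ∈ listsUpTo A n, φ (a :: l) := by
  classical
  rw [listsUpTo, Finset.sum_insert (by simp), Finset.sum_image (by
    rintro ⟨a, l⟩ - ⟨b, l'⟩ - h
    simpa using h), Finset.sum_product]

theorem mem_listsUpTo {A : Type*} [Fintype A] {n : ℕ} {l : List A} (h : l.length ≤ n) :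
    l ∈ listsUpTo A n := by
  induction n generalizing l with
  | zero => simp [listsUpTo, List.length_eq_zero_iff.1 (Nat.le_zero.1 h)]
  | succ n ih =>
    cases l with
    | nil => simp [listsUpTo]
    | cons a l => simp [listsUpTo, ih (Nat.le_of_succ_le_succ h)]

namespace TolledNetwork

variable {V A : Type*} (T : TolledNetwork V A)

/-- A user who departs at time `θ`, follows the arcs of the list and never waits, travels together
with the flow `f`. -/
def Carried (f : A → ℝ → ℝ) : List A → ℝ → Prop
  | [], _ => True
  | a :: l, θ => 0 < f a θ ∧ Carried f l (θ + T.delay a)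

/-- The total flow that leaves the vertex `v`. -/
def outRate [Fintype A] (f : A → ℝ → ℝ) (v : V) (θ : ℝ) : ℝ :=
  open Classical in ∑ a, if T.src a = v then f a θ else 0

/-- The probability that a particle follows the arcs of the list, if it chooses arcs with
probabilities proportional to the flow. -/
def weight [Fintype A] (f : A → ℝ → ℝ) : List A → ℝ → ℝ
  | [], _ => 1
  | a :: l, θ => f a θ / T.outRate f (T.src a) θ * weight f l (θ + T.delay a)

open Classical in
/-- The sum of the values of `φ` at the times at which the arc `b` is entered. -/
def visits (b : A) (φ : ℝ → ℝ) : List A → ℝ → ℝ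
  | [], _ => 0
  | a :: l, θ => (if a = b then φ θ else 0) + visits b φ l (θ + T.delay a)

open Classical in
/-- The probability of reaching `t` with at most `n` arcs. -/
def arrival [Fintype A] (f : A → ℝ → ℝ) (t : V) (n : ℕ) (v : V) (θ : ℝ) : ℝ :=
  ∑ l ∈ listsUpTo A n, if IsWalk T.src T.tgt v t l then T.weight f l θ else 0

open Classical in
/-- The expectation of `visits b φ` over the lists of at most `n` arcs that lead to `t`. -/
def expVisits [Fintype A] (f : A → ℝ → ℝ) (t : V) (b : A) (φ : ℝ → ℝ) (n : ℕ) (v : V) (θ : ℝ) :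
    ℝ :=
  ∑ l ∈ listsUpTo A n,
    if IsWalk T.src T.tgt v t l then T.weight f l θ * T.visits b φ l θ else 0

variable {T} [Fintype A] {f : A → ℝ → ℝ} {s t v w : V} {θ : ℝ}

open Classical in
theorem arrival_succ (n : ℕ) : T.arrival f t (n + 1) v θ = (if v = t then 1 else 0) +
    ∑ a, if T.src a = v then
      f a θ / T.outRate f v θ * T.arrival f t n (T.tgt a) (θ + T.delay a) else 0 := by
  rw [arrival, sum_listsUpTo_succ]
  congr 1
  refine Finset.sum_congr rfl fun a _ => ?_
  by_cases ha : T.src a = v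
  · simp only [IsWalk, ha, true_and, if_true, arrival, Finset.mul_sum, weight]
    exact Finset.sum_congr rfl fun l _ => by split_ifs <;> simp
  · simp [IsWalk, ha]

open Classical in
theorem expVisits_succ (b : A) (φ : ℝ → ℝ) (n : ℕ) :
    T.expVisits f t b φ (n + 1) v θ = ∑ a, if T.src a = v then
      f a θ / T.outRate f v θ * ((if a = b then φ θ else 0) *
        T.arrival f t n (T.tgt a) (θ + T.delay a) +
        T.expVisits f t b φ n (T.tgt a) (θ + T.delay a)) else 0 := by
  rw [expVisits, sum_listsUpTo_succ]
  have h0 : (if IsWalk T.src T.tgt v t [] then T.weight f [] θ * T.visits b φ [] θ else 0) = 0 := by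
    simp [visits]
  rw [h0, zero_add]
  refine Finset.sum_congr rfl fun a _ => ?_
  by_cases ha : T.src a = v
  · simp only [IsWalk, ha, true_and, if_true, arrival, expVisits, Finset.mul_sum, weight, visits,
      ← Finset.sum_add_distrib]
    refine Finset.sum_congr rfl fun l _ => ?_
    split_ifs <;> ring
  · simp [IsWalk, ha]

theorem visits_eq_sum (b : A) (φ : ℝ → ℝ) (l : List A) (θ : ℝ) : T.visits b φ l θ =
    open Classical in ∑ i : Fin l.length,
      if l.get i = b then φ (θ + ((l.take i).map T.delay).sum) else 0 := by
  induction l generalizing θ with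
  | nil => simp [visits]
  | cons a l ih =>
    rw [visits, ih]
    refine Eq.trans ?_ (Fin.sum_univ_succ (n := l.length) _).symm
    congr 1
    · simp
      rfl
    · refine Finset.sum_congr rfl fun i _ => ?_
      simp [add_assoc]

/-- Flows over time without waiting, together with a counter that shows that particles cannot
return to a vertex. -/
structure IsFlow (T : TolledNetwork V A) (s t : V) (f : A → ℝ → ℝ) (K : V → ℝ → ℕ) (B : ℕ) :
    Prop where
  delay_nonneg : ∀ a, 0 ≤ T.delay a
  nonneg : ∀ a θ, 0 ≤ f a θ
  measurable : ∀ a, Measurable (f a)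
  integrable : ∀ a, Integrable (f a)
  eq_zero : ∀ a, T.tgt a = s ∨ T.src a = t → ∀ θ, f a θ = 0
  balance : ∀ v, v ≠ s → v ≠ t → ∀ θ, T.outRate f v θ =
    open Classical in ∑ a, if T.tgt a = v then f a (θ - T.delay a) else 0
  key_mono : ∀ v, Monotone (K v)
  key_le : ∀ v θ, K v θ ≤ B
  key_lt : ∀ a θ, 0 < f a θ → K (T.tgt a) (θ + T.delay a) < K (T.src a) θ

namespace IsFlow

variable {K : V → ℝ → ℕ} {B : ℕ}

theorem outRate_nonneg (hF : T.IsFlow s t f K B) (v : V) (θ : ℝ) : 0 ≤ T.outRate f v θ :=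
  Finset.sum_nonneg fun a _ => by split_ifs; exacts [hF.nonneg a θ, le_rfl]

theorem le_outRate (hF : T.IsFlow s t f K B) (a : A) (θ : ℝ) :
    f a θ ≤ T.outRate f (T.src a) θ := by
  classical
  refine le_trans ?_ (Finset.single_le_sum (fun b _ => ?_) (Finset.mem_univ a))
  · simp
  · split_ifs; exacts [hF.nonneg b θ, le_rfl]

/-- By flow conservation a particle that travels with the flow never gets to a vertex other than `t`
without outflow, so `weight` never divides by zero along its way. -/
theorem tgt_cases (hF : T.IsFlow s t f K B) {a : A} (h : 0 < f a θ) :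
    T.tgt a = t ∨ 0 < T.outRate f (T.tgt a) (θ + T.delay a) := by
  classical
  by_cases ht : T.tgt a = t
  · exact Or.inl ht
  have hs : T.tgt a ≠ s := fun hs => h.ne' (hF.eq_zero a (Or.inl hs) θ)
  right
  rw [hF.balance _ hs ht]
  refine lt_of_lt_of_le ?_ (Finset.single_le_sum (fun b _ => ?_) (Finset.mem_univ a))
  · simpa using h
  · split_ifs; exacts [hF.nonneg b _, le_rfl]

theorem outRate_t (hF : T.IsFlow s t f K B) (θ : ℝ) : T.outRate f t θ = 0 :=
  Finset.sum_eq_zero fun a _ => by split_ifs with h; exacts [hF.eq_zero a (Or.inr h) θ, rfl]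

theorem arrival_t (hF : T.IsFlow s t f K B) (n : ℕ) (θ : ℝ) : T.arrival f t n t θ = 1 := by
  cases n with
  | zero => simp [arrival, listsUpTo, IsWalk, weight]
  | succ n => simp [arrival_succ, hF.outRate_t]

/-- `K` drops with every arc, so a particle with key below `n` has arrived within `n` arcs; the
probabilities at each vertex with outflow add up to one. -/
theorem arrival_eq_one (hF : T.IsFlow s t f K B) (n : ℕ) (v : V) (θ : ℝ) (hn : K v θ < n)
    (hv : v = t ∨ 0 < T.outRate f v θ) : T.arrival f t n v θ = 1 := by
  classical
  induction n generalizing v θ with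
  | zero => omega
  | succ n ih =>
    by_cases hvt : v = t
    · rw [hvt, hF.arrival_t]
    have hpos := hv.resolve_left hvt
    rw [arrival_succ, if_neg hvt, zero_add]
    have h1 : ∀ a, (if T.src a = v then
        f a θ / T.outRate f v θ * T.arrival f t n (T.tgt a) (θ + T.delay a) else 0)
        = (if T.src a = v then f a θ else 0) / T.outRate f v θ := fun a => by
      split_ifs with ha
      · rcases (hF.nonneg a θ).eq_or_lt with h0 | h0
        · simp [← h0]
        · have := hF.key_lt a θ h0
          rw [ha] at this
          rw [ih _ _ (by omega) (hF.tgt_cases h0), mul_one]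
      · simp
    rw [Finset.sum_congr rfl fun a _ => h1 a, ← Finset.sum_div]
    exact div_self hpos.ne'

theorem expVisits_stable (hF : T.IsFlow s t f K B) (b : A) (φ : ℝ → ℝ) (n : ℕ) (v : V) (θ : ℝ)
    (hn : K v θ < n) : T.expVisits f t b φ (n + 1) v θ = T.expVisits f t b φ n v θ := by
  classical
  induction n generalizing v θ with
  | zero => omega
  | succ n ih =>
    rw [expVisits_succ, expVisits_succ]
    refine Finset.sum_congr rfl fun a _ => ?_
    split_ifs with ha hb
    all_goals try rfl
    all_goals
      rcases (hF.nonneg a θ).eq_or_lt with h0 | h0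
      · simp [← h0]
      · have h1 := hF.key_lt a θ h0
        rw [ha] at h1
        have hS : ∀ m, n ≤ m → 0 < n → T.arrival f t m (T.tgt a) (θ + T.delay a) = 1 :=
          fun m hm _ => hF.arrival_eq_one m _ _ (by omega) (hF.tgt_cases h0)
        rw [ih _ _ (by omega), hS _ (Nat.le_succ n) (by omega), hS n le_rfl (by omega)]

theorem weight_mem (hF : T.IsFlow s t f K B) (l : List A) (θ : ℝ) :
    0 ≤ T.weight f l θ ∧ T.weight f l θ ≤ 1 := by
  induction l generalizing θ with
  | nil => simp [weight]
  | cons a l ih =>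
    have h0 : 0 ≤ f a θ / T.outRate f (T.src a) θ :=
      div_nonneg (hF.nonneg a θ) (hF.outRate_nonneg _ θ)
    have h1 : f a θ / T.outRate f (T.src a) θ ≤ 1 :=
      div_le_one_of_le₀ (hF.le_outRate a θ) (hF.outRate_nonneg _ θ)
    exact ⟨mul_nonneg h0 (ih _).1, mul_le_one₀ h1 (ih _).1 (ih _).2⟩

theorem measurable_outRate (hF : T.IsFlow s t f K B) (v : V) : Measurable (T.outRate f v) :=
  Finset.measurable_sum _ fun a _ => by
    split_ifs
    exacts [hF.measurable a, measurable_const]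

theorem integrable_outRate (hF : T.IsFlow s t f K B) (v : V) : Integrable (T.outRate f v) :=
  integrable_finsetSum _ fun a _ => by
    split_ifs
    exacts [hF.integrable a, integrable_zero _ _ _]

theorem measurable_weight (hF : T.IsFlow s t f K B) (l : List A) : Measurable (T.weight f l) := by
  induction l with
  | nil => exact measurable_const
  | cons a l ih =>
    exact ((hF.measurable a).div (hF.measurable_outRate _)).mul
      (ih.comp (measurable_id.add_const _))

theorem carried_of_weight_ne (hF : T.IsFlow s t f K B) {l : List A} {θ : ℝ}
    (h : T.weight f l θ ≠ 0) : T.Carried f l θ := by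
  induction l generalizing θ with
  | nil => trivial
  | cons a l ih =>
    obtain ⟨h1, h2⟩ := mul_ne_zero_iff.1 h
    exact ⟨lt_of_le_of_ne (hF.nonneg a θ) fun h0 => h1 (by simp [← h0]), ih h2⟩

theorem key_add_length_le (hF : T.IsFlow s t f K B) {l : List A} {v w : V} {θ : ℝ}
    (hl : IsWalk T.src T.tgt v w l) (h : T.Carried f l θ) :
    K w (θ + (l.map T.delay).sum) + l.length ≤ K v θ := by
  induction l generalizing v θ with
  | nil =>
    obtain rfl : v = w := hl
    simp
  | cons a l ih =>
    have h1 := ih hl.2 h.2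
    have h2 := hF.key_lt a θ h.1
    rw [hl.1] at h2
    simp only [List.map_cons, List.sum_cons, List.length_cons, ← add_assoc]
    omega

theorem carried_append {l₁ l₂ : List A} {θ : ℝ} (h : T.Carried f (l₁ ++ l₂) θ) :
    T.Carried f l₁ θ := by
  induction l₁ generalizing θ with
  | nil => trivial
  | cons a l ih => exact ⟨h.1, ih h.2⟩

/-- On returning to a vertex, time has not decreased, so neither has `K`; but `K` has strictly
decreased along the arcs in between. -/
theorem isPath_of_carried (hF : T.IsFlow s t f K B) {l : List A} {v w : V} {θ : ℝ}
    (hl : IsWalk T.src T.tgt v w l) (h : T.Carried f l θ) : IsPath T.src T.tgt v w l := by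
  refine ⟨hl, ?_⟩
  induction l generalizing v θ with
  | nil => simp
  | cons a l ih =>
    refine List.nodup_cons.2 ⟨fun hmem => ?_, ih hl.2 h.2⟩
    rw [List.map_cons] at hmem
    obtain ⟨l₁, l₂, rfl, h₁, -⟩ := hl.2.exists_split hmem
    have h1 := hF.key_add_length_le (l := a :: l₁) (v := v) (w := v) ⟨hl.1, h₁⟩
      (carried_append (l₂ := l₂) h)
    have h2 : K v θ ≤ K v (θ + ((a :: l₁).map T.delay).sum) :=
      hF.key_mono v (le_add_of_nonneg_right (List.sum_nonneg fun y hy => by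
        obtain ⟨b, -, rfl⟩ := List.mem_map.1 hy
        exact hF.delay_nonneg b))
    simp only [List.length_cons] at h1
    omega

open Classical in
/-- Sums over lists of bounded length, weighted by the flow, are sums over routes. -/
theorem sum_listsUpTo_eq (hF : T.IsFlow s t f K B) (m : List A → ℝ) (θ : ℝ) :
    T.outRate f s θ * (∑ l ∈ listsUpTo A (B + 1),
      if IsWalk T.src T.tgt s t l then T.weight f l θ * m l else 0) =
    ∑ p ∈ T.routes s t, T.outRate f s θ * T.weight f p θ * m p := by
  rw [Finset.mul_sum]
  have h1 : ∀ l, T.weight f l θ ≠ 0 → IsWalk T.src T.tgt s t l →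
      l ∈ T.routes s t ∧ l ∈ listsUpTo A (B + 1) := fun l hw hl => by
    have hc := hF.carried_of_weight_ne hw
    have := hF.key_add_length_le hl hc
    have := hF.key_le s θ
    exact ⟨mem_routes.2 (hF.isPath_of_carried hl hc), mem_listsUpTo (by omega)⟩
  trans ∑ p ∈ T.routes s t ∩ listsUpTo A (B + 1), T.outRate f s θ * T.weight f p θ * m p
  · symm
    refine Finset.sum_subset_zero_on_sdiff Finset.inter_subset_right (fun l hl => ?_)
      fun l hl => ?_
    · obtain ⟨h2, h3⟩ := Finset.mem_sdiff.1 hl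
      split_ifs with hw
      · by_cases h0 : T.weight f l θ = 0
        · simp [h0]
        · exact absurd (Finset.mem_inter.2 (h1 l h0 hw)) h3
      · simp
    · rw [if_pos (mem_routes.1 (Finset.mem_inter.1 hl).1).1, mul_assoc]
  · refine Finset.sum_subset Finset.inter_subset_left fun l hl hl' => ?_
    by_cases h0 : T.weight f l θ = 0
    · simp [h0]
    · exact absurd (Finset.mem_inter.2 (h1 l h0 (mem_routes.1 hl).1)) hl'

end IsFlow

end TolledNetwork

/-! ### The random walk of a particle reproduces the flow -/

namespace TolledNetwork

namespace IsFlow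

variable {V A : Type*} {T : TolledNetwork V A} [Fintype A] {f : A → ℝ → ℝ} {s t : V}
  {K : V → ℝ → ℕ} {B : ℕ}

theorem expVisits_t (hF : T.IsFlow s t f K B) (b : A) (φ : ℝ → ℝ) (n : ℕ) (θ : ℝ) :
    T.expVisits f t b φ (n + 1) t θ = 0 := by
  rw [expVisits_succ]
  exact Finset.sum_eq_zero fun a _ => by simp [hF.outRate_t]

open Classical in
-- The bound `B + 1` on the number of arcs exceeds every key, so the recursion becomes a fixed-point
-- equation, and the probabilities of arrival in it are one.
theorem outRate_mul_expVisits (hF : T.IsFlow s t f K B) (b : A) (φ : ℝ → ℝ) (v : V) (θ : ℝ) :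
    T.outRate f v θ * T.expVisits f t b φ (B + 1) v θ =
      ∑ a, if T.src a = v then f a θ * ((if a = b then φ θ else 0) +
        T.expVisits f t b φ (B + 1) (T.tgt a) (θ + T.delay a)) else 0 := by
  rw [← hF.expVisits_stable b φ (B + 1) v θ (Nat.lt_succ_of_le (hF.key_le v θ)), expVisits_succ,
    Finset.mul_sum]
  refine Finset.sum_congr rfl fun a _ => ?_
  by_cases ha : T.src a = v
  · rw [if_pos ha, if_pos ha]
    rcases (hF.nonneg a θ).eq_or_lt with h0 | h0
    · simp [← h0]
    · have h1 := h0.trans_le (hF.le_outRate a θ)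
      rw [ha] at h1
      rw [hF.arrival_eq_one (B + 1) _ _ (Nat.lt_succ_of_le (hF.key_le _ _)) (hF.tgt_cases h0),
        mul_one, ← mul_assoc, mul_div_cancel₀ _ h1.ne']
  · simp [ha]

variable {b : A} {φ : ℝ → ℝ}

theorem measurable_visits (hφ : Measurable φ) (l : List A) : Measurable (T.visits b φ l) := by
  induction l with
  | nil => exact measurable_const
  | cons a l ih =>
    refine Measurable.add ?_ (ih.comp (measurable_id.add_const _))
    split_ifs
    exacts [hφ, measurable_const]

theorem visits_mem (hφ0 : ∀ x, 0 ≤ φ x ∧ φ x ≤ 1) (l : List A) (θ : ℝ) :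
    0 ≤ T.visits b φ l θ ∧ T.visits b φ l θ ≤ l.length := by
  induction l generalizing θ with
  | nil => simp [visits]
  | cons a l ih =>
    have h1 := ih (θ + T.delay a)
    have h2 := hφ0 θ
    rw [visits, List.length_cons, Nat.cast_succ]
    split_ifs <;> constructor <;> linarith

theorem measurable_expVisits (hF : T.IsFlow s t f K B) (hφ : Measurable φ) (n : ℕ) (v : V) :
    Measurable (T.expVisits f t b φ n v) :=
  Finset.measurable_sum _ fun l _ => by
    split_ifs
    exacts [(hF.measurable_weight l).mul (measurable_visits hφ l), measurable_const]

theorem abs_expVisits_le (hF : T.IsFlow s t f K B) (hφ0 : ∀ x, 0 ≤ φ x ∧ φ x ≤ 1) (n : ℕ) (v : V)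
    (θ : ℝ) : |T.expVisits f t b φ n v θ| ≤ ∑ l ∈ listsUpTo A n, (l.length : ℝ) := by
  refine (Finset.abs_sum_le_sum_abs _ _).trans (Finset.sum_le_sum fun l _ => ?_)
  split_ifs
  · obtain ⟨h1, h2⟩ := hF.weight_mem l θ
    obtain ⟨h3, h4⟩ := visits_mem (T := T) (b := b) hφ0 l θ
    rw [abs_of_nonneg (mul_nonneg h1 h3)]
    calc T.weight f l θ * T.visits b φ l θ ≤ 1 * T.visits b φ l θ :=
          mul_le_mul_of_nonneg_right h2 h3
      _ ≤ l.length := by rw [one_mul]; exact h4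
  · simp

open Classical in
-- Integrate the fixed-point equation and add over all vertices: weighted outflows equal `∫ f b · φ`
-- plus weighted inflows. Conservation cancels everything at inner vertices, nothing enters `s`, and
-- at `t` no further visits are expected.
theorem integral_outRate_mul_expVisits [Finite V] (hF : T.IsFlow s t f K B) (hφ : Measurable φ)
    (hφ0 : ∀ x, 0 ≤ φ x ∧ φ x ≤ 1) :
    ∫ θ, T.outRate f s θ * T.expVisits f t b φ (B + 1) s θ = ∫ θ, f b θ * φ θ := by
  have := Fintype.ofFinite V
  set X := T.expVisits f t b φ (B + 1) with hX
  have hXm : ∀ v, Measurable (X v) := hF.measurable_expVisits hφ (B + 1)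
  obtain ⟨c, hc⟩ : ∃ c, ∀ v θ, |X v θ| ≤ c := ⟨_, hF.abs_expVisits_le hφ0 (B + 1)⟩
  let inRate : V → ℝ → ℝ := fun v θ => ∑ a, if T.tgt a = v then f a (θ - T.delay a) else 0
  have hini : ∀ v a, Integrable fun θ => if T.tgt a = v then f a (θ - T.delay a) else 0 :=
    fun v a => by
      split_ifs
      exacts [(hF.integrable a).comp_sub_right _, integrable_zero _ _ _]
  have mulX : ∀ (q : ℝ → ℝ) (v : V), Integrable q → Integrable fun θ => q θ * X v θ :=
    fun q v hq => hq.mul_bdd (c := c) (hXm v).aestronglyMeasurable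
      (Filter.Eventually.of_forall fun θ => hc v θ)
  have h1 : ∀ a, Integrable fun θ => f a θ * if a = b then φ θ else 0 := fun a =>
    (hF.integrable a).mul_bdd (c := 1)
      (by split_ifs; exacts [hφ.aestronglyMeasurable, aestronglyMeasurable_const])
      (Filter.Eventually.of_forall fun θ => by
        have := hφ0 θ
        split_ifs
        · rw [Real.norm_eq_abs, abs_of_nonneg this.1]; exact this.2
        · simp)
  have h2 : ∀ a, Integrable fun θ => f a θ * X (T.tgt a) (θ + T.delay a) := fun a =>
    (hF.integrable a).mul_bdd (c := c)
      ((hXm _).comp (measurable_id.add_const (T.delay a))).aestronglyMeasurable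
      (Filter.Eventually.of_forall fun θ => hc _ _)
  have hout : ∑ v, ∫ θ, T.outRate f v θ * X v θ =
      (∫ θ, f b θ * φ θ) + ∑ v, ∫ θ, inRate v θ * X v θ := by
    have e1 : ∀ v, ∫ θ, T.outRate f v θ * X v θ = ∑ a, if T.src a = v then
        ((∫ θ, f a θ * if a = b then φ θ else 0) +
          ∫ θ, f a θ * X (T.tgt a) (θ + T.delay a)) else 0 := fun v => by
      have e2 : ∀ θ, T.outRate f v θ * X v θ = ∑ a, if T.src a = v then
          (f a θ * (if a = b then φ θ else 0) + f a θ * X (T.tgt a) (θ + T.delay a)) else 0 :=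
        fun θ => by simp only [hX, hF.outRate_mul_expVisits, mul_add]
      simp only [e2]
      rw [integral_finsetSum]
      · refine Finset.sum_congr rfl fun a _ => ?_
        by_cases hv : T.src a = v
        · simp only [if_pos hv]
          exact integral_add (h1 a) (h2 a)
        · simp only [if_neg hv, integral_zero]
      · intro a _
        by_cases hv : T.src a = v
        · simp only [if_pos hv]
          exact (h1 a).add (h2 a)
        · simp only [if_neg hv]
          exact integrable_zero _ _ _
    have e3 : ∀ v, ∫ θ, inRate v θ * X v θ = ∑ a, if T.tgt a = v then
        ∫ θ, f a θ * X (T.tgt a) (θ + T.delay a) else 0 := fun v => by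
      simp only [inRate, Finset.sum_mul]
      rw [integral_finsetSum _ fun a _ => mulX _ v (hini v a)]
      refine Finset.sum_congr rfl fun a _ => ?_
      split_ifs with ha
      · rw [← integral_sub_right_eq_self (fun θ => f a θ * X (T.tgt a) (θ + T.delay a))
          (T.delay a)]
        simp [ha]
      · simp
    rw [Finset.sum_congr rfl fun v _ => e1 v, Finset.sum_congr rfl fun v _ => e3 v,
      Finset.sum_comm, Finset.sum_comm (s := (Finset.univ : Finset V))]
    simp only [Finset.sum_ite_eq, Finset.mem_univ, if_true, Finset.sum_add_distrib]
    congr 1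
    rw [Finset.sum_eq_single b]
    · simp
    · intro a _ ha
      simp [ha]
    · simp
  have hdiff : ∑ v, ((∫ θ, T.outRate f v θ * X v θ) - ∫ θ, inRate v θ * X v θ) =
      ∫ θ, T.outRate f s θ * X s θ := by
    rw [Finset.sum_eq_single s]
    · have h0 : ∀ θ, inRate s θ = 0 := fun θ => Finset.sum_eq_zero fun a _ => by
        split_ifs with ha
        exacts [hF.eq_zero a (Or.inl ha) _, rfl]
      simp [h0]
    · intro v _ hv
      by_cases hvt : v = t
      · have h0 : ∀ θ, X t θ = 0 := hF.expVisits_t b φ B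
        simp [hvt, h0]
      · have h0 : ∀ θ, T.outRate f v θ = inRate v θ := hF.balance v hv hvt
        simp [h0]
    · simp
  rw [Finset.sum_sub_distrib, hout] at hdiff
  rw [← hdiff]
  ring

/-- A flow over time without waiting is the result of departures along routes. -/
theorem exists_isLoading [Finite V] (hF : T.IsFlow s t f K B)
    (hcap : ∀ a θ, f a θ ≤ T.cap a θ) (hsupp : ∃ L : ℝ, ∀ a θ, L < |θ| → f a θ = 0) :
    ∃ h, T.IsLoading s t (∫ θ, T.outRate f s θ) h (fun a ξ => ∫ x in Iic ξ, f a x) f ∧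
      ∀ p ∈ T.routes s t, ∀ θ, 0 < h p θ → T.Carried f p θ := by
  classical
  set U : A → ℝ → ℝ := fun a ξ => ∫ x in Iic ξ, f a x with hU
  have hreach : ∀ l θ, T.reach U f l θ = θ + (l.map T.delay).sum := fun l => by
    induction l with
    | nil => simp [reach]
    | cons a l ih =>
      intro θ
      rw [reach, entryTime_eq_self le_rfl, ih, List.map_cons, List.sum_cons, add_assoc]
  have hhm : ∀ p, Measurable fun θ => T.outRate f s θ * T.weight f p θ := fun p =>
    (hF.measurable_outRate s).mul (hF.measurable_weight p)
  have hhi : ∀ p, Integrable fun θ => T.outRate f s θ * T.weight f p θ := fun p =>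
    (hF.integrable_outRate s).mul_bdd (c := 1) (hF.measurable_weight p).aestronglyMeasurable
      (Filter.Eventually.of_forall fun θ => by
        obtain ⟨h1, h2⟩ := hF.weight_mem p θ
        rwa [Real.norm_eq_abs, abs_of_nonneg h1])
  -- Departures along `p` have the outflow of `s` times the probability of `p`. With `U` the
  -- cumulative flow itself, no queue ever forms.
  refine ⟨fun p θ => T.outRate f s θ * T.weight f p θ, ⟨?_, ?_, ?_, ?_, hF.nonneg, hcap,
    hF.integrable, hsupp, fun _ _ => le_rfl, fun a ξ => ?_, fun a => ?_⟩, fun p _ θ h => ?_⟩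
  · exact fun p _ θ => mul_nonneg (hF.outRate_nonneg s θ) (hF.weight_mem p θ).1
  · exact fun p _ => hhi p
  · rw [← integral_finsetSum _ fun p _ => hhi p]
    refine integral_congr_ae (Filter.Eventually.of_forall fun θ => ?_)
    have h1 := hF.sum_listsUpTo_eq (fun _ => 1) θ
    simp only [mul_one] at h1
    simp only
    rw [← h1]
    rcases (hF.outRate_nonneg s θ).eq_or_lt with h0 | h0
    · rw [← h0, zero_mul]
    · have := hF.arrival_eq_one (B + 1) s θ (Nat.lt_succ_of_le (hF.key_le s θ)) (Or.inr h0)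
      rw [arrival] at this
      rw [this, mul_one]
  · intro b ξ
    -- With this indicator, the expected visits count the users who join the queue of `b` up to time
    -- `ξ`.
    let φ : ℝ → ℝ := fun x => if x ≤ ξ then 1 else 0
    have hφ : Measurable φ := Measurable.ite measurableSet_Iic measurable_const measurable_const
    have hφ0 : ∀ x, 0 ≤ φ x ∧ φ x ≤ 1 := fun x => by simp only [φ]; split_ifs <;> simp
    have h1 := hF.integral_outRate_mul_expVisits (b := b) hφ hφ0
    have h2 : ∫ θ, f b θ * φ θ = U b ξ := by
      show _ = ∫ x in Iic ξ, f b x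
      rw [← integral_indicator measurableSet_Iic]
      congr 1
      ext x
      by_cases hx : x ≤ ξ <;> simp [φ, hx]
    have hterm : ∀ (p : List A) (c : ℝ), Integrable fun θ =>
        T.outRate f s θ * T.weight f p θ * φ (θ + c) := fun p c =>
      (hhi p).mul_bdd (c := 1) (hφ.comp (measurable_id.add_const c)).aestronglyMeasurable
        (Filter.Eventually.of_forall fun θ => by
          obtain ⟨h1, h2⟩ := hφ0 (θ + c)
          show ‖φ (θ + c)‖ ≤ 1
          rwa [Real.norm_eq_abs, abs_of_nonneg h1])
    rw [← h2, ← h1]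
    have h3 : ∀ θ, T.outRate f s θ * T.expVisits f t b φ (B + 1) s θ =
        ∑ p ∈ T.routes s t, ∑ i : Fin p.length, if p.get i = b then
          T.outRate f s θ * T.weight f p θ * φ (θ + ((p.take i).map T.delay).sum) else 0 :=
      fun θ => by
        rw [expVisits, hF.sum_listsUpTo_eq (fun l => T.visits b φ l θ) θ]
        refine Finset.sum_congr rfl fun p _ => ?_
        rw [visits_eq_sum, Finset.mul_sum]
        refine Finset.sum_congr rfl fun i _ => ?_
        split_ifs <;> simp
    have hi : ∀ (p : List A) (i : Fin p.length), Integrable fun θ => if p.get i = b then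
        T.outRate f s θ * T.weight f p θ * φ (θ + ((p.take i).map T.delay).sum) else 0 :=
      fun p i => by
        split_ifs
        exacts [hterm p _, integrable_zero _ _ _]
    simp only [h3]
    rw [integral_finsetSum _ fun p _ => integrable_finsetSum _ fun i _ => hi p i]
    refine Finset.sum_congr rfl fun p _ => ?_
    rw [integral_finsetSum _ fun i _ => hi p i]
    refine Finset.sum_congr rfl fun i _ => ?_
    split_ifs
    · have hset : MeasurableSet {θ | T.reach U f (p.take i) θ ≤ ξ} := by
        simp only [hreach]
        exact (measurable_id.add_const _) measurableSet_Iic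
      rw [← integral_indicator hset]
      congr 1
      ext θ
      by_cases hθ : θ + ((p.take i).map T.delay).sum ≤ ξ
      · rw [indicator_of_mem (by simpa only [mem_ofPred_eq, hreach] using hθ)]
        show _ * (if _ ≤ ξ then (1 : ℝ) else 0) = _
        rw [if_pos hθ, mul_one]
      · rw [indicator_of_notMem (by simpa only [mem_ofPred_eq, hreach] using hθ)]
        show _ * (if _ ≤ ξ then (1 : ℝ) else 0) = _
        rw [if_neg hθ, mul_zero]
    · simp
  · exact setIntegral_le_integral (hF.integrable a) (Filter.Eventually.of_forall (hF.nonneg a))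
  · exact Filter.Eventually.of_forall fun ξ h => absurd h (lt_irrefl _)
  · exact hF.carried_of_weight_ne fun h0 => by simp [h0] at h

end IsFlow

end TolledNetwork

/-! ### Networks with lanes -/

section Tolls

variable {V A : Type*} {T : TolledNetwork V A} {U g : A → ℝ → ℝ}

theorem TolledNetwork.tollSum_nonneg (h0 : ∀ a θ, 0 ≤ T.toll a θ) (p : List A) (θ : ℝ) :
    0 ≤ T.tollSum U g p θ := by
  induction p generalizing θ with
  | nil => exact le_rfl
  | cons a p ih => exact add_nonneg (h0 _ _) (ih _)

theorem TolledNetwork.le_tollSum_of_mem (h0 : ∀ a θ, 0 ≤ T.toll a θ) {M : ℝ} {a : A}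
    (ha : ∀ θ, M ≤ T.toll a θ) {p : List A} (hp : a ∈ p) (θ : ℝ) : M ≤ T.tollSum U g p θ := by
  induction p generalizing θ with
  | nil => simp at hp
  | cons b p ih =>
    rw [TolledNetwork.tollSum]
    rcases List.mem_cons.1 hp with rfl | hp
    · linarith [ha (entryTime (U a) (g a) θ), TolledNetwork.tollSum_nonneg (U := U) (g := g) h0 p
        (entryTime (U a) (g a) θ + T.delay a)]
    · linarith [ih hp (entryTime (U b) (g b) θ + T.delay b), h0 b (entryTime (U b) (g b) θ)]

theorem TolledNetwork.IsLoading.le_cost [Finite A] {s t : V} {Q α : ℝ} {ρ : ℝ → ℝ}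
    {h : List A → ℝ → ℝ} (hL : T.IsLoading s t Q h U g) (hd : ∀ a, 0 ≤ T.delay a) (hα : 0 < α)
    (hρ : ∀ θ, 0 ≤ ρ θ) (h0 : ∀ a θ, 0 ≤ T.toll a θ) {M : ℝ} {a : A} (ha : ∀ θ, M ≤ T.toll a θ)
    {p : List A} (hp : a ∈ p) (θ : ℝ) : M ≤ T.cost α ρ U g p θ := by
  rw [TolledNetwork.cost]
  have h1 := TolledNetwork.le_tollSum_of_mem (U := U) (g := g) h0 ha hp θ
  have h2 := mul_nonneg hα.le (sub_nonneg.2 (hL.le_reach hd p θ))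
  linarith [hρ (T.reach U g p θ)]

end Tolls

namespace Network

variable {V E : Type*} (N : Network V E) {f δ : E → ℝ → ℝ} {M : ℝ}

theorem isWalk_map_fst {u v : V} {p : List (E × Bool)}
    (h : IsWalk (N.withLanes f δ M).src (N.withLanes f δ M).tgt u v p) :
    IsWalk N.src N.tgt u v (p.map Prod.fst) := by
  induction p generalizing u with
  | nil => exact h
  | cons a p ih => exact ⟨h.1, ih h.2⟩

theorem isWalk_map_lane {u v : V} {q : List E} (h : IsWalk N.src N.tgt u v q) :
    IsWalk (N.withLanes f δ M).src (N.withLanes f δ M).tgt u v (q.map fun e => (e, true)) := by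
  induction q generalizing u with
  | nil => exact h
  | cons a p ih => exact ⟨h.1, ih h.2⟩

theorem isPath_map_fst {u v : V} {p : List (E × Bool)}
    (h : IsPath (N.withLanes f δ M).src (N.withLanes f δ M).tgt u v p) :
    IsPath N.src N.tgt u v (p.map Prod.fst) :=
  ⟨N.isWalk_map_fst h.1, by rw [List.map_map]; exact h.2⟩

theorem isPath_map_lane {u v : V} {q : List E} (h : IsPath N.src N.tgt u v q) :
    IsPath (N.withLanes f δ M).src (N.withLanes f δ M).tgt u v (q.map fun e => (e, true)) :=
  ⟨N.isWalk_map_lane h.1, by rw [List.map_map]; exact h.2⟩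

variable {α : ℝ} {ρ : ℝ → ℝ} {U g : E × Bool → ℝ → ℝ} {L : ℝ}

/-- A user who drives on the first lanes after all queues there have vanished is not delayed. -/
theorem cost_map_lane (h : ∀ e θ, L ≤ θ → U (e, true) θ ≤ ∫ x in Iic θ, g (e, true) x)
    (q : List E) (θ : ℝ) (hθ : L ≤ θ) :
    (N.withLanes f δ M).cost α ρ U g (q.map fun e => (e, true)) θ =
      (N.withTolls δ).cost α ρ 0 0 q θ := by
  have key : ∀ θ, L ≤ θ →
      (N.withLanes f δ M).reach U g (q.map fun e => (e, true)) θ =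
        (N.withTolls δ).reach 0 0 q θ ∧
      (N.withLanes f δ M).tollSum U g (q.map fun e => (e, true)) θ =
        (N.withTolls δ).tollSum 0 0 q θ := by
    induction q with
    | nil => exact fun θ _ => ⟨rfl, rfl⟩
    | cons e q ih =>
      intro θ hθ
      -- Zero for `U` and `g` models the empty network, so the right-hand side does not depend on
      -- the equilibrium.
      have h0 : entryTime ((0 : E → ℝ → ℝ) e) ((0 : E → ℝ → ℝ) e) θ = θ :=
        entryTime_eq_self (by simp)
      have h1 : entryTime (U (e, true)) (g (e, true)) θ = θ := entryTime_eq_self (h e θ hθ)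
      have h2 := ih (θ + N.delay e) (by linarith [N.delay_nonneg e])
      rw [List.map_cons, TolledNetwork.reach, TolledNetwork.reach, TolledNetwork.tollSum,
        TolledNetwork.tollSum, h0, h1]
      exact ⟨h2.1, congrArg (δ e θ + ·) h2.2⟩
  rw [TolledNetwork.cost, TolledNetwork.cost, (key θ hθ).1, (key θ hθ).2]

end Network

/-! ### Equilibrium and enforcement in the network with lanes -/

namespace SSPRun

variable {V E : Type*} [Finite V] {N : Network V E} {s t : V} (R : SSPRun N s t) {α : ℝ} {ρ : ℝ → ℝ} {C : ℝ}
  {M : ℝ}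

/-- The network with lanes whose first lanes have the capacities `R.flow` and the tolls `R.toll`. -/
abbrev lanes (α : ℝ) (ρ : ℝ → ℝ) (C M : ℝ) : TolledNetwork V (E × Bool) :=
  N.withLanes (R.flow α ρ C) (R.toll α ρ C) M

/-- The flow that uses only the first lanes. -/
abbrev laneFlow (α : ℝ) (ρ : ℝ → ℝ) (C : ℝ) (a : E × Bool) (θ : ℝ) : ℝ :=
  if a.2 then R.flow α ρ C a.1 θ else 0

theorem lanes_toll_nonneg (hM : 0 ≤ M) (a : E × Bool) (θ : ℝ) :
    0 ≤ (R.lanes α ρ C M).toll a θ := by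
  obtain ⟨e, b⟩ := a
  cases b
  · exact hM
  · exact le_max_right _ _

theorem lane_of_laneFlow_pos {a : E × Bool} {θ : ℝ} (h : 0 < R.laneFlow α ρ C a θ) :
    a.2 = true ∧ 0 < R.flow α ρ C a.1 θ := by
  obtain ⟨e, b⟩ := a
  cases b
  · exact absurd h (lt_irrefl 0)
  · exact ⟨rfl, h⟩

theorem exists_isFlow_lanes [Fintype E] (hN : N.NoZeroDelayCycle) (hρ : IsSchedulingCost α ρ)
    (hα : 0 < α) : ∃ K B, (R.lanes α ρ C M).IsFlow s t (R.laneFlow α ρ C) K B := by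
  classical
  obtain ⟨K, B, h1, h2, h3⟩ := R.exists_key (C := C) hN hρ hα
  refine ⟨K, B, fun a => N.delay_nonneg a.1, ?_, ?_, ?_, ?_, ?_, h1, h2, ?_⟩
  · rintro ⟨e, _ | _⟩ θ
    exacts [le_rfl, R.flow_nonneg hρ hα]
  · rintro ⟨e, _ | _⟩
    exacts [measurable_const, R.measurable_flow hρ e]
  · rintro ⟨e, _ | _⟩
    exacts [integrable_zero _ _ _, R.integrable_flow hρ e]
  · rintro ⟨e, _ | _⟩ he θ
    exacts [rfl, R.flow_eq_zero he]
  · intro v hvs hvt θ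
    have h := R.flow_balance (α := α) (ρ := ρ) (C := C) v θ
    simp only [hvs.symm, hvt.symm, if_false, sub_zero, mul_zero, Finset.sum_const_zero,
      sub_eq_zero] at h
    simp only [TolledNetwork.outRate, Fintype.sum_prod_type, Fintype.sum_bool,
      Network.withLanes, laneFlow]
    simpa using h
  · rintro a θ h
    exact h3 a.1 θ (R.lane_of_laneFlow_pos h).2

theorem integral_outRate_laneFlow [Fintype E] (hst : s ≠ t) (hρ : IsSchedulingCost α ρ) :
    ∫ θ, (R.lanes α ρ C M).outRate (R.laneFlow α ρ C) s θ = R.value α ρ C := by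
  rw [← R.integral_flow_src_s hst hρ]
  refine integral_congr_ae (Filter.Eventually.of_forall fun θ => ?_)
  simp [TolledNetwork.outRate, Fintype.sum_prod_type, laneFlow]
  rfl

/-- The first lane tolls pay for the increase of the potential. -/
theorem potential_sub_le (U g : E × Bool → ℝ → ℝ) (hE : ∀ a θ, entryTime (U a) (g a) θ = θ)
    {v w : V} {p : List (E × Bool)}
    (hp : IsWalk (R.lanes α ρ C M).src (R.lanes α ρ C M).tgt v w p)
    (h1 : ∀ a ∈ p, a.2 = true) (θ : ℝ) :
    R.potential α ρ C w ((R.lanes α ρ C M).reach U g p θ) - R.potential α ρ C v θ ≤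
      α * ((R.lanes α ρ C M).reach U g p θ - θ) + (R.lanes α ρ C M).tollSum U g p θ := by
  induction p generalizing v θ with
  | nil =>
    obtain rfl : v = w := hp
    simp [TolledNetwork.reach, TolledNetwork.tollSum]
  | cons a p ih =>
    obtain ⟨e, b⟩ := a
    obtain rfl : b = true := h1 _ List.mem_cons_self
    obtain ⟨rfl, hp⟩ := hp
    have h2 := ih hp (fun a ha => h1 a (List.mem_cons_of_mem _ ha)) (θ + N.delay e)
    have h3 : R.potential α ρ C (N.tgt e) (θ + N.delay e) - R.potential α ρ C (N.src e) θ
      - α * N.delay e ≤ R.toll α ρ C e θ := le_max_left _ _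
    rw [TolledNetwork.reach, TolledNetwork.tollSum, hE]
    have h4 : (R.lanes α ρ C M).toll (e, true) θ = R.toll α ρ C e θ := rfl
    have h5 : (R.lanes α ρ C M).delay (e, true) = N.delay e := rfl
    have h6 : (R.lanes α ρ C M).src (e, true) = N.src e := rfl
    have h7 : (R.lanes α ρ C M).tgt (e, true) = N.tgt e := rfl
    rw [h4, h5, h6]
    rw [h7] at h2
    linarith

/-- On flow-carrying arcs the positive part in the toll is superfluous by complementary slackness,
so the inequality of `potential_sub_le` becomes an equality. The last arc supplies the bound on `ρ`
under which the potential at `t` is known. -/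
theorem potential_sub_eq [Finite E] (hα : 0 < α) (hρ : IsSchedulingCost α ρ) (U g : E × Bool → ℝ → ℝ)
    (hE : ∀ a θ, entryTime (U a) (g a) θ = θ) {v : V} {p : List (E × Bool)}
    (hp : IsWalk (R.lanes α ρ C M).src (R.lanes α ρ C M).tgt v t p) {θ : ℝ}
    (hc : (R.lanes α ρ C M).Carried (R.laneFlow α ρ C) p θ) :
    R.potential α ρ C t ((R.lanes α ρ C M).reach U g p θ) - R.potential α ρ C v θ =
      α * ((R.lanes α ρ C M).reach U g p θ - θ) + (R.lanes α ρ C M).tollSum U g p θ ∧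
    (p ≠ [] → ρ ((R.lanes α ρ C M).reach U g p θ) ≤ C) := by
  induction p generalizing v θ with
  | nil =>
    obtain rfl : v = t := hp
    simp [TolledNetwork.reach, TolledNetwork.tollSum]
  | cons a p ih =>
    obtain ⟨e, b⟩ := a
    obtain ⟨h0, hf⟩ := R.lane_of_laneFlow_pos hc.1
    obtain rfl : b = true := h0
    obtain ⟨rfl, hp⟩ := hp
    obtain ⟨h2, h8⟩ := ih hp hc.2
    have h3 : R.toll α ρ C e θ = R.potential α ρ C (N.tgt e) (θ + N.delay e) -
        R.potential α ρ C (N.src e) θ - α * N.delay e :=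
      max_eq_left (by linarith [R.potential_src_add_le hα hρ hf])
    rw [TolledNetwork.reach, TolledNetwork.tollSum, hE]
    have h4 : (R.lanes α ρ C M).toll (e, true) θ = R.toll α ρ C e θ := rfl
    have h5 : (R.lanes α ρ C M).delay (e, true) = N.delay e := rfl
    have h6 : (R.lanes α ρ C M).src (e, true) = N.src e := rfl
    have h7 : (R.lanes α ρ C M).tgt (e, true) = N.tgt e := rfl
    rw [h5, h7] at h2
    rw [h5] at h8
    rw [h4, h5, h6]
    refine ⟨by linarith, fun _ => ?_⟩
    by_cases hnil : p = []
    · subst hnil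
      exact R.rho_le_of_flow_pos hα hρ hp hf
    · exact h8 hnil

/-- The potential rises from `0` at `s` to at least `C - ρ` at `t`, and commuting cost and tolls pay
for the rise. Thus first-lane routes cost at least `C`, exactly `C` for those who travel with the
flow, and one second lane alone costs `M ≥ C`. -/
theorem isDynamicEquilibrium_laneFlow [Fintype E] (hst : s ≠ t)
    (hN : N.NoZeroDelayCycle) (hα : 0 < α) (hρ : IsSchedulingCost α ρ) (hM : 0 ≤ M)
    (hCM : C ≤ M) :
    (R.lanes α ρ C M).IsDynamicEquilibrium s t α ρ (R.value α ρ C) (R.laneFlow α ρ C) := by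
  obtain ⟨K, B, hF⟩ := R.exists_isFlow_lanes (C := C) (M := M) hN hρ hα
  obtain ⟨L, hLs⟩ := R.exists_flow_support (C := C) hρ
  obtain ⟨h, hL, hcar⟩ := hF.exists_isLoading (by
    rintro ⟨e, _ | _⟩ θ
    · exact sub_nonneg.2 (R.flow_le_cap hρ hα)
    · exact le_rfl) ⟨L, by
    rintro ⟨e, _ | _⟩ θ hθ
    · rfl
    · exact hLs e θ hθ⟩
  rw [R.integral_outRate_laneFlow hst hρ] at hL
  have hE : ∀ a θ, entryTime (fun ξ => ∫ x in Iic ξ, R.laneFlow α ρ C a x)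
      (R.laneFlow α ρ C a) θ = θ := fun a θ => entryTime_eq_self le_rfl
  refine ⟨h, _, C, hL, fun p hp θ => ?_, fun p hp => Filter.Eventually.of_forall fun θ hθ => ?_⟩
  · by_cases h2 : ∀ a ∈ p, a.2 = true
    · have h3 := R.potential_sub_le (fun a ξ => ∫ x in Iic ξ, R.laneFlow α ρ C a x)
        (R.laneFlow α ρ C) hE (TolledNetwork.mem_routes.1 hp).1 h2 θ
      rw [R.potential_s hα hρ] at h3
      have h4 := R.le_potential_at_t (ρ := ρ) (C := C) hα
        (θ := (R.lanes α ρ C M).reach (fun a ξ => ∫ x in Iic ξ, R.laneFlow α ρ C a x)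
        (R.laneFlow α ρ C) p θ)
      rw [TolledNetwork.cost]
      linarith
    · push Not at h2
      obtain ⟨⟨e, b⟩, ha, hb⟩ := h2
      obtain rfl : b = false := by simpa using hb
      exact hCM.trans (hL.le_cost (fun a => N.delay_nonneg a.1) hα hρ.nonneg
        (R.lanes_toll_nonneg hM) (fun _ => le_rfl) ha θ)
  · have hw := (TolledNetwork.mem_routes.1 hp).1
    obtain ⟨h3, h4⟩ := R.potential_sub_eq hα hρ (fun a ξ => ∫ x in Iic ξ, R.laneFlow α ρ C a x)
        (R.laneFlow α ρ C) hE hw (hcar p hp θ hθ)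
    have h5 := h4 fun hnil => hst (by subst hnil; exact hw)
    rw [R.potential_s hα hρ, R.potential_at_t hα hρ h5] at h3
    rw [TolledNetwork.cost]
    linarith

/-- If the toll of the second lanes exceeds the cost of waiting until the first lanes are empty,
then nobody uses the second lanes. -/
theorem second_lane_unused [Finite E] (hα : 0 < α) (hρ : IsSchedulingCost α ρ) (hM : 0 ≤ M)
    {Q L : ℝ} (hLs : ∀ e θ, L < |θ| → R.flow α ρ C e θ = 0)
    (hcost : ∀ q ∈ (N.withTolls (R.toll α ρ C)).routes s t,
      (N.withTolls (R.toll α ρ C)).cost α ρ 0 0 q L < M)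
    {h : List (E × Bool) → ℝ → ℝ} {U g : E × Bool → ℝ → ℝ} {c : ℝ}
    (hL : (R.lanes α ρ C M).IsLoading s t Q h U g)
    (hc : ∀ p ∈ (R.lanes α ρ C M).routes s t, ∀ θ, c ≤ (R.lanes α ρ C M).cost α ρ U g p θ)
    (hc' : ∀ p ∈ (R.lanes α ρ C M).routes s t, ∀ᵐ θ, 0 < h p θ →
      (R.lanes α ρ C M).cost α ρ U g p θ = c) (e : E) :
    ∀ᵐ θ, g (e, false) θ = 0 := by
  classical
  -- From time `L` on the first lanes have capacity zero. As everybody is served, all who ever join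
  -- a queue there have entered before.
  have hU : ∀ e θ, L ≤ θ → U (e, true) θ ≤ ∫ x in Iic θ, g (e, true) x := fun e θ hθ => by
    rw [setIntegral_Iic_eq_integral (fun x hx => ?_) hθ]
    · exact hL.served _ _
    · refine le_antisymm ?_ (hL.entry_nonneg _ _)
      rw [← hLs e x (hx.trans_le (le_abs_self x))]
      exact hL.entry_le_cap (e, true) x
  have h0 : ∀ p ∈ (R.lanes α ρ C M).routes s t, (e, false) ∈ p → h p =ᵐ[volume] 0 := by
    intro p hp he
    have hp1 := N.isPath_map_fst (TolledNetwork.mem_routes.1 hp)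
    -- The deviation: depart at time `L` and use the first lanes of the same arcs.
    have h1 := hc _ (TolledNetwork.mem_routes.2 (N.isPath_map_lane hp1)) L
    rw [N.cost_map_lane hU _ L le_rfl] at h1
    have h2 := hcost _ (TolledNetwork.mem_routes.2 hp1)
    filter_upwards [hc' p hp] with θ hθ
    refine le_antisymm (not_lt.1 fun hpos => ?_) (hL.departure_nonneg p hp θ)
    have h3 := hL.le_cost (fun a => N.delay_nonneg a.1) hα hρ.nonneg
        (R.lanes_toll_nonneg hM) (fun _ => le_rfl) he θ
    rw [hθ hpos] at h3
    exact absurd (h1.trans_lt h2) (not_lt.2 h3)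
  have hU0 : ∀ ξ, U (e, false) ξ = 0 := fun ξ => by
    rw [hL.queue_inflow]
    refine Finset.sum_eq_zero fun p hp => Finset.sum_eq_zero fun i _ => ?_
    split_ifs with hi
    · exact integral_eq_zero_of_ae (ae_restrict_of_ae (h0 p hp (hi ▸ List.get_mem p i)))
    · rfl
  obtain ⟨K, hK⟩ := hL.entry_compact
  have h1 : ∫ x, g (e, false) x = 0 := by
    refine le_antisymm ?_ (integral_nonneg (hL.entry_nonneg _))
    rw [← setIntegral_Iic_eq_integral (fun x hx => hK _ x (hx.trans_le (le_abs_self x))) le_rfl,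
      ← hU0 K]
    exact hL.queue_nonneg _ _
  exact (integral_eq_zero_iff_of_nonneg (hL.entry_nonneg _) (hL.entry_integrable _)).1 h1

/-- An equilibrium on the first lanes is the flow computed by the algorithm. -/
theorem first_lane_eq [Fintype E] (hst : s ≠ t) (hN : N.NoZeroDelayCycle) (hα : 0 < α)
    (hρ : IsSchedulingCost α ρ) {h : List (E × Bool) → ℝ → ℝ} {U g : E × Bool → ℝ → ℝ}
    (hL : (R.lanes α ρ C M).IsLoading s t (R.value α ρ C) h U g)
    (h0 : ∀ e, ∀ᵐ θ, g (e, false) θ = 0) (e : E) :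
    ∀ᵐ θ, g (e, true) θ = R.flow α ρ C e θ := by
  have h1 : ∀ e ξ, ∫ x in Iic ξ, g (e, false) x = 0 := fun e ξ =>
    integral_eq_zero_of_ae (ae_restrict_of_ae (h0 e))
  have h2 : ∀ e, ∫ x, g (e, false) x = 0 := fun e => integral_eq_zero_of_ae (h0 e)
  refine R.flow_unique hst hN hα hρ (g := fun e => g (e, true)) (fun e => hL.entry_nonneg _)
    (fun e θ => hL.entry_le_cap (e, true) θ) (fun e => hL.entry_integrable _)
    (fun v hv ξ => ?_) ?_ e
  · have h3 := hL.outflow_le_inflow hv ξ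
    simp only [Fintype.sum_prod_type, Fintype.sum_bool, h1, ite_self, add_zero] at h3
    exact h3
  · have h3 := hL.value_le hst
    simp only [Fintype.sum_prod_type, Fintype.sum_bool, h2, ite_self, add_zero] at h3
    exact h3

end SSPRun

end LaneTolls

/-! ### The theorem -/

theorem mainTheorem5 {V E : Type*} [Finite V] [Finite E] (N : LaneTolls.Network V E) (s t : V)
    (hst : s ≠ t) (hN : N.NoZeroDelayCycle)
    (α : ℝ) (hα : 0 < α) (ρ : ℝ → ℝ) (hρ : LaneTolls.IsSchedulingCost α ρ)
    (R : LaneTolls.SSPRun N s t) (C Q : ℝ) (hQ : R.value α ρ C = Q) :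
    (∀ g : E → ℝ → ℝ,
      (N.withTolls (R.toll α ρ C)).IsDynamicEquilibrium s t α ρ Q g →
      (∀ e θ, g e θ ≤ R.flow α ρ C e θ) →
      ∀ e, ∀ᵐ θ : ℝ, g e θ = R.flow α ρ C e θ) ∧
    ∃ M₀ : ℝ, 0 ≤ M₀ ∧ ∀ M : ℝ, M₀ ≤ M →
      (N.withLanes (R.flow α ρ C) (R.toll α ρ C) M).IsDynamicEquilibrium s t α ρ Q
        (fun a θ => if a.2 then R.flow α ρ C a.1 θ else 0) ∧
      ∀ g : E × Bool → ℝ → ℝ,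
        (N.withLanes (R.flow α ρ C) (R.toll α ρ C) M).IsDynamicEquilibrium s t α ρ Q g →
        ∀ e, (∀ᵐ θ : ℝ, g (e, true) θ = R.flow α ρ C e θ) ∧
          (∀ᵐ θ : ℝ, g (e, false) θ = 0) := by
  have := Fintype.ofFinite E
  subst hQ
  refine ⟨fun g ⟨h, U, c, hL, _, _⟩ hgf => R.flow_unique hst hN hα hρ hL.entry_nonneg hgf
    hL.entry_integrable (fun v hv ξ => hL.outflow_le_inflow hv ξ) (hL.value_le hst), ?_⟩
  obtain ⟨L, hLs⟩ := R.exists_flow_support (C := C) hρ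
  set F := (N.withTolls (R.toll α ρ C)).routes s t
  set k := fun q => |(N.withTolls (R.toll α ρ C)).cost α ρ 0 0 q L|
  have hk : 0 ≤ ∑ q ∈ F, k q := Finset.sum_nonneg fun q _ => abs_nonneg _
  -- The sum dominates the cost of each free route at time `L`, the summand `|C|` ensures `C ≤ M`,
  -- and `1` makes the comparison with `M` strict.
  refine ⟨1 + |C| + ∑ q ∈ F, k q, by positivity, fun M hM => ?_⟩
  have hC := le_abs_self C
  have hC' := abs_nonneg C
  have hM0 : 0 ≤ M := by linarith
  refine ⟨R.isDynamicEquilibrium_laneFlow hst hN hα hρ hM0 (by linarith),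
    fun g ⟨h, U, c, hL, hc, hc'⟩ => ?_⟩
  have h0 := R.second_lane_unused hα hρ hM0 hLs (fun q hq => by
    have h1 : k q ≤ ∑ q ∈ F, k q := Finset.single_le_sum (fun q _ => abs_nonneg _) hq
    have h2 := le_abs_self ((N.withTolls (R.toll α ρ C)).cost α ρ 0 0 q L)
    linarith) hL hc hc'
  exact fun e => ⟨R.first_lane_eq hst hN hα hρ hL h0 e, h0 e⟩

end
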